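/- Let $\Omega\subset\mathbb{R}^n$, $n=2$ or $3$, be a bounded domain (nonempty, open, connected) with Lipschitz boundary, $dS$ the surface measure on $\partial\Omega$, and $\nu$ the outward unit normal. Let $L^\infty_+(\Omega)=\{\gamma\in L^\infty(\Omega):\operatorname{ess\,inf}\gamma>0\}$, $L^2_\diamond(\partial\Omega)=\{f\in L^2(\partial\Omega):\int_{\partial\Omega}f\,dS=0\}$, $H^1_\diamond(\Omega)=\{w\in H^1(\Omega): w|_{\partial\Omega}\in L^2_\diamond(\partial\Omega)\}$ and $\mathbb{R}^k_\diamond=\{W\in\mathbb{R}^k:\sum_j W_j=0\}$. *Continuum model.* For $\gamma\in L^\infty_+(\Omega)$ and $f\in L^2_\diamond(\partial\Omega)$ there is a unique weak solution $u\in H^1_\diamond(\Omega)$ of $\nabla\cdot(\gamma\nabla u)=0$ in $\Omega$, $\nu\cdot\gamma\nabla u=f$ on $\partial\Omega$, i.e. $\int_\Omega\gamma\nabla u\cdot\nabla w\,dx=\int_{\partial\Omega}fw\,dS$ for all $w\in H^1(\Omega)$, and $\Lambda(\gamma):f\mapsto u|_{\partial\Omega}$ is a bounded linear operator on $L^2_\diamond(\partial\Omega)$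 (the Neumann-to-Dirichlet, ND, map). *Complete electrode model (CEM).* Let $k\ge1$, let $E_1,\dots,E_k\subseteq\partial\Omega$ be nonempty, connected, relatively open and mutually disjoint, and let $z_1,\dots,z_k>0$. For $\gamma\in L^\infty_+(\Omega)$ and $I\in\mathbb{R}^k_\diamond$ there is a unique weak solution $(v,V)\in H^1(\Omega)\oplus\mathbb{R}^k_\diamond$ of $\nabla\cdot(\gamma\nabla v)=0$ in $\Omega$, $\nu\cdot\gamma\nabla v=0$ on $\partial\Omega\setminus\bigcup_jE_j$, $v+z_j\,\nu\cdot\gamma\nabla v=V_j$ on $E_j$, $\int_{E_j}\nu\cdot\gamma\nabla v\,dS=I_j$, i.e. $\int_\Omega\gamma\nabla v\cdot\nabla w\,dx+\sum_j\int_{E_j}\frac1{z_j}(v-V_j)(w-W_j)\,dS=\sum_jI_jW_j$ for all $(w,W)\in H^1(\Omega)\oplus\mathbb{R}^k_\diamond$, and $R(\gamma):I\mapsto V$ is a linear operator on $\mathbb{R}^k_\diamond$ (the CEM measurement map). Then the maps $\gamma\mapsto\Lambda(\gamma)\in\mathcal{L}(L^2_\diamond(\partial\Omega))$ and $\gamma\mapsto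 R(\gamma)\in\mathcal{L}(\mathbb{R}^k_\diamond)$ are (real) analytic on the open set $L^\infty_+(\Omega)\subset L^\infty(\Omega)$, with respect to the operator norms; in particular they are infinitely many times Fréchet differentiable. Moreover, let $\gamma\in L^\infty_+(\Omega)$ and let $\eta\in L^\infty(\Omega)$ be compactly supported in $\Omega$. Let $u$ and $(v,V)$ be the weak solutions above for given $f\in L^2_\diamond(\partial\Omega)$ and $I\in\mathbb{R}^k_\diamond$. Then the problem $$\nabla\cdot(\gamma\nabla u')=-\nabla\cdot(\eta\nabla u)\ \text{in }\Omega,\qquad \nu\cdot\gamma\nabla u'=0\ \text{on }\partial\Omega,$$ has a unique solution $u'\in H^1_\diamond(\Omega)$, the problem $$\nabla\cdot(\gamma\nabla v')=-\nabla\cdot(\eta\nabla v)\ \text{in }\Omega,\quad \nu\cdot\gamma\nabla v'=0\ \text{on }\partial\Omega\setminus\textstyle\bigcup_jE_j,\quad v'+z_j\,\nu\cdot\gamma\nabla v'=V'_j\ \text{on }E_j,\quad \int_{E_j}\nu\cdot\gamma\nabla v'\,dS=0\quad(j=1,\dots,k)$$ has a unique solution $(v',V')\in H^1(\Omega)\oplus\mathbb{R}^k_\diamond$,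 and $$(\Lambda'(\gamma)\eta)f=u'|_{\partial\Omega},\qquad (R'(\gamma)\eta)I=V'.$$ In the last two problems the equation in $\Omega$ is meant in the sense of distributions, the conditions on parts of $\partial\Omega$ almost everywhere, and $\nu\cdot\gamma\nabla u'=g\in L^2(\partial\Omega)$ means that $\int_\Omega\gamma\nabla u'\cdot\nabla\varphi\,dx=\int_{\partial\Omega}g\varphi\,dS$ for all smooth $\varphi$ supported in some fixed neighbourhood of $\partial\Omega$. -/

import Mathlib

open MeasureTheory Filter Topology

noncomputable section

namespace EIT

/-- Euclidean space `ℝⁿ`. -/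
abbrev Space (n : ℕ) : Type := EuclideanSpace ℝ (Fin n)

/-- `∂Ω` is Lipschitz: near each of its points, in a suitable direction `e`, the set `Ω` is the
strict epigraph of a Lipschitz function `ψ` of the component orthogonal to `e`. -/
def HasLipschitzBoundary {n : ℕ} (Ω : Set (Space n)) : Prop :=
  ∀ x ∈ frontier Ω, ∃ e : Space n, ‖e‖ = 1 ∧ ∃ (L : NNReal) (ψ : Space n → ℝ),
    LipschitzWith L ψ ∧ ∃ r > 0, ∀ y ∈ Metric.ball x r,
      (y ∈ Ω ↔ ψ (y - (inner ℝ e y : ℝ) • e) < inner ℝ e y)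

/-- A bounded domain (nonempty, open, connected) with Lipschitz boundary. -/
structure IsBoundedLipschitzDomain {n : ℕ} (Ω : Set (Space n)) : Prop where
  isOpen : IsOpen Ω
  isConnected : IsConnected Ω
  isBounded : Bornology.IsBounded Ω
  lipschitz : HasLipschitzBoundary Ω

/-- Lebesgue measure on `Ω`. -/
abbrev vol {n : ℕ} (Ω : Set (Space n)) : Measure (Space n) := volume.restrict Ω

/-- The surface measure `dS` on `∂Ω`: the `(n-1)`-dimensional Hausdorff measure, in the Euclidean
normalization. -/
abbrev surf {n : ℕ} (Ω : Set (Space n)) : Measure (Space n) :=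
  (Measure.euclideanHausdorffMeasure (n - 1)).restrict (frontier Ω)

/-- Smooth functions with compact support contained in `Ω`. -/
def IsTestFunction {n : ℕ} (Ω : Set (Space n)) (φ : Space n → ℝ) : Prop :=
  ContDiff ℝ (⊤ : ℕ∞) φ ∧ HasCompactSupport φ ∧ tsupport φ ⊆ Ω

/-- `G` is the weak gradient of `u` in `Ω`. -/
def IsWeakGradient {n : ℕ} (Ω : Set (Space n)) (u : Space n → ℝ) (G : Space n → Space n) : Prop :=
  ∀ φ : Space n → ℝ, IsTestFunction Ω φ → ∀ e : Space n,
    ∫ x, u x * fderiv ℝ φ x e ∂(vol Ω) = - ∫ x, (inner ℝ (G x) e : ℝ) * φ x ∂(vol Ω)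

theorem IsTestFunction.memLp {n : ℕ} {Ω : Set (Space n)} {φ : Space n → ℝ}
    (h : IsTestFunction Ω φ) : MemLp φ 2 (vol Ω) :=
  (h.1.continuous.memLp_of_hasCompactSupport h.2.1).restrict _

theorem IsTestFunction.memLp_fderiv {n : ℕ} {Ω : Set (Space n)} {φ : Space n → ℝ}
    (h : IsTestFunction Ω φ) (e : Space n) : MemLp (fun x => fderiv ℝ φ x e) 2 (vol Ω) := by
  have hc : Continuous (fun x => fderiv ℝ φ x e) :=
    (h.1.continuous_fderiv (by simp)).clm_apply continuous_const
  have hs : HasCompactSupport (fun x => fderiv ℝ φ x e) := h.2.1.fderiv_apply ℝ e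
  exact (hc.memLp_of_hasCompactSupport hs).restrict _

theorem integrable_test_left {n : ℕ} {Ω : Set (Space n)} {φ : Space n → ℝ}
    (h : IsTestFunction Ω φ) (e : Space n) (u : Lp ℝ 2 (vol Ω)) :
    Integrable (fun x => u x * fderiv ℝ φ x e) (vol Ω) :=
  (Lp.memLp u).integrable_mul (h.memLp_fderiv e)

theorem integrable_test_right {n : ℕ} {Ω : Set (Space n)} {φ : Space n → ℝ}
    (h : IsTestFunction Ω φ) (e : Space n) (G : Lp (Space n) 2 (vol Ω)) :
    Integrable (fun x => (inner ℝ (G x) e : ℝ) * φ x) (vol Ω) :=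
  ((Lp.memLp G).inner_const e).integrable_mul h.memLp

/-- The Sobolev space `H¹(Ω)`: pairs `(u, ∇u)` of square integrable classes, `∇u` being the weak
gradient of `u`, with the norm `(‖u‖² + ‖∇u‖²)^{1/2}`. -/
def H1 {n : ℕ} (Ω : Set (Space n)) :
    Submodule ℝ (WithLp 2 (Lp ℝ 2 (vol Ω) × Lp (Space n) 2 (vol Ω))) where
  carrier := {p | IsWeakGradient Ω p.fst p.snd}
  zero_mem' := by
    intro φ _ e
    have h1 : ∫ x, (0 : Lp ℝ 2 (vol Ω)) x * fderiv ℝ φ x e ∂(vol Ω) = 0 := by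
      refine integral_eq_zero_of_ae ?_
      filter_upwards [Lp.coeFn_zero ℝ 2 (vol Ω)] with x hx
      rw [hx]
      simp
    have h2 : ∫ x, (inner ℝ ((0 : Lp (Space n) 2 (vol Ω)) x) e : ℝ) * φ x ∂(vol Ω) = 0 := by
      refine integral_eq_zero_of_ae ?_
      filter_upwards [Lp.coeFn_zero (Space n) 2 (vol Ω)] with x hx
      rw [hx]
      simp
    rw [WithLp.zero_fst, WithLp.zero_snd, h1, h2, neg_zero]
  add_mem' := by
    intro p q hp hq φ hφ e
    have h1 : ∫ x, (p.fst + q.fst) x * fderiv ℝ φ x e ∂(vol Ω)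
        = ∫ x, p.fst x * fderiv ℝ φ x e ∂(vol Ω) + ∫ x, q.fst x * fderiv ℝ φ x e ∂(vol Ω) := by
      rw [← integral_add (integrable_test_left hφ e _) (integrable_test_left hφ e _)]
      refine integral_congr_ae ?_
      filter_upwards [Lp.coeFn_add p.fst q.fst] with x hx
      rw [hx, Pi.add_apply, add_mul]
    have h2 : ∫ x, (inner ℝ ((p.snd + q.snd) x) e : ℝ) * φ x ∂(vol Ω)
        = ∫ x, (inner ℝ (p.snd x) e : ℝ) * φ x ∂(vol Ω)
          + ∫ x, (inner ℝ (q.snd x) e : ℝ) * φ x ∂(vol Ω) := by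
      rw [← integral_add (integrable_test_right hφ e _) (integrable_test_right hφ e _)]
      refine integral_congr_ae ?_
      filter_upwards [Lp.coeFn_add p.snd q.snd] with x hx
      rw [hx, Pi.add_apply, inner_add_left, add_mul]
    rw [WithLp.add_fst, WithLp.add_snd, h1, h2, hp φ hφ e, hq φ hφ e, neg_add]
  smul_mem' := by
    intro c p hp φ hφ e
    have h1 : ∫ x, (c • p.fst) x * fderiv ℝ φ x e ∂(vol Ω)
        = c * ∫ x, p.fst x * fderiv ℝ φ x e ∂(vol Ω) := by
      rw [← integral_const_mul]
      refine integral_congr_ae ?_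
      filter_upwards [Lp.coeFn_smul c p.fst] with x hx
      rw [hx, Pi.smul_apply, smul_eq_mul, mul_assoc]
    have h2 : ∫ x, (inner ℝ ((c • p.snd) x) e : ℝ) * φ x ∂(vol Ω)
        = c * ∫ x, (inner ℝ (p.snd x) e : ℝ) * φ x ∂(vol Ω) := by
      rw [← integral_const_mul]
      refine integral_congr_ae ?_
      filter_upwards [Lp.coeFn_smul c p.snd] with x hx
      rw [hx, Pi.smul_apply, real_inner_smul_left, mul_assoc]
    rw [WithLp.smul_fst, WithLp.smul_snd, h1, h2, hp φ hφ e, mul_neg]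

/-- The function underlying an element of `H¹(Ω)`. -/
def fn {n : ℕ} {Ω : Set (Space n)} (u : H1 Ω) : Lp ℝ 2 (vol Ω) := (u.1).fst

/-- The weak gradient `∇u` of an element of `H¹(Ω)`. -/
def wgrad {n : ℕ} {Ω : Set (Space n)} (u : H1 Ω) : Lp (Space n) 2 (vol Ω) := (u.1).snd

/-- `g ∈ L²(∂Ω)` is the trace of `u ∈ H¹(Ω)`: there are smooth functions `φ m` on `ℝⁿ` with
`φ m → u` in `H¹(Ω)` and `φ m|_{∂Ω} → g` in `L²(∂Ω)`. -/
def IsTrace {n : ℕ} (Ω : Set (Space n)) (u : H1 Ω) (g : Lp ℝ 2 (surf Ω)) : Prop :=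
  ∃ φ : ℕ → Space n → ℝ, (∀ m, ContDiff ℝ (⊤ : ℕ∞) (φ m)) ∧
    Tendsto (fun m => eLpNorm (fun x => φ m x - fn u x) 2 (vol Ω)) atTop (𝓝 0) ∧
    Tendsto (fun m => eLpNorm (fun x => gradient (φ m) x - wgrad u x) 2 (vol Ω)) atTop (𝓝 0) ∧
    Tendsto (fun m => eLpNorm (fun x => φ m x - g x) 2 (surf Ω)) atTop (𝓝 0)

open Classical in
/-- The trace `u|_{∂Ω}` (on a bounded Lipschitz domain every `u ∈ H¹(Ω)` has exactly one). -/
def trace {n : ℕ} {Ω : Set (Space n)} (u : H1 Ω) : Lp ℝ 2 (surf Ω) :=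
  if h : ∃ g, IsTrace Ω u g then h.choose else 0

/-- `L^∞(Ω)`. -/
abbrev Linfty {n : ℕ} (Ω : Set (Space n)) : Type := Lp ℝ ⊤ (vol Ω)

/-- `L^∞_+(Ω)`: the elements of `L^∞(Ω)` with positive essential infimum. -/
def LinftyPlus {n : ℕ} (Ω : Set (Space n)) : Set (Linfty Ω) :=
  {γ | ∃ c : ℝ, 0 < c ∧ ∀ᵐ x ∂(vol Ω), c ≤ γ x}

/-- `η ∈ L^∞(Ω)` is compactly supported in `Ω`: it vanishes almost everywhere off some compact
subset of `Ω`. -/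
def CompactlySupported {n : ℕ} {Ω : Set (Space n)} (η : Linfty Ω) : Prop :=
  ∃ K : Set (Space n), IsCompact K ∧ K ⊆ Ω ∧ ∀ᵐ x ∂(vol Ω), x ∉ K → η x = 0

/-- `L²_⋄(∂Ω)`: the square integrable functions on `∂Ω` with vanishing mean. (On a bounded
Lipschitz domain the surface measure is finite and the integrability is automatic.) -/
def L2Diamond {n : ℕ} (Ω : Set (Space n)) : Submodule ℝ (Lp ℝ 2 (surf Ω)) where
  carrier := {g | Integrable g (surf Ω) ∧ ∫ x, g x ∂(surf Ω) = 0}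
  zero_mem' := by
    refine ⟨(integrable_congr (Lp.coeFn_zero ℝ 2 (surf Ω))).2 (integrable_zero _ _ _), ?_⟩
    rw [integral_congr_ae (Lp.coeFn_zero ℝ 2 (surf Ω))]
    simp
  add_mem' := by
    rintro f g ⟨hf, hf0⟩ ⟨hg, hg0⟩
    refine ⟨(integrable_congr (Lp.coeFn_add f g)).2 (hf.add hg), ?_⟩
    rw [integral_congr_ae (Lp.coeFn_add f g)]
    simp only [Pi.add_apply]
    rw [integral_add hf hg, hf0, hg0, add_zero]
  smul_mem' := by
    rintro c f ⟨hf, hf0⟩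
    refine ⟨(integrable_congr (Lp.coeFn_smul c f)).2 (hf.smul c), ?_⟩
    rw [integral_congr_ae (Lp.coeFn_smul c f)]
    simp only [Pi.smul_apply]
    rw [integral_smul, hf0, smul_zero]

/-- `∫_Ω a ∇u · ∇w dx`. -/
def energy {n : ℕ} {Ω : Set (Space n)} (a : Linfty Ω) (u w : H1 Ω) : ℝ :=
  ∫ x, a x * (inner ℝ (wgrad u x) (wgrad w x) : ℝ) ∂(vol Ω)

/-! ### The continuum model -/

/-- `u ∈ H¹_⋄(Ω)` is the weak solution of `∇·(γ∇u) = 0` in `Ω`, `ν·γ∇u = f` on `∂Ω`. -/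
def IsCMSolution {n : ℕ} {Ω : Set (Space n)} (γ : Linfty Ω) (f : L2Diamond Ω) (u : H1 Ω) : Prop :=
  trace u ∈ L2Diamond Ω ∧
    ∀ w : H1 Ω, energy γ u w = ∫ x, f.1 x * trace w x ∂(surf Ω)

/-- `T` is the Neumann-to-Dirichlet map `f ↦ u|_{∂Ω}` of the conductivity `γ`. -/
def IsNDMap {n : ℕ} {Ω : Set (Space n)} (γ : Linfty Ω)
    (T : L2Diamond Ω →L[ℝ] L2Diamond Ω) : Prop :=
  ∀ f : L2Diamond Ω, ∃ u : H1 Ω, IsCMSolution γ f u ∧ trace u = (T f : Lp ℝ 2 (surf Ω))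

open Classical in
/-- The Neumann-to-Dirichlet map `Λ(γ)`, as a bounded operator on `L²_⋄(∂Ω)`. -/
def ndMap {n : ℕ} (Ω : Set (Space n)) (γ : Linfty Ω) : L2Diamond Ω →L[ℝ] L2Diamond Ω :=
  if h : ∃ T, IsNDMap γ T then h.choose else 0

/-! ### The complete electrode model -/

/-- `ℝ^k_⋄`: the vectors in `ℝ^k` whose components sum to zero. -/
def RDiamond (k : ℕ) : Submodule ℝ (EuclideanSpace ℝ (Fin k)) where
  carrier := {W | ∑ j, W j = 0}
  zero_mem' := by simp
  add_mem' := by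
    intro V W (hV : ∑ j, V j = 0) (hW : ∑ j, W j = 0)
    change ∑ j, (V + W) j = 0
    simp [Finset.sum_add_distrib, hV, hW]
  smul_mem' := by
    intro c V (hV : ∑ j, V j = 0)
    change ∑ j, (c • V) j = 0
    simp [← Finset.mul_sum, hV]

/-- Electrodes: (relatively) open, connected, mutually disjoint subsets of `∂Ω`. -/
structure IsElectrodes {n k : ℕ} (Ω : Set (Space n)) (E : Fin k → Set (Space n)) : Prop where
  relOpen : ∀ j, ∃ U : Set (Space n), IsOpen U ∧ E j = U ∩ frontier Ω
  connected : ∀ j, IsConnected (E j)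
  disjoint : ∀ i j, i ≠ j → Disjoint (E i) (E j)

/-- `(v, V) ∈ H¹(Ω) ⊕ ℝ^k_⋄` is the weak solution of the complete electrode model with conductivity
`γ`, contact impedances `z` and net currents `I`:
`∇·(γ∇v) = 0` in `Ω`, `ν·γ∇v = 0` on `∂Ω` off the electrodes, `v + z_j ν·γ∇v = V_j` on `E_j` and
`∫_{E_j} ν·γ∇v dS = I_j`. -/
def IsCEMSolution {n k : ℕ} {Ω : Set (Space n)} (E : Fin k → Set (Space n)) (z : Fin k → ℝ)
    (γ : Linfty Ω) (I : RDiamond k) (v : H1 Ω) (V : RDiamond k) : Prop :=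
  ∀ (w : H1 Ω) (W : RDiamond k),
    energy γ v w +
      ∑ j, ∫ x in E j, 1 / z j * ((trace v x - V.1 j) * (trace w x - W.1 j)) ∂(surf Ω)
    = ∑ j, I.1 j * W.1 j

/-- `T` is the measurement map `I ↦ V` of the complete electrode model. -/
def IsCEMMap {n k : ℕ} {Ω : Set (Space n)} (E : Fin k → Set (Space n)) (z : Fin k → ℝ)
    (γ : Linfty Ω) (T : RDiamond k →L[ℝ] RDiamond k) : Prop :=
  ∀ I : RDiamond k, ∃ v : H1 Ω, IsCEMSolution E z γ I v (T I)

open Classical in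
/-- The measurement map `R(γ)` of the complete electrode model, as a bounded operator on
`ℝ^k_⋄`. -/
def cemMap {n k : ℕ} (Ω : Set (Space n)) (E : Fin k → Set (Space n)) (z : Fin k → ℝ)
    (γ : Linfty Ω) : RDiamond k →L[ℝ] RDiamond k :=
  if h : ∃ T, IsCEMMap E z γ T then h.choose else 0

/-! ### The sensitivity problems -/

/-- `∇·(γ∇u') = -∇·(η∇u)` in `Ω`, in the sense of distributions. -/
def SensitivityEq {n : ℕ} {Ω : Set (Space n)} (γ η : Linfty Ω) (u u' : H1 Ω) : Prop :=
  ∀ φ : Space n → ℝ, IsTestFunction Ω φ →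
    ∫ x, γ x * (inner ℝ (wgrad u' x) (gradient φ x) : ℝ) ∂(vol Ω)
      = - ∫ x, η x * (inner ℝ (wgrad u x) (gradient φ x) : ℝ) ∂(vol Ω)

/-- `ν·γ∇u = g` on `∂Ω` in the weak sense, for a field `γ∇u` that is divergence free near `∂Ω`:
Green's formula `∫_Ω γ∇u·∇φ dx = ∫_{∂Ω} g φ dS` holds for all smooth `φ` supported in some fixed
neighbourhood of `∂Ω`. -/
def HasConormalDerivative {n : ℕ} {Ω : Set (Space n)} (γ : Linfty Ω) (u : H1 Ω)
    (g : Lp ℝ 2 (surf Ω)) : Prop :=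
  ∃ U : Set (Space n), IsOpen U ∧ frontier Ω ⊆ U ∧
    ∀ φ : Space n → ℝ, ContDiff ℝ (⊤ : ℕ∞) φ → tsupport φ ⊆ U →
      ∫ x, γ x * (inner ℝ (wgrad u x) (gradient φ x) : ℝ) ∂(vol Ω) = ∫ x, g x * φ x ∂(surf Ω)

/-- `u' ∈ H¹_⋄(Ω)` solves `∇·(γ∇u') = -∇·(η∇u)` in `Ω`, `ν·γ∇u' = 0` on `∂Ω`. -/
def IsCMSensitivity {n : ℕ} {Ω : Set (Space n)} (γ η : Linfty Ω) (u u' : H1 Ω) : Prop :=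
  trace u' ∈ L2Diamond Ω ∧ SensitivityEq γ η u u' ∧ HasConormalDerivative γ u' 0

/-- `(v', V') ∈ H¹(Ω) ⊕ ℝ^k_⋄` solves `∇·(γ∇v') = -∇·(η∇v)` in `Ω`, `ν·γ∇v' = 0` on `∂Ω` off the
electrodes, `v' + z_j ν·γ∇v' = V'_j` on `E_j`, and `∫_{E_j} ν·γ∇v' dS = 0`; here `g` is
`ν·γ∇v'`. -/
def IsCEMSensitivity {n k : ℕ} {Ω : Set (Space n)} (E : Fin k → Set (Space n)) (z : Fin k → ℝ)
    (γ η : Linfty Ω) (v : H1 Ω) (v' : H1 Ω) (V' : RDiamond k) : Prop :=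
  SensitivityEq γ η v v' ∧
    ∃ g : Lp ℝ 2 (surf Ω), HasConormalDerivative γ v' g ∧
      (∀ᵐ x ∂(surf Ω), x ∉ ⋃ j, E j → g x = 0) ∧
      (∀ j, ∀ᵐ x ∂(surf Ω), x ∈ E j → trace v' x + z j * g x = V'.1 j) ∧
      ∀ j, ∫ x in E j, g x ∂(surf Ω) = 0

end EIT

end

/-!
Both models are, in weak form, one linear equation `(B + A γ) u = S f` in a Hilbert space: `A γ` is
the operator of the energy form `∫_Ω γ ∇u·∇w`, which is linear and bounded in `γ`, `B` is a fixed
operator coming from the boundary, `S` turns the data into a functional, and the measurement is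
`T u` for a bounded operator `T`. For `γ ∈ L^∞_+(Ω)` the operator `B + A γ` is coercive, hence
invertible, so `γ ↦ T (B + A γ)⁻¹ S` is analytic because inversion is (`analyticAt_solOp`), and its
derivative in the direction `η` is `T u'`, where `(B + A γ) u' = -A η u` (`fderiv_solOp_apply`).

For the continuum model the space is `H¹(Ω)` and `B` is the form `(∫_{∂Ω} u dS) (∫_{∂Ω} w dS)`. It
replaces the constraint of vanishing mean: it makes the form coercive on all of `H¹(Ω)`, and testing
with the constant one shows that the mean of the solution vanishes by itself (`meanOp_add_eq_iff`).
For the complete electrode model the space is `H¹(Ω) ⊕ ℝ^k_⋄` and `B` is the contact term on the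
electrodes; coercivity uses that electrodes have positive surface measure (`surf_pos`), so that the
energy bounds the differences between the mean of `v` and the voltages `V_j`, while `∑_j V_j = 0`
bounds the mean itself (`isUnit_electrodeOp_add`).

The analytic input on a Lipschitz domain is obtained by elementary means.
* In a boundary chart, moving in the direction in which `Ω` is an epigraph gives a bound of surface
  integrals by volume integrals (`exists_chart`) and, with a one-dimensional inequality, the trace
  inequality (`trace_inequality`).
* The cone property (`exists_cone`) allows one to mollify after a small translation into `Ω`, so
  smooth functions on `ℝⁿ` are dense in `H¹(Ω)` (`exists_contDiff_approx`), and traces exist and are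
  unique (`trace_eq_traceL`).
* The Poincaré inequality is proved in the form that the mean square of `f(y) - f(z)` over `Ω × Ω` is
  controlled by the Dirichlet integral. Locally this follows by integrating along segments into a
  common ball; connectedness of `Ω` and compactness of its closure make it global (`linked_self`).

Finally, for `η` supported in a compact subset of `Ω`, the sensitivity problems, formulated with
distributions in `Ω` and conormal derivatives on `∂Ω`, are equivalent to the weak form
`∫ γ ∇u'·∇w = -∫ η ∇u·∇w + ∫_{∂Ω} g w dS` for all `w ∈ H¹(Ω)`: by density `w` may be taken smooth,
and a smooth function splits on `Ω` into a test function and a function supported near `∂Ω`, off the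
support of `η` (`sensitivityEq_and_hasConormalDerivative_iff`). This is the equation for `u'` above.
-/

noncomputable section

namespace EIT

/-! ### Geometry of Lipschitz domains -/

section Graph

variable {n : ℕ} {Ω : Set (Space n)} {x e : Space n} {ψ : Space n → ℝ} {L : NNReal} {r : ℝ}

theorem norm_sub_inner_smul_le (he : ‖e‖ = 1) (v : Space n) :
    ‖v - (inner ℝ e v : ℝ) • e‖ ≤ ‖v‖ := by
  have h : ‖v - (inner ℝ e v : ℝ) • e‖ ^ 2 ≤ ‖v‖ ^ 2 := by
    rw [norm_sub_sq_real, norm_smul, he, real_inner_smul_right, real_inner_comm]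
    simp only [Real.norm_eq_abs, mul_one, sq_abs]
    nlinarith [sq_nonneg (inner ℝ e v : ℝ)]
  exact (sq_le_sq₀ (norm_nonneg _) (norm_nonneg _)).1 h

/-- The height of a point over the graph of `ψ` in the direction `e`. -/
def heightOver (e : Space n) (ψ : Space n → ℝ) (y : Space n) : ℝ :=
  inner ℝ e y - ψ (y - (inner ℝ e y : ℝ) • e)

theorem continuous_heightOver (hψ : LipschitzWith L ψ) : Continuous (heightOver e ψ) := by
  have := hψ.continuous
  unfold heightOver
  fun_prop

theorem heightOver_add_smul (he : ‖e‖ = 1) (y : Space n) (t : ℝ) :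
    heightOver e ψ (y + t • e) = heightOver e ψ y + t := by
  have h : (inner ℝ e (y + t • e) : ℝ) = inner ℝ e y + t := by
    rw [inner_add_right, real_inner_smul_right, real_inner_self_eq_norm_sq, he]; simp
  have h2 : y + t • e - ((inner ℝ e y : ℝ) + t) • e = y - (inner ℝ e y : ℝ) • e := by
    rw [add_smul]; abel
  rw [heightOver, heightOver, h, h2]; ring

/-- Where `Ω` is the strict epigraph of `ψ`, its boundary is the graph of `ψ`. -/
theorem mem_frontier_iff_heightOver (he : ‖e‖ = 1) (hψ : LipschitzWith L ψ) (hΩ : IsOpen Ω)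
    (h : ∀ y ∈ Metric.ball x r, (y ∈ Ω ↔ 0 < heightOver e ψ y)) {y : Space n}
    (hy : y ∈ Metric.ball x r) : y ∈ frontier Ω ↔ heightOver e ψ y = 0 := by
  rw [hΩ.frontier_eq]
  constructor
  · rintro ⟨hc, hn⟩
    rw [h y hy, not_lt] at hn
    refine le_antisymm hn (not_lt.1 fun hlt => ?_)
    obtain ⟨w, ⟨hw1, hw2⟩, hw3⟩ := mem_closure_iff.1 hc
      (Metric.ball x r ∩ {w | heightOver e ψ w < 0})
      (Metric.isOpen_ball.inter (isOpen_lt (continuous_heightOver hψ) continuous_const)) ⟨hy, hlt⟩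
    exact absurd ((h w hw1).1 hw3) (not_lt.2 (le_of_lt hw2))
  · intro h0
    refine ⟨?_, by rw [h y hy, h0]; exact lt_irrefl _⟩
    have ht : Tendsto (fun t : ℝ => y + t • e) (𝓝[>] 0) (𝓝 y) := by
      have : Continuous (fun t : ℝ => y + t • e) := by fun_prop
      have := (this.tendsto 0).mono_left (nhdsWithin_le_nhds (s := Set.Ioi 0))
      simpa using this
    refine mem_closure_of_tendsto ht ?_
    filter_upwards [ht (Metric.isOpen_ball.mem_nhds hy), self_mem_nhdsWithin] with t ht1 ht2
    rw [h _ ht1, heightOver_add_smul he, h0, zero_add]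
    exact ht2

end Graph

/-- The uniform cone property at a point `x` of the closure: near `x`, the points that are within
`ε` of a translate `y + ε e` of a point `y` of `Ω` belong to `Ω`. In the interior `e = 0` works;
at the boundary `e` is a multiple of the direction in which `Ω` is an epigraph. -/
theorem IsBoundedLipschitzDomain.exists_cone {n : ℕ} {Ω : Set (Space n)}
    (hΩ : IsBoundedLipschitzDomain Ω) {x : Space n} (hx : x ∈ closure Ω) :
    ∃ (e : Space n) (r : ℝ), 0 < r ∧ ∀ y ∈ Ω, ∀ z ∈ Metric.ball x r, ∀ ε : ℝ, 0 < ε → ε < r →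
      ‖z - y - ε • e‖ ≤ ε → z ∈ Ω := by
  by_cases hxΩ : x ∈ Ω
  · obtain ⟨r, hr, hb⟩ := Metric.isOpen_iff.1 hΩ.isOpen x hxΩ
    exact ⟨0, r, hr, fun y _ z hz _ _ _ _ => hb hz⟩
  have hxf : x ∈ frontier Ω := by rw [hΩ.isOpen.frontier_eq]; exact ⟨hx, hxΩ⟩
  obtain ⟨e, he, L, ψ, hψ, ρ, hρ, h⟩ := hΩ.lipschitz x hxf
  have hL : (0 : ℝ) ≤ L := L.2
  refine ⟨((L : ℝ) + 2) • e, ρ / (L + 4), by positivity, ?_⟩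
  intro y hy z hz ε hε hεr hzy
  rw [lt_div_iff₀ (by positivity)] at hεr
  rw [Metric.mem_ball, lt_div_iff₀ (by positivity)] at hz
  set d := z - y - ε • (((L : ℝ) + 2) • e) with hd
  have hyd : z = y + d + (ε * (L + 2)) • e := by
    rw [hd, smul_smul]; abel
  have hzball : z ∈ Metric.ball x ρ := by
    rw [Metric.mem_ball]
    nlinarith [dist_nonneg (x := z) (y := x)]
  have hyball : y ∈ Metric.ball x ρ := by
    rw [Metric.mem_ball]
    have h1 : dist y z ≤ ε + ε * (L + 2) := by
      rw [dist_comm, dist_eq_norm]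
      have : z - y = d + (ε * (L + 2)) • e := by rw [hyd]; abel
      rw [this]
      refine (norm_add_le _ _).trans (add_le_add hzy ?_)
      rw [norm_smul, he, mul_one, Real.norm_of_nonneg (by positivity)]
    have h2 := dist_triangle y z x
    have h3 : dist z x * (L + 4) + ε * (L + 4) < ρ * (1 + 1) := by linarith
    by_contra hcon
    rw [not_lt] at hcon
    have h4 : dist z x < ρ / (L + 4) := by rwa [lt_div_iff₀ (by positivity)]
    have h5 : ε < ρ / (L + 4) := by rwa [lt_div_iff₀ (by positivity)]
    have h6 : ρ / (L + 4) * (L + 4) = ρ := by field_simp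
    nlinarith
  have hyh := (h y hyball).1 hy
  rw [h z hzball]
  have hinner : (inner ℝ e z : ℝ) = inner ℝ e y + inner ℝ e d + ε * (L + 2) := by
    rw [hyd, inner_add_right, inner_add_right, real_inner_smul_right,
      real_inner_self_eq_norm_sq, he]
    ring
  have hdiff : (z - (inner ℝ e z : ℝ) • e) - (y - (inner ℝ e y : ℝ) • e)
      = d - (inner ℝ e d : ℝ) • e := by
    rw [hinner]; nth_rewrite 1 [hyd]; simp only [add_smul]; abel
  have h1 : ψ (z - (inner ℝ e z : ℝ) • e) ≤ ψ (y - (inner ℝ e y : ℝ) • e) + L * ε := by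
    have := hψ.dist_le_mul (z - (inner ℝ e z : ℝ) • e) (y - (inner ℝ e y : ℝ) • e)
    rw [dist_eq_norm, dist_eq_norm, hdiff, Real.norm_eq_abs] at this
    have h2 := (norm_sub_inner_smul_le he d).trans hzy
    have h3 := mul_le_mul_of_nonneg_left h2 hL
    linarith [le_abs_self (ψ (z - (inner ℝ e z : ℝ) • e) - ψ (y - (inner ℝ e y : ℝ) • e))]
  have h2 : -ε ≤ (inner ℝ e d : ℝ) := by
    have := abs_real_inner_le_norm e d
    rw [he, one_mul] at this
    linarith [neg_abs_le (inner ℝ e d : ℝ)]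
  nlinarith

/-! ### The surface measure in graph coordinates -/

section Hyperplane

variable {n : ℕ} {e : Space n}

/-- The hyperplane orthogonal to `e`. -/
abbrev hyperplane (e : Space n) : Submodule ℝ (Space n) := (Submodule.span ℝ {e})ᗮ

theorem sub_inner_smul_mem_hyperplane (he : ‖e‖ = 1) (y : Space n) :
    y - (inner ℝ e y : ℝ) • e ∈ hyperplane e := by
  rw [Submodule.mem_orthogonal_singleton_iff_inner_right, inner_sub_right, real_inner_smul_right,
    real_inner_self_eq_norm_sq, he]
  simp

theorem inner_coe_hyperplane (p : hyperplane e) : (inner ℝ e (p : Space n) : ℝ) = 0 :=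
  Submodule.mem_orthogonal_singleton_iff_inner_right.1 p.2

/-- The orthogonal splitting of `ℝⁿ` into the hyperplane orthogonal to the unit vector `e` and the
line of `e`. -/
def hyperplaneProdEquiv (he : ‖e‖ = 1) : (hyperplane e × ℝ) ≃L[ℝ] Space n :=
  LinearEquiv.toContinuousLinearEquiv
    { toFun := fun q => (q.1 : Space n) + q.2 • e
      invFun := fun y => (⟨y - (inner ℝ e y : ℝ) • e, sub_inner_smul_mem_hyperplane he y⟩,
        inner ℝ e y)
      map_add' := fun q q' => by
        simp only [Prod.fst_add, Prod.snd_add, Submodule.coe_add, add_smul]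
        abel
      map_smul' := fun c q => by simp [smul_smul]
      left_inv := fun q => by
        have h : (inner ℝ e ((q.1 : Space n) + q.2 • e) : ℝ) = q.2 := by
          rw [inner_add_right, inner_coe_hyperplane, real_inner_smul_right,
            real_inner_self_eq_norm_sq, he]; simp
        ext
        · simp [h]
        · simp [h]
      right_inv := fun y => by simp }

theorem finrank_hyperplane (he : ‖e‖ = 1) : Module.finrank ℝ (hyperplane e) = n - 1 := by
  have h0 : e ≠ 0 := by rintro rfl; simp at he
  have h1 := Submodule.finrank_add_finrank_orthogonal (Submodule.span ℝ {e})
  rw [finrank_span_singleton h0, finrank_euclideanSpace_fin] at h1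
  change 1 + Module.finrank ℝ (hyperplane e) = n at h1
  omega

/-- The surface measure of a hyperplane. -/
abbrev hypMeasure (e : Space n) : Measure (hyperplane e) :=
  Measure.euclideanHausdorffMeasure (n - 1)

theorem isAddHaarMeasure_hypMeasure (he : ‖e‖ = 1) : (hypMeasure e).IsAddHaarMeasure := by
  rw [hypMeasure, ← finrank_hyperplane he]; infer_instance

/-- Fubini's theorem along the direction `e`. The constant `c` relates the product of the Hausdorff
measure of the hyperplane and the Lebesgue measure of the line to Lebesgue measure; that it is
finite, by uniqueness of Haar measure, is all that is needed. -/
theorem lintegral_hyperplane (he : ‖e‖ = 1) : ∃ c : ENNReal, c ≠ ⊤ ∧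
    ∀ F : Space n → ENNReal, Measurable F →
      ∫⁻ p : hyperplane e, ∫⁻ t : ℝ, F (p + t • e) ∂(volume) ∂(hypMeasure e) = c * ∫⁻ y, F y := by
  have := isAddHaarMeasure_hypMeasure he
  set μ := ((hypMeasure e).prod (volume : Measure ℝ)).map (hyperplaneProdEquiv he) with hμ
  have hH : μ.IsAddHaarMeasure := ContinuousLinearEquiv.isAddHaarMeasure_map _ _
  have heq := Measure.isAddLeftInvariant_eq_smul μ (volume : Measure (Space n))
  refine ⟨_, ENNReal.coe_ne_top (r := Measure.addHaarScalarFactor μ volume), fun F hF => ?_⟩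
  have hm : Measurable (hyperplaneProdEquiv he) := (hyperplaneProdEquiv he).continuous.measurable
  have h1 : ∫⁻ y, F y ∂μ
      = ∫⁻ p : hyperplane e, ∫⁻ t : ℝ, F (p + t • e) ∂(volume) ∂(hypMeasure e) := by
    rw [hμ, lintegral_map hF hm,
      lintegral_prod (fun a => F (hyperplaneProdEquiv he a)) (hF.comp hm).aemeasurable]
    rfl
  rw [← h1, ← smul_eq_mul, ← ENNReal.smul_def, ← lintegral_smul_measure, ← heq]

theorem euclideanHausdorffMeasure_image_le {X Y : Type*} [EMetricSpace X] [EMetricSpace Y]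
    [MeasurableSpace X] [BorelSpace X] [MeasurableSpace Y] [BorelSpace Y] {K : NNReal} {f : X → Y}
    (hf : LipschitzWith K f) (d : ℕ) (s : Set X) :
    (Measure.euclideanHausdorffMeasure d : Measure Y) (f '' s)
      ≤ (K : ENNReal) ^ d * (Measure.euclideanHausdorffMeasure d : Measure X) s := by
  rw [Measure.euclideanHausdorffMeasure_def, Measure.euclideanHausdorffMeasure_def,
    Measure.smul_apply, Measure.smul_apply, ENNReal.smul_def, ENNReal.smul_def, smul_eq_mul,
    smul_eq_mul, mul_left_comm]
  have := hf.hausdorffMeasure_image_le (Nat.cast_nonneg d) s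
  rw [ENNReal.rpow_natCast] at this
  gcongr

end Hyperplane

section Chart

variable {n : ℕ} {Ω : Set (Space n)}

/-- Near a boundary point the surface measure is controlled by Lebesgue measure: sweeping the
boundary in a direction `e` transversal to it gives at most a multiple of the volume. -/
theorem IsBoundedLipschitzDomain.exists_chart (hΩ : IsBoundedLipschitzDomain Ω) {x : Space n}
    (hx : x ∈ frontier Ω) : ∃ (e : Space n) (r : ℝ) (C : ENNReal), ‖e‖ = 1 ∧ 0 < r ∧ C ≠ ⊤ ∧
      (∀ y ∈ frontier Ω ∩ Metric.ball x r, ∀ t : ℝ, 0 < t → t < r → y + t • e ∈ Ω) ∧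
      ∀ F : Space n → ENNReal, Measurable F →
        ∫⁻ y in Metric.ball x r, ∫⁻ t : ℝ, F (y + t • e) ∂(volume) ∂(surf Ω) ≤ C * ∫⁻ y, F y := by
  obtain ⟨e, he, L, ψ, hψ, ρ, hρ, h⟩ := hΩ.lipschitz x hx
  have h' : ∀ y ∈ Metric.ball x ρ, (y ∈ Ω ↔ 0 < heightOver e ψ y) := fun y hy => by
    rw [h y hy, heightOver, sub_pos]
  have hfr := fun {y} => mem_frontier_iff_heightOver (y := y) he hψ hΩ.isOpen h'
  obtain ⟨c, hc, hcF⟩ := lintegral_hyperplane he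
  set G : hyperplane e → Space n := fun p => (p : Space n) + ψ p • e with hG
  have hGL : LipschitzWith (1 + L) G := by
    refine LipschitzWith.add (LipschitzWith.subtype_val _) ?_
    refine LipschitzWith.of_dist_le_mul fun p q => ?_
    rw [dist_eq_norm, ← sub_smul, norm_smul, he, mul_one, ← dist_eq_norm]
    exact hψ.dist_le_mul _ _
  -- The boundary near `x` is the image of a piece of the hyperplane under the Lipschitz map `G`.
  have hle : (surf Ω).restrict (Metric.ball x ρ)
      ≤ ((1 + L : NNReal) : ENNReal) ^ (n - 1) • (hypMeasure e).map G := by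
    refine Measure.le_iff.2 fun s hs => ?_
    rw [Measure.restrict_apply hs, Measure.restrict_apply (hs.inter measurableSet_ball),
      Measure.smul_apply, Measure.map_apply hGL.continuous.measurable hs, smul_eq_mul]
    refine (measure_mono ?_).trans (euclideanHausdorffMeasure_image_le hGL (n - 1) (G ⁻¹' s))
    rintro y ⟨⟨hys, hyb⟩, hyf⟩
    have h0 := (hfr hyb).1 hyf
    have hGy : G ⟨y - (inner ℝ e y : ℝ) • e, sub_inner_smul_mem_hyperplane he y⟩ = y := by
      rw [heightOver, sub_eq_zero] at h0
      simp only [hG]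
      rw [← h0]; abel
    exact ⟨_, by rw [Set.mem_preimage, hGy]; exact hys, hGy⟩
  refine ⟨e, ρ / 2, ((1 + L : NNReal) : ENNReal) ^ (n - 1) * c, he, by positivity,
    ENNReal.mul_ne_top (ENNReal.pow_ne_top ENNReal.coe_ne_top) hc, ?_, fun F hF => ?_⟩
  · rintro y ⟨hyf, hyb⟩ t ht htρ
    rw [Metric.mem_ball] at hyb
    have hyb' : y ∈ Metric.ball x ρ := by rw [Metric.mem_ball]; linarith
    rw [h' _ ?_, heightOver_add_smul he, (hfr hyb').1 hyf]
    · linarith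
    · rw [Metric.mem_ball, dist_eq_norm] at *
      calc ‖y + t • e - x‖ = ‖(y - x) + t • e‖ := by congr 1; abel
        _ ≤ ‖y - x‖ + ‖t • e‖ := norm_add_le _ _
        _ < ρ := by rw [norm_smul, he, mul_one, Real.norm_of_nonneg ht.le]; linarith
  · have hFm : Measurable (fun y => ∫⁻ t : ℝ, F (y + t • e)) := by
      refine Measurable.lintegral_prod_right' (f := fun q : Space n × ℝ => F (q.1 + q.2 • e)) ?_
      exact hF.comp (by fun_prop)
    calc ∫⁻ y in Metric.ball x (ρ / 2), ∫⁻ t : ℝ, F (y + t • e) ∂(volume) ∂(surf Ω)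
        ≤ ∫⁻ y in Metric.ball x ρ, ∫⁻ t : ℝ, F (y + t • e) ∂(volume) ∂(surf Ω) :=
          lintegral_mono_set (Metric.ball_subset_ball (by linarith))
      _ ≤ ∫⁻ y, ∫⁻ t : ℝ, F (y + t • e) ∂(volume)
            ∂(((1 + L : NNReal) : ENNReal) ^ (n - 1) • (hypMeasure e).map G) :=
          lintegral_mono' hle le_rfl
      _ = ((1 + L : NNReal) : ENNReal) ^ (n - 1) *
            ∫⁻ p, ∫⁻ t : ℝ, F (G p + t • e) ∂(volume) ∂(hypMeasure e) := by
          rw [lintegral_smul_measure, lintegral_map hFm hGL.continuous.measurable, smul_eq_mul]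
      _ = ((1 + L : NNReal) : ENNReal) ^ (n - 1) *
            ∫⁻ p : hyperplane e, ∫⁻ t : ℝ, F (p + t • e) ∂(volume) ∂(hypMeasure e) := by
          -- translation invariance on each line removes the height `ψ p`
          congr 1
          refine lintegral_congr fun p => ?_
          rw [← lintegral_add_left_eq_self (μ := (volume : Measure ℝ))
            (fun t => F (p + t • e)) (ψ p)]
          simp only [hG, add_smul, add_assoc]
      _ = _ := by rw [hcF F hF, mul_assoc]

theorem IsBoundedLipschitzDomain.isCompact_frontier (hΩ : IsBoundedLipschitzDomain Ω) :
    IsCompact (frontier Ω) :=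
  Metric.isCompact_of_isClosed_isBounded isClosed_frontier
    (hΩ.isBounded.closure.subset frontier_subset_closure)

/-- Sweeping the boundary near `x` over a unit length stays in a ball, which has finite volume;
`∂Ω` is compact. -/
theorem IsBoundedLipschitzDomain.isFiniteMeasure_surf (hΩ : IsBoundedLipschitzDomain Ω) :
    IsFiniteMeasure (surf Ω) := by
  have hloc : ∀ x ∈ frontier Ω, ∃ t ∈ 𝓝[frontier Ω] x, surf Ω t < ⊤ := by
    intro x hx
    obtain ⟨e, r, C, he, hr, hC, -, hF⟩ := hΩ.exists_chart hx
    refine ⟨Metric.ball x r, mem_nhdsWithin_of_mem_nhds (Metric.ball_mem_nhds x hr), ?_⟩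
    have h1 := hF ((Metric.ball x (r + 1)).indicator 1)
      (measurable_one.indicator measurableSet_ball)
    rw [lintegral_indicator_one measurableSet_ball] at h1
    have h2 : ∫⁻ y in Metric.ball x r, 1 ∂(surf Ω) ≤ ∫⁻ y in Metric.ball x r,
        ∫⁻ t : ℝ, (Metric.ball x (r + 1)).indicator 1 (y + t • e) ∂(volume) ∂(surf Ω) := by
      refine setLIntegral_mono' measurableSet_ball fun y hy => ?_
      calc (1 : ENNReal) = ∫⁻ t : ℝ, (Set.Ioo 0 1).indicator 1 t := by
            rw [lintegral_indicator_one measurableSet_Ioo]; simp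
        _ ≤ _ := by
          refine lintegral_mono fun t => ?_
          refine Set.indicator_apply_le' (fun ht => ?_) (fun _ => zero_le)
          rw [Set.indicator_of_mem]; · simp
          rw [Metric.mem_ball, dist_eq_norm] at *
          calc ‖y + t • e - x‖ = ‖(y - x) + t • e‖ := by congr 1; abel
            _ ≤ ‖y - x‖ + ‖t • e‖ := norm_add_le _ _
            _ < r + 1 := by
              rw [norm_smul, he, mul_one, Real.norm_of_nonneg ht.1.le]
              linarith [ht.2]
    rw [setLIntegral_one] at h2
    refine (h2.trans h1).trans_lt (ENNReal.mul_lt_top hC.lt_top ?_)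
    exact measure_ball_lt_top
  refine ⟨?_⟩
  have := hΩ.isCompact_frontier.measure_lt_top_of_nhdsWithin hloc
  rw [surf, Measure.restrict_apply_univ]
  rwa [Measure.restrict_apply_self] at this

/-- Relatively open subsets of the boundary have positive surface measure: their orthogonal
projection to the hyperplane of the chart contains a ball. -/
theorem IsBoundedLipschitzDomain.surf_pos (hΩ : IsBoundedLipschitzDomain Ω) {x : Space n}
    (hx : x ∈ frontier Ω) {U : Set (Space n)} (hU : IsOpen U) (hxU : x ∈ U) : 0 < surf Ω U := by
  obtain ⟨e, he, L, ψ, hψ, ρ, hρ, h⟩ := hΩ.lipschitz x hx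
  have h' : ∀ y ∈ Metric.ball x ρ, (y ∈ Ω ↔ 0 < heightOver e ψ y) := fun y hy => by
    rw [h y hy, heightOver, sub_pos]
  have hfr := fun {y} => mem_frontier_iff_heightOver (y := y) he hψ hΩ.isOpen h'
  have := isAddHaarMeasure_hypMeasure he
  set G : hyperplane e → Space n := fun p => (p : Space n) + ψ p • e with hG
  have hGc : Continuous G := by
    have := hψ.continuous
    fun_prop
  -- The projection along `e` is a left inverse of the graph map `G` and does not increase the
  -- Hausdorff measure.
  set π : Space n → hyperplane e :=
    fun y => ⟨y - (inner ℝ e y : ℝ) • e, sub_inner_smul_mem_hyperplane he y⟩ with hπ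
  have hπL : LipschitzWith 1 π := by
    refine LipschitzWith.of_dist_le_mul fun y z => ?_
    rw [NNReal.coe_one, one_mul, Subtype.dist_eq, dist_eq_norm, dist_eq_norm]
    refine le_trans (le_of_eq ?_) (norm_sub_inner_smul_le he (y - z))
    simp only [hπ, inner_sub_right, sub_smul]
    congr 1; abel
  have hπG : ∀ p, π (G p) = p := fun p => by
    have : (inner ℝ e ((p : Space n) + ψ p • e) : ℝ) = ψ p := by
      rw [inner_add_right, inner_coe_hyperplane, real_inner_smul_right,
        real_inner_self_eq_norm_sq, he]; simp
    ext1
    simp only [hπ, hG, this]; abel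
  have hGx : G (π x) = x := by
    have h0 := (hfr (Metric.mem_ball_self hρ)).1 hx
    rw [heightOver, sub_eq_zero] at h0
    simp only [hG, hπ]
    rw [← h0]; abel
  set V : Set (hyperplane e) := G ⁻¹' (U ∩ Metric.ball x ρ) with hV
  have hVo : IsOpen V := (hU.inter Metric.isOpen_ball).preimage hGc
  have hVpos : 0 < hypMeasure e V :=
    hVo.measure_pos _ ⟨π x, by rw [hV, Set.mem_preimage, hGx]; exact ⟨hxU, Metric.mem_ball_self hρ⟩⟩
  rw [Measure.restrict_apply hU.measurableSet]
  have hsub : V ⊆ π '' (U ∩ frontier Ω) := by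
    intro p hp
    refine ⟨G p, ⟨hp.1, (hfr hp.2).2 ?_⟩, hπG p⟩
    have h1 : (G p : Space n) - (inner ℝ e (G p) : ℝ) • e = p := congrArg Subtype.val (hπG p)
    have h2 : (inner ℝ e (G p) : ℝ) = ψ p := by
      simp only [hG, inner_add_right, inner_coe_hyperplane, real_inner_smul_right,
        real_inner_self_eq_norm_sq, he]; simp
    rw [heightOver, h1, h2, sub_self]
  have := (measure_mono hsub).trans
    (euclideanHausdorffMeasure_image_le hπL (n - 1) (U ∩ frontier Ω))
  simp only [ENNReal.coe_one, one_pow, one_mul] at this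
  exact hVpos.trans_le this

end Chart

/-! ### Gradients of continuously differentiable functions -/

section Gradient

variable {n : ℕ}

theorem continuous_gradient {f : Space n → ℝ} (hf : ContDiff ℝ 1 f) : Continuous (gradient f) :=
  (InnerProductSpace.toDual ℝ (Space n)).symm.continuous.comp (hf.continuous_fderiv one_ne_zero)

theorem enorm_fderiv_apply_le (f : Space n → ℝ) (y v : Space n) :
    ‖fderiv ℝ f y v‖ₑ ≤ ‖gradient f y‖ₑ * ‖v‖ₑ := by
  rw [← inner_gradient_left, ← ofReal_norm, ← ofReal_norm, ← ofReal_norm,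
    ← ENNReal.ofReal_mul (norm_nonneg _)]
  exact ENNReal.ofReal_le_ofReal (norm_inner_le_norm _ _)

theorem hasDerivAt_comp_line {f : Space n → ℝ} (hf : ContDiff ℝ 1 f) (y v : Space n) (t : ℝ) :
    HasDerivAt (fun s : ℝ => f (y + s • v)) (fderiv ℝ f (y + t • v) v) t := by
  have h1 : HasDerivAt (fun s : ℝ => y + s • v) v t := by
    simpa using ((hasDerivAt_id t).smul_const v).const_add y
  exact (hf.differentiable one_ne_zero _).hasFDerivAt.comp_hasDerivAt t h1

end Gradient

/-! ### The trace inequality -/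

theorem enorm_sq_eq_ofReal_sq (a : ℝ) : ‖a‖ₑ ^ 2 = ENNReal.ofReal (a ^ 2) := by
  rw [Real.enorm_eq_ofReal_abs, ← ENNReal.ofReal_pow (abs_nonneg _), sq_abs]

/-- Integrate the derivative of `(1 - t / h) g(t) ^ 2` over `[0, h]`. -/
theorem sq_le_integral_sq_add_deriv_sq {g g' : ℝ → ℝ} (hg : ∀ t, HasDerivAt g (g' t) t)
    (hc : Continuous g') {h : ℝ} (hh : 0 < h) :
    g 0 ^ 2 ≤ (1 / h + 1) * ∫ t in (0 : ℝ)..h, (g t ^ 2 + g' t ^ 2) := by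
  have hgc : Continuous g := continuous_iff_continuousAt.2 fun t => (hg t).continuousAt
  have h1 : ∫ t in (0 : ℝ)..h, (1 / h * g t ^ 2 - (1 - t / h) * (2 * g t * g' t)) = g 0 ^ 2 := by
    have := intervalIntegral.integral_eq_sub_of_hasDerivAt (a := 0) (b := h)
      (f := fun t => -((1 - t / h) * g t ^ 2))
      (f' := fun t => 1 / h * g t ^ 2 - (1 - t / h) * (2 * g t * g' t))
      (fun t _ => by
        have h2 : HasDerivAt (fun t : ℝ => 1 - t / h) (-(1 / h)) t := by
          simpa using ((hasDerivAt_id t).div_const h).const_sub 1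
        have h3 := (h2.mul ((hg t).pow 2)).neg
        refine h3.congr_deriv ?_
        simp only [Pi.pow_apply]
        push_cast
        ring)
      (Continuous.intervalIntegrable (by fun_prop) _ _)
    rw [this]
    field_simp
    simp
  rw [← h1, ← intervalIntegral.integral_const_mul]
  refine intervalIntegral.integral_mono_on hh.le (Continuous.intervalIntegrable (by fun_prop) _ _)
    (Continuous.intervalIntegrable (by fun_prop) _ _) fun t ht => ?_
  have h4 : 0 ≤ 1 - t / h := by rw [sub_nonneg, div_le_one hh]; exact ht.2
  have h5 : 1 - t / h ≤ 1 := by linarith [div_nonneg ht.1 hh.le]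
  have h6 : 0 < 1 / h := by positivity
  have h7 : (1 - t / h) * (-(2 * g t * g' t)) ≤ (1 - t / h) * (g t ^ 2 + g' t ^ 2) :=
    mul_le_mul_of_nonneg_left (by nlinarith [sq_nonneg (g t + g' t)]) h4
  have h8 : (1 - t / h) * (g t ^ 2 + g' t ^ 2) ≤ 1 * (g t ^ 2 + g' t ^ 2) :=
    mul_le_mul_of_nonneg_right h5 (by positivity)
  nlinarith [mul_nonneg h6.le (sq_nonneg (g' t))]

theorem enorm_sq_le_lintegral_enorm_sq_add_deriv {g g' : ℝ → ℝ} (hg : ∀ t, HasDerivAt g (g' t) t)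
    (hc : Continuous g') {h : ℝ} (hh : 0 < h) :
    ‖g 0‖ₑ ^ 2 ≤ ENNReal.ofReal (1 / h + 1) *
      ∫⁻ t in Set.Ioc 0 h, (‖g t‖ₑ ^ 2 + ‖g' t‖ₑ ^ 2) := by
  have hgc : Continuous g := continuous_iff_continuousAt.2 fun t => (hg t).continuousAt
  have hsum : ∀ t, ‖g t‖ₑ ^ 2 + ‖g' t‖ₑ ^ 2 = ENNReal.ofReal (g t ^ 2 + g' t ^ 2) := fun t => by
    rw [enorm_sq_eq_ofReal_sq, enorm_sq_eq_ofReal_sq,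
      ENNReal.ofReal_add (sq_nonneg _) (sq_nonneg _)]
  simp_rw [hsum]
  rw [enorm_sq_eq_ofReal_sq, ← ofReal_integral_eq_lintegral_ofReal,
    ← ENNReal.ofReal_mul (by positivity),
    ← intervalIntegral.integral_of_le hh.le]
  · exact ENNReal.ofReal_le_ofReal (sq_le_integral_sq_add_deriv_sq hg hc hh)
  · exact (Continuous.integrableOn_Icc (by fun_prop)).mono_set Set.Ioc_subset_Icc_self
  · exact Eventually.of_forall fun t => by positivity

section TraceInequality

variable {n : ℕ} {Ω : Set (Space n)}

/-- The trace inequality `‖f‖_{L²(∂Ω)} ≤ C ‖f‖_{H¹(Ω)}`: integrate the one-dimensional inequality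
along the segments of a boundary chart, and cover `∂Ω` by finitely many charts. -/
theorem IsBoundedLipschitzDomain.trace_inequality (hΩ : IsBoundedLipschitzDomain Ω) :
    ∃ C : ENNReal, C ≠ ⊤ ∧ ∀ f : Space n → ℝ, ContDiff ℝ 1 f →
      ∫⁻ y, ‖f y‖ₑ ^ 2 ∂(surf Ω) ≤ C * ∫⁻ y, (‖f y‖ₑ ^ 2 + ‖gradient f y‖ₑ ^ 2) ∂(vol Ω) := by
  suffices h : ∃ C : ENNReal, C ≠ ⊤ ∧ ∀ f : Space n → ℝ, ContDiff ℝ 1 f →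
      ∫⁻ y in frontier Ω, ‖f y‖ₑ ^ 2 ∂(surf Ω)
        ≤ C * ∫⁻ y, (‖f y‖ₑ ^ 2 + ‖gradient f y‖ₑ ^ 2) ∂(vol Ω) by
    simpa only [surf, Measure.restrict_restrict isClosed_frontier.measurableSet, Set.inter_self]
      using h
  refine hΩ.isCompact_frontier.induction_on (p := fun s => ∃ C : ENNReal, C ≠ ⊤ ∧
    ∀ f : Space n → ℝ, ContDiff ℝ 1 f → ∫⁻ y in s, ‖f y‖ₑ ^ 2 ∂(surf Ω)
        ≤ C * ∫⁻ y, (‖f y‖ₑ ^ 2 + ‖gradient f y‖ₑ ^ 2) ∂(vol Ω)) ?_ ?_ ?_ ?_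
  · exact ⟨0, ENNReal.zero_ne_top, fun f _ => by simp⟩
  · rintro s t hst ⟨C, hC, h⟩
    exact ⟨C, hC, fun f hf => (lintegral_mono_set hst).trans (h f hf)⟩
  · rintro s t ⟨C, hC, h⟩ ⟨D, hD, h'⟩
    refine ⟨C + D, ENNReal.add_ne_top.2 ⟨hC, hD⟩, fun f hf => ?_⟩
    rw [add_mul]
    exact (lintegral_union_le _ _ _).trans (add_le_add (h f hf) (h' f hf))
  · intro x hx
    obtain ⟨e, r, C, he, hr, hC, hin, hF⟩ := hΩ.exists_chart hx
    refine ⟨Metric.ball x r, mem_nhdsWithin_of_mem_nhds (Metric.ball_mem_nhds x hr),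
      ENNReal.ofReal (1 / (r / 2) + 1) * C, ENNReal.mul_ne_top ENNReal.ofReal_ne_top hC,
      fun f hf => ?_⟩
    set F : Space n → ENNReal := Ω.indicator fun y => ‖f y‖ₑ ^ 2 + ‖gradient f y‖ₑ ^ 2 with hFdef
    have hFm : Measurable F := by
      have h1 := hf.continuous
      have h2 := continuous_gradient hf
      exact Measurable.indicator (by fun_prop) hΩ.isOpen.measurableSet
    have hkey : ∀ᵐ y ∂((surf Ω).restrict (Metric.ball x r)), ‖f y‖ₑ ^ 2
        ≤ ENNReal.ofReal (1 / (r / 2) + 1) * ∫⁻ t : ℝ, F (y + t • e) := by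
      rw [Measure.restrict_restrict measurableSet_ball,
        ae_restrict_iff' (measurableSet_ball.inter isClosed_frontier.measurableSet)]
      refine Eventually.of_forall fun y hy => ?_
      have h1 := enorm_sq_le_lintegral_enorm_sq_add_deriv (hasDerivAt_comp_line hf y e)
        (by have := hf.continuous_fderiv one_ne_zero; fun_prop) (half_pos hr)
      rw [zero_smul, add_zero] at h1
      refine h1.trans (mul_le_mul_right ?_ _)
      refine le_trans ?_ (setLIntegral_le_lintegral (Set.Ioc 0 (r / 2)) _)
      refine setLIntegral_mono' measurableSet_Ioc fun t ht => ?_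
      have hmem := hin y ⟨hy.2, hy.1⟩ t ht.1 (by linarith [ht.2])
      rw [hFdef, Set.indicator_of_mem hmem]
      have := enorm_fderiv_apply_le f (y + t • e) e
      rw [← ofReal_norm e, he, ENNReal.ofReal_one, mul_one] at this
      gcongr
    calc ∫⁻ y in Metric.ball x r, ‖f y‖ₑ ^ 2 ∂(surf Ω)
        ≤ ∫⁻ y in Metric.ball x r, ENNReal.ofReal (1 / (r / 2) + 1) * ∫⁻ t : ℝ, F (y + t • e)
            ∂(volume) ∂(surf Ω) := lintegral_mono_ae hkey
      _ = ENNReal.ofReal (1 / (r / 2) + 1) *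
            ∫⁻ y in Metric.ball x r, ∫⁻ t : ℝ, F (y + t • e) ∂(volume) ∂(surf Ω) :=
          lintegral_const_mul' _ _ ENNReal.ofReal_ne_top
      _ ≤ ENNReal.ofReal (1 / (r / 2) + 1) * (C * ∫⁻ y, F y) := by gcongr; exact hF F hFm
      _ = _ := by rw [hFdef, lintegral_indicator hΩ.isOpen.measurableSet, mul_assoc]

end TraceInequality

/-! ### The Poincaré inequality -/

theorem sq_lintegral_le_lintegral_sq {α : Type*} [MeasurableSpace α] {μ : Measure α}
    [IsProbabilityMeasure μ] {f : α → ENNReal} (hf : AEMeasurable f μ) :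
    (∫⁻ a, f a ∂μ) ^ 2 ≤ ∫⁻ a, f a ^ 2 ∂μ := by
  have h := ENNReal.lintegral_mul_le_Lp_mul_Lq μ Real.HolderConjugate.two_two hf
    (aemeasurable_const (b := (1 : ENNReal)))
  simp only [Pi.mul_apply, mul_one, ENNReal.one_rpow, lintegral_const, measure_univ] at h
  calc (∫⁻ a, f a ∂μ) ^ 2 ≤ ((∫⁻ a, f a ^ (2 : ℝ) ∂μ) ^ (1 / 2 : ℝ)) ^ 2 := by gcongr
    _ = ∫⁻ a, f a ^ 2 ∂μ := by
      rw [← ENNReal.rpow_natCast, ← ENNReal.rpow_mul]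
      norm_num

section Poincare

variable {n : ℕ} {Ω : Set (Space n)}

theorem enorm_sub_sq_le_lintegral_segment {f : Space n → ℝ} (hf : ContDiff ℝ 1 f) (y q : Space n) :
    ‖f y - f q‖ₑ ^ 2
      ≤ ‖q - y‖ₑ ^ 2 * ∫⁻ t in Set.Ioc (0 : ℝ) 1, ‖gradient f (y + t • (q - y))‖ₑ ^ 2 := by
  have hc : Continuous (fun t : ℝ => fderiv ℝ f (y + t • (q - y)) (q - y)) := by
    have := hf.continuous_fderiv one_ne_zero
    fun_prop
  have hg := continuous_gradient hf
  have h1 : ∫ t in (0 : ℝ)..1, fderiv ℝ f (y + t • (q - y)) (q - y) = f q - f y := by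
    rw [intervalIntegral.integral_eq_sub_of_hasDerivAt
      (fun t _ => hasDerivAt_comp_line hf y (q - y) t) (hc.intervalIntegrable _ _)]
    simp
  rw [intervalIntegral.integral_of_le zero_le_one] at h1
  have : IsProbabilityMeasure (volume.restrict (Set.Ioc (0 : ℝ) 1)) := ⟨by simp⟩
  rw [← neg_sub, enorm_neg, ← h1]
  calc _ ≤ (∫⁻ t in Set.Ioc (0 : ℝ) 1, ‖fderiv ℝ f (y + t • (q - y)) (q - y)‖ₑ) ^ 2 := by
        gcongr; exact enorm_integral_le_lintegral_enorm _
    _ ≤ ∫⁻ t in Set.Ioc (0 : ℝ) 1, ‖fderiv ℝ f (y + t • (q - y)) (q - y)‖ₑ ^ 2 :=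
        sq_lintegral_le_lintegral_sq hc.enorm.measurable.aemeasurable
    _ ≤ ∫⁻ t in Set.Ioc (0 : ℝ) 1, ‖q - y‖ₑ ^ 2 * ‖gradient f (y + t • (q - y))‖ₑ ^ 2 := by
        refine lintegral_mono fun t => ?_
        rw [← mul_pow, mul_comm ‖q - y‖ₑ]
        gcongr
        exact enorm_fderiv_apply_le _ _ _
    _ = _ := lintegral_const_mul' _ _ (ENNReal.pow_ne_top enorm_ne_top)

/-- Change of variables; `t ≥ 1/2` keeps the Jacobian `t⁻ⁿ` below `2ⁿ`. -/
theorem lintegral_comp_add_smul_le {g : Space n → ENNReal} (hg : Measurable g) (a : Space n) {t : ℝ}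
    (ht : 1 / 2 ≤ t) : ∫⁻ q, g (a + t • q) ≤ 2 ^ n * ∫⁻ q, g q := by
  have ht0 : 0 < t := by linarith
  have h1 := Measure.map_addHaar_smul (volume : Measure (Space n)) ht0.ne'
  rw [finrank_euclideanSpace_fin] at h1
  have h2 : ∫⁻ q, g (a + t • q) = ENNReal.ofReal |(t ^ n)⁻¹| * ∫⁻ q, g q := by
    rw [← lintegral_map (f := fun q => g (a + q)) (g := fun q => t • q)
      (hg.comp (measurable_const_add a)) (measurable_const_smul t), h1, lintegral_smul_measure,
      lintegral_add_left_eq_self, smul_eq_mul]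
  rw [h2]
  gcongr
  rw [abs_of_pos (by positivity), ← inv_pow]
  have h3 : t⁻¹ ≤ 2 := by
    rw [inv_le_comm₀ ht0 (by norm_num)]; linarith
  calc ENNReal.ofReal (t⁻¹ ^ n) ≤ ENNReal.ofReal (2 ^ n) := by gcongr
    _ = 2 ^ n := by rw [ENNReal.ofReal_pow (by norm_num)]; simp

/-- Averaging over segments: for `t ≥ 1/2` substitute for the end point, for `t ≤ 1/2` for the
starting point of the segment. -/
theorem lintegral_segments_le {g : Space n → ENNReal} (hg : Measurable g) (A B : Set (Space n)) :
    ∫⁻ y in A, ∫⁻ q in B, ∫⁻ t in Set.Ioc (0 : ℝ) 1, g (y + t • (q - y))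
      ≤ 2 ^ n * (volume A + volume B) * ∫⁻ y, g y := by
  have hm : Measurable (fun z : Space n × Space n × ℝ => g (z.1 + z.2.2 • (z.2.1 - z.1))) :=
    hg.comp (by fun_prop)
  have hswap : ∫⁻ y in A, ∫⁻ q in B, ∫⁻ t in Set.Ioc (0 : ℝ) 1, g (y + t • (q - y))
      = ∫⁻ t in Set.Ioc (0 : ℝ) 1, ∫⁻ y in A, ∫⁻ q in B, g (y + t • (q - y)) := by
    have h1 : ∀ y, ∫⁻ q in B, ∫⁻ t in Set.Ioc (0 : ℝ) 1, g (y + t • (q - y))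
        = ∫⁻ t in Set.Ioc (0 : ℝ) 1, ∫⁻ q in B, g (y + t • (q - y)) := fun y =>
      lintegral_lintegral_swap (f := fun q t => g (y + t • (q - y)))
        (hm.comp (by fun_prop : Measurable fun z : Space n × ℝ => (y, z.1, z.2))).aemeasurable
    simp_rw [h1]
    refine lintegral_lintegral_swap (Measurable.aemeasurable ?_)
    exact Measurable.lintegral_prod_right'
      (f := fun z : (Space n × ℝ) × Space n => g (z.1.1 + z.1.2 • (z.2 - z.1.1)))
      (hg.comp (by fun_prop))
  rw [hswap]
  have hbound : ∀ t ∈ Set.Ioc (0 : ℝ) 1, ∫⁻ y in A, ∫⁻ q in B, g (y + t • (q - y))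
      ≤ 2 ^ n * (volume A + volume B) * ∫⁻ y, g y := by
    intro t ht
    rcases le_total (1 / 2) t with h | h
    · calc ∫⁻ y in A, ∫⁻ q in B, g (y + t • (q - y))
          ≤ ∫⁻ _ in A, 2 ^ n * ∫⁻ q, g q := by
            refine lintegral_mono fun y => ?_
            refine (setLIntegral_le_lintegral _ _).trans ?_
            have : ∀ q, y + t • (q - y) = (y - t • y) + t • q := fun q => by
              rw [smul_sub]; abel
            simp_rw [this]
            exact lintegral_comp_add_smul_le hg _ h
        _ = 2 ^ n * volume A * ∫⁻ y, g y := by rw [setLIntegral_const]; ring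
        _ ≤ _ := by gcongr; exact le_self_add
    · rw [lintegral_lintegral_swap (f := fun y q => g (y + t • (q - y)))
        (hm.comp
          (by fun_prop : Measurable fun z : Space n × Space n => (z.1, z.2, t))).aemeasurable]
      calc ∫⁻ q in B, ∫⁻ y in A, g (y + t • (q - y))
          ≤ ∫⁻ _ in B, 2 ^ n * ∫⁻ q, g q := by
            refine lintegral_mono fun q => ?_
            refine (setLIntegral_le_lintegral _ _).trans ?_
            have : ∀ y, y + t • (q - y) = t • q + (1 - t) • y := fun y => by
              rw [smul_sub, sub_smul, one_smul]; abel
            simp_rw [this]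
            exact lintegral_comp_add_smul_le hg _ (by linarith)
        _ = 2 ^ n * volume B * ∫⁻ y, g y := by rw [setLIntegral_const]; ring
        _ ≤ _ := by gcongr; exact le_add_self
  calc _ ≤ ∫⁻ _ in Set.Ioc (0 : ℝ) 1, 2 ^ n * (volume A + volume B) * ∫⁻ y, g y :=
        setLIntegral_mono' measurableSet_Ioc hbound
    _ = _ := by simp

/-- `A` and `B` are linked in `Ω` if the mean square of `f(y) - f(z)`, `y ∈ A`, `z ∈ B`, is
controlled by the Dirichlet integral of `f` over `Ω`. -/
def Linked (Ω A B : Set (Space n)) : Prop :=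
  ∃ C : ENNReal, C ≠ ⊤ ∧ ∀ f : Space n → ℝ, ContDiff ℝ 1 f →
    ∫⁻ y in A, ∫⁻ z in B, ‖f y - f z‖ₑ ^ 2 ≤ C * ∫⁻ y, ‖gradient f y‖ₑ ^ 2 ∂(vol Ω)

theorem measurable_enorm_sub_sq {f : Space n → ℝ} (hf : ContDiff ℝ 1 f) :
    Measurable (fun q : Space n × Space n => ‖f q.1 - f q.2‖ₑ ^ 2) := by
  have := hf.continuous
  fun_prop

theorem Linked.symm {A B : Set (Space n)} (h : Linked Ω A B) : Linked Ω B A := by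
  obtain ⟨C, hC, h⟩ := h
  refine ⟨C, hC, fun f hf => ?_⟩
  rw [lintegral_lintegral_swap (measurable_enorm_sub_sq hf).aemeasurable]
  simp_rw [← enorm_neg (f _ - f _), neg_sub]
  exact h f hf

theorem Linked.mono {A B A' B' : Set (Space n)} (h : Linked Ω A B) (hA : A' ⊆ A) (hB : B' ⊆ B) :
    Linked Ω A' B' := by
  obtain ⟨C, hC, h⟩ := h
  exact ⟨C, hC, fun f hf => le_trans ((lintegral_mono_set hA).trans
    (lintegral_mono fun y => lintegral_mono_set hB)) (h f hf)⟩

theorem Linked.union_left {A A' B : Set (Space n)} (h : Linked Ω A B) (h' : Linked Ω A' B) :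
    Linked Ω (A ∪ A') B := by
  obtain ⟨C, hC, h⟩ := h
  obtain ⟨D, hD, h'⟩ := h'
  refine ⟨C + D, ENNReal.add_ne_top.2 ⟨hC, hD⟩, fun f hf => ?_⟩
  rw [add_mul]
  exact (lintegral_union_le _ _ _).trans (add_le_add (h f hf) (h' f hf))

theorem enorm_sub_sq_le (a b c : ℝ) : ‖a - c‖ₑ ^ 2 ≤ 2 * (‖a - b‖ₑ ^ 2 + ‖b - c‖ₑ ^ 2) := by
  rw [enorm_sq_eq_ofReal_sq, enorm_sq_eq_ofReal_sq, enorm_sq_eq_ofReal_sq,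
    ← ENNReal.ofReal_add (sq_nonneg _) (sq_nonneg _),
    show (2 : ENNReal) = ENNReal.ofReal 2 by simp, ← ENNReal.ofReal_mul (by norm_num)]
  exact ENNReal.ofReal_le_ofReal (by nlinarith [sq_nonneg (a - b - (b - c))])

/-- Compare `f(y)` and `f(z)` with `f(b)` and average over `b ∈ B`. -/
theorem Linked.trans {A B D : Set (Space n)} (h : Linked Ω A B) (h' : Linked Ω B D)
    (hB : volume B ≠ 0) (hB' : volume B ≠ ⊤) (hA : volume A ≠ ⊤) (hD : volume D ≠ ⊤) :
    Linked Ω A D := by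
  obtain ⟨C, hC, h⟩ := h
  obtain ⟨C', hC', h'⟩ := h'.symm
  refine ⟨(volume B)⁻¹ * (2 * (C * volume D + volume A * C')), ?_, fun f hf => ?_⟩
  · exact ENNReal.mul_ne_top (ENNReal.inv_ne_top.2 hB) (ENNReal.mul_ne_top (by simp)
      (ENNReal.add_ne_top.2 ⟨ENNReal.mul_ne_top hC hD, ENNReal.mul_ne_top hA hC'⟩))
  have hfm := hf.continuous.measurable
  have hp : ∀ y z, ‖f y - f z‖ₑ ^ 2 ≤ (volume B)⁻¹ *
      (2 * (∫⁻ b in B, ‖f y - f b‖ₑ ^ 2) + 2 * ∫⁻ b in B, ‖f z - f b‖ₑ ^ 2) := by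
    intro y z
    have h1 : ‖f y - f z‖ₑ ^ 2 * volume B
        ≤ 2 * (∫⁻ b in B, ‖f y - f b‖ₑ ^ 2) + 2 * ∫⁻ b in B, ‖f z - f b‖ₑ ^ 2 := by
      rw [← setLIntegral_const, ← lintegral_const_mul _ (by fun_prop),
        ← lintegral_const_mul _ (by fun_prop), ← lintegral_add_left (by fun_prop)]
      refine lintegral_mono fun b => ?_
      rw [← mul_add, ← enorm_neg (f z - f b), neg_sub]
      exact enorm_sub_sq_le _ _ _
    rw [mul_comm] at h1
    calc ‖f y - f z‖ₑ ^ 2 = (volume B)⁻¹ * (volume B * ‖f y - f z‖ₑ ^ 2) := by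
          rw [← mul_assoc, ENNReal.inv_mul_cancel hB hB', one_mul]
      _ ≤ _ := by gcongr
  have hm : Measurable (fun y => ∫⁻ b in B, ‖f y - f b‖ₑ ^ 2) :=
    Measurable.lintegral_prod_right' (measurable_enorm_sub_sq hf)
  calc ∫⁻ y in A, ∫⁻ z in D, ‖f y - f z‖ₑ ^ 2
      ≤ ∫⁻ y in A, ∫⁻ z in D, (volume B)⁻¹ *
      (2 * (∫⁻ b in B, ‖f y - f b‖ₑ ^ 2) + 2 * ∫⁻ b in B, ‖f z - f b‖ₑ ^ 2) :=
        lintegral_mono fun y => lintegral_mono fun z => hp y z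
    _ = (volume B)⁻¹ * (2 * ((∫⁻ y in A, ∫⁻ b in B, ‖f y - f b‖ₑ ^ 2) * volume D
          + volume A * ∫⁻ z in D, ∫⁻ b in B, ‖f z - f b‖ₑ ^ 2)) := by
        have h1 : ∀ y, ∫⁻ z in D, (volume B)⁻¹ *
            (2 * (∫⁻ b in B, ‖f y - f b‖ₑ ^ 2) + 2 * ∫⁻ b in B, ‖f z - f b‖ₑ ^ 2)
            = (volume B)⁻¹ * (2 * (∫⁻ b in B, ‖f y - f b‖ₑ ^ 2) * volume D
              + 2 * ∫⁻ z in D, ∫⁻ b in B, ‖f z - f b‖ₑ ^ 2) := fun y => by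
          rw [lintegral_const_mul _ (by fun_prop), lintegral_add_left measurable_const,
            setLIntegral_const, lintegral_const_mul _ hm]
        simp_rw [h1]
        rw [lintegral_const_mul _ (by fun_prop), lintegral_add_right _ measurable_const,
          setLIntegral_const, lintegral_mul_const _ (by fun_prop), lintegral_const_mul _ hm]
        ring
    _ ≤ (volume B)⁻¹ * (2 * ((C * ∫⁻ y, ‖gradient f y‖ₑ ^ 2 ∂(vol Ω)) * volume D
          + volume A * (C' * ∫⁻ y, ‖gradient f y‖ₑ ^ 2 ∂(vol Ω)))) := by
        gcongr
        · exact h f hf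
        · exact h' f hf
    _ = _ := by ring

/-- Sets joined by segments inside `Ω` are linked in `Ω`. -/
theorem linked_of_segments (hΩ : MeasurableSet Ω) {A B : Set (Space n)} (hA : MeasurableSet A)
    (hB : MeasurableSet B) (hA' : Bornology.IsBounded A) (hB' : Bornology.IsBounded B)
    (h : ∀ y ∈ A, ∀ q ∈ B, ∀ t : ℝ, 0 < t → t ≤ 1 → y + t • (q - y) ∈ Ω) : Linked Ω A B := by
  obtain ⟨R, hR⟩ := Metric.isBounded_iff.1 (hA'.union hB')
  refine ⟨ENNReal.ofReal R ^ 2 * (2 ^ n * (volume A + volume B)), ?_, fun f hf => ?_⟩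
  · exact ENNReal.mul_ne_top (ENNReal.pow_ne_top ENNReal.ofReal_ne_top)
      (ENNReal.mul_ne_top (by simp)
        (ENNReal.add_ne_top.2 ⟨hA'.measure_lt_top.ne, hB'.measure_lt_top.ne⟩))
  set g : Space n → ENNReal := Ω.indicator fun y => ‖gradient f y‖ₑ ^ 2 with hgdef
  have hgm : Measurable g := by
    have h2 := continuous_gradient hf
    exact Measurable.indicator (by fun_prop) hΩ
  calc ∫⁻ y in A, ∫⁻ q in B, ‖f y - f q‖ₑ ^ 2
      ≤ ∫⁻ y in A, ∫⁻ q in B, ENNReal.ofReal R ^ 2 *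
          ∫⁻ t in Set.Ioc (0 : ℝ) 1, g (y + t • (q - y)) := by
        refine setLIntegral_mono' hA fun y hy => setLIntegral_mono' hB fun q hq => ?_
        refine (enorm_sub_sq_le_lintegral_segment hf y q).trans ?_
        gcongr ?_ ^ 2 * ?_
        · rw [← ofReal_norm, ← dist_eq_norm]
          exact ENNReal.ofReal_le_ofReal (hR (Or.inr hq) (Or.inl hy))
        · refine setLIntegral_mono' measurableSet_Ioc fun t ht => ?_
          rw [hgdef, Set.indicator_of_mem (h y hy q hq t ht.1 ht.2)]
    _ = ENNReal.ofReal R ^ 2 *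
          ∫⁻ y in A, ∫⁻ q in B, ∫⁻ t in Set.Ioc (0 : ℝ) 1, g (y + t • (q - y)) := by
        have hne : ENNReal.ofReal R ^ 2 ≠ ⊤ := ENNReal.pow_ne_top ENNReal.ofReal_ne_top
        simp_rw [lintegral_const_mul' _ _ hne]
    _ ≤ ENNReal.ofReal R ^ 2 * (2 ^ n * (volume A + volume B) * ∫⁻ y, g y) := by
        gcongr; exact lintegral_segments_le hgm A B
    _ = _ := by rw [hgdef, lintegral_indicator hΩ]; ring

theorem IsBoundedLipschitzDomain.volume_ne_top (hΩ : IsBoundedLipschitzDomain Ω)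
    {A : Set (Space n)} (hA : A ⊆ Ω) : volume A ≠ ⊤ :=
  (hΩ.isBounded.subset hA).measure_lt_top.ne

theorem IsBoundedLipschitzDomain.volume_inter_ne_zero (hΩ : IsBoundedLipschitzDomain Ω)
    {x : Space n} (hx : x ∈ closure Ω) {U : Set (Space n)} (hU : IsOpen U) (hxU : x ∈ U) :
    volume (Ω ∩ U) ≠ 0 := by
  obtain ⟨y, hyU, hyΩ⟩ := mem_closure_iff.1 hx U hU hxU
  exact ((hΩ.isOpen.inter hU).measure_pos _ ⟨y, hyΩ, hyU⟩).ne'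

/-- Every point of the closure has a neighbourhood whose part in `Ω` is linked to itself: by the
cone property it is joined by segments inside `Ω` to one and the same ball. -/
theorem IsBoundedLipschitzDomain.exists_linked_self (hΩ : IsBoundedLipschitzDomain Ω)
    {x : Space n} (hx : x ∈ closure Ω) :
    ∃ U : Set (Space n), IsOpen U ∧ x ∈ U ∧ Linked Ω (Ω ∩ U) (Ω ∩ U) := by
  obtain ⟨e, r, hr, hcone⟩ := hΩ.exists_cone hx
  have he := norm_nonneg e
  set ε : ℝ := r / (‖e‖ + 2) with hε
  have hε0 : 0 < ε := by positivity
  have hεr : ε * (‖e‖ + 2) = r := by rw [hε]; field_simp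
  have hseg : ∀ y ∈ Ω ∩ Metric.ball x (ε / 4), ∀ q ∈ Metric.ball (x + ε • e) (ε / 2),
      ∀ t : ℝ, 0 < t → t ≤ 1 → y + t • (q - y) ∈ Ω := by
    rintro y ⟨hy, hyx⟩ q hq t ht0 ht1
    rw [Metric.mem_ball, dist_eq_norm] at hyx hq
    have hd : ‖q - y - ε • e‖ ≤ ε := by
      calc ‖q - y - ε • e‖ = ‖(q - (x + ε • e)) - (y - x)‖ := by congr 1; abel
        _ ≤ ‖q - (x + ε • e)‖ + ‖y - x‖ := norm_sub_le _ _
        _ ≤ ε := by linarith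
    refine hcone y hy _ ?_ (t * ε) (by positivity) ?_ ?_
    · rw [Metric.mem_ball, dist_eq_norm]
      calc ‖y + t • (q - y) - x‖ = ‖(y - x) + t • ((q - y - ε • e) + ε • e)‖ := by
            congr 1; rw [sub_add_cancel]; abel
        _ ≤ ‖y - x‖ + ‖t • ((q - y - ε • e) + ε • e)‖ := norm_add_le _ _
        _ ≤ ‖y - x‖ + 1 * (ε + ε * ‖e‖) := by
            rw [norm_smul, Real.norm_of_nonneg ht0.le]
            gcongr
            refine (norm_add_le _ _).trans (add_le_add hd ?_)
            rw [norm_smul, Real.norm_of_nonneg hε0.le]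
        _ < r := by nlinarith
    · nlinarith
    · have : y + t • (q - y) - y - (t * ε) • e = t • (q - y - ε • e) := by
        simp only [smul_sub, mul_smul]; abel
      rw [this, norm_smul, Real.norm_of_nonneg ht0.le]
      gcongr
  have hball : Metric.ball x (ε / 4) ∈ 𝓝 x := Metric.ball_mem_nhds _ (by positivity)
  have h1 : Linked Ω (Ω ∩ Metric.ball x (ε / 4)) (Metric.ball (x + ε • e) (ε / 2)) :=
    linked_of_segments hΩ.isOpen.measurableSet (hΩ.isOpen.inter Metric.isOpen_ball).measurableSet
      measurableSet_ball (hΩ.isBounded.subset Set.inter_subset_left) Metric.isBounded_ball hseg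
  refine ⟨_, Metric.isOpen_ball, Metric.mem_ball_self (by positivity), h1.trans h1.symm ?_ ?_
    (hΩ.volume_ne_top Set.inter_subset_left) (hΩ.volume_ne_top Set.inter_subset_left)⟩
  · exact (Metric.measure_ball_pos _ _ (by positivity)).ne'
  · exact measure_ball_lt_top.ne

/-- The Poincaré inequality in a connected domain. Being linked near two points is an equivalence
relation with open classes on the connected set `closure Ω`, so any two points are linked; the sum
over a finite cover gives the inequality on all of `Ω`. -/
theorem IsBoundedLipschitzDomain.linked_self (hΩ : IsBoundedLipschitzDomain Ω) : Linked Ω Ω Ω := by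
  have hK : IsCompact (closure Ω) := hΩ.isBounded.isCompact_closure
  have hpair : ∀ x ∈ closure Ω, ∀ y ∈ closure Ω, ∃ U V : Set (Space n),
      IsOpen U ∧ IsOpen V ∧ x ∈ U ∧ y ∈ V ∧ Linked Ω (Ω ∩ U) (Ω ∩ V) := by
    intro x hx y hy
    refine hΩ.isConnected.closure.isPreconnected.induction₂ (fun x y => ∃ U V : Set (Space n),
      IsOpen U ∧ IsOpen V ∧ x ∈ U ∧ y ∈ V ∧ Linked Ω (Ω ∩ U) (Ω ∩ V)) ?_ ?_ ?_ hx hy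
    · intro x hx
      obtain ⟨U, hU, hxU, hl⟩ := hΩ.exists_linked_self hx
      filter_upwards [mem_nhdsWithin_of_mem_nhds (hU.mem_nhds hxU)] with y hy
      exact ⟨U, U, hU, hU, hxU, hy, hl⟩
    · rintro x y z hx hy hz ⟨U, V, hU, hV, hxU, hyV, hl⟩ ⟨V', W, hV', hW, hyV', hzW, hl'⟩
      refine ⟨U, W, hU, hW, hxU, hzW, Linked.trans (B := Ω ∩ (V ∩ V'))
        (hl.mono le_rfl (Set.inter_subset_inter_right _ Set.inter_subset_left))
        (hl'.mono (Set.inter_subset_inter_right _ Set.inter_subset_right) le_rfl)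
        (hΩ.volume_inter_ne_zero hy (hV.inter hV') ⟨hyV, hyV'⟩) ?_ ?_ ?_⟩ <;>
      exact hΩ.volume_ne_top Set.inter_subset_left
    · rintro x y hx hy ⟨U, V, hU, hV, hxU, hyV, hl⟩
      exact ⟨V, U, hV, hU, hyV, hxU, hl.symm⟩
  have hempty : ∀ A : Set (Space n), Linked Ω ∅ A := fun A =>
    ⟨0, ENNReal.zero_ne_top, fun f _ => by simp⟩
  have hone : ∀ x ∈ closure Ω, ∃ U : Set (Space n), IsOpen U ∧ x ∈ U ∧ Linked Ω (Ω ∩ U) Ω := by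
    intro x hx
    have := hK.induction_on (p := fun s => ∃ U : Set (Space n), IsOpen U ∧ x ∈ U ∧
      Linked Ω (Ω ∩ s) (Ω ∩ U)) ⟨Set.univ, isOpen_univ, trivial, by
        rw [Set.inter_empty]; exact hempty _⟩ ?_ ?_ ?_
    · obtain ⟨U, hU, hxU, hl⟩ := this
      rw [Set.inter_eq_left.2 subset_closure] at hl
      exact ⟨U, hU, hxU, hl.symm⟩
    · rintro s t hst ⟨U, hU, hxU, hl⟩
      exact ⟨U, hU, hxU, hl.mono (Set.inter_subset_inter_right _ hst) le_rfl⟩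
    · rintro s t ⟨U, hU, hxU, hl⟩ ⟨V, hV, hxV, hl'⟩
      refine ⟨U ∩ V, hU.inter hV, ⟨hxU, hxV⟩, ?_⟩
      rw [Set.inter_union_distrib_left]
      exact (hl.mono le_rfl (Set.inter_subset_inter_right _ Set.inter_subset_left)).union_left
        (hl'.mono le_rfl (Set.inter_subset_inter_right _ Set.inter_subset_right))
    · intro y hy
      obtain ⟨U, V, hU, hV, hxU, hyV, hl⟩ := hpair x hx y hy
      exact ⟨V, mem_nhdsWithin_of_mem_nhds (hV.mem_nhds hyV), U, hU, hxU, hl.symm⟩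
  have := hK.induction_on (p := fun s => Linked Ω (Ω ∩ s) Ω) (by
    rw [Set.inter_empty]; exact hempty _) ?_ ?_ ?_
  · rwa [Set.inter_eq_left.2 subset_closure] at this
  · exact fun s t hst hl => hl.mono (Set.inter_subset_inter_right _ hst) le_rfl
  · intro s t hl hl'
    rw [Set.inter_union_distrib_left]
    exact hl.union_left hl'
  · intro x hx
    obtain ⟨U, hU, hxU, hl⟩ := hone x hx
    exact ⟨U, mem_nhdsWithin_of_mem_nhds (hU.mem_nhds hxU), hl⟩

end Poincare

/-! ### Mollification in `L²` -/

theorem eLpNorm_two_sq {α E : Type*} [MeasurableSpace α] [NormedAddCommGroup E] (f : α → E)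
    (μ : Measure α) : eLpNorm f 2 μ ^ 2 = ∫⁻ x, ‖f x‖ₑ ^ 2 ∂μ := by
  rw [eLpNorm_eq_lintegral_rpow_enorm_toReal two_ne_zero ENNReal.ofNat_ne_top,
    ← ENNReal.rpow_natCast, ← ENNReal.rpow_mul]
  norm_num

section Mollify

variable {n : ℕ} {E : Type*} [NormedAddCommGroup E]

/-- Continuity of translations in `L²`. -/
theorem exists_eLpNorm_translate_sub_le {f : Space n → E} (hf : MemLp f 2 volume) {κ : ENNReal}
    (hκ : κ ≠ 0) :
    ∃ δ > 0, ∀ h : Space n, ‖h‖ ≤ δ → eLpNorm (fun y => f (y - h) - f y) 2 volume ≤ κ := by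
  set F := hf.toLp f with hF
  let g : Space n → C(Space n, Space n) :=
    (ContinuousMap.mk (fun q : Space n × Space n => q.2 - q.1) (by fun_prop)).curry
  have hg : Continuous g := ContinuousMap.continuous _
  have hgm : ∀ h, MeasurePreserving (g h) volume volume := fun h =>
    measurePreserving_sub_right volume h
  have hc : Continuous (fun h => Lp.compMeasurePreserving (g h) (hgm h) F) :=
    continuous_const.compMeasurePreservingLp hg hgm (by simp)
  have hae : ∀ h, Lp.compMeasurePreserving (g h) (hgm h) F =ᵐ[volume] fun y => f (y - h) := fun h =>
    (Lp.coeFn_compMeasurePreserving F (hgm h)).trans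
      ((hgm h).quasiMeasurePreserving.ae_eq_comp hf.coeFn_toLp)
  have h0 : Lp.compMeasurePreserving (g 0) (hgm 0) F = F := by
    refine Lp.ext ((hae 0).trans ?_)
    simp only [sub_zero]
    exact hf.coeFn_toLp.symm
  have ht := hc.tendsto 0
  rw [h0] at ht
  obtain ⟨δ, hδ, hb⟩ := Metric.eventually_nhds_iff.1
    (EMetric.tendsto_nhds.1 ht κ (pos_iff_ne_zero.2 hκ))
  refine ⟨δ / 2, half_pos hδ, fun h hh => ?_⟩
  have h1 := hb (y := h) (by rw [dist_zero_right]; linarith)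
  rw [Lp.edist_def] at h1
  refine le_trans (le_of_eq (eLpNorm_congr_ae ?_)) h1.le
  filter_upwards [hae h, hf.coeFn_toLp] with y hy hy'
  rw [Pi.sub_apply, hy, hF, hy']

variable [NormedSpace ℝ E] [CompleteSpace E]

/-- Mollification moves `f` in `L²` by at most as much as the translations by the vectors in the
support of the kernel do (Jensen's inequality). -/
theorem eLpNorm_mollify_sub_le {f : Space n → E} (hsm : StronglyMeasurable f)
    (hf : MemLp f 2 volume) {k : Space n → ℝ} (hk : Continuous k) (hks : HasCompactSupport k)
    (hk0 : ∀ v, 0 ≤ k v) (hk1 : ∫ v, k v = 1) {κ : ENNReal}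
    (h : ∀ v, k v ≠ 0 → eLpNorm (fun y => f (y - v) - f y) 2 volume ≤ κ) :
    eLpNorm (fun y => (∫ z, k (y - z) • f z) - f y) 2 volume ≤ κ := by
  have hki : Integrable k := hk.integrable_of_hasCompactSupport hks
  set d : Space n → ENNReal := fun v => ENNReal.ofReal (k v) with hd
  have hdm : Measurable d := hk.measurable.ennreal_ofReal
  have hd1 : ∫⁻ v, d v = 1 := by
    rw [hd, ← ofReal_integral_eq_lintegral_ofReal hki (Eventually.of_forall hk0), hk1,
      ENNReal.ofReal_one]
  have hprob : IsProbabilityMeasure ((volume : Measure (Space n)).withDensity d) :=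
    ⟨by rw [withDensity_apply _ MeasurableSet.univ, Measure.restrict_univ, hd1]⟩
  have hjoint : Measurable (fun q : Space n × Space n => ‖f (q.1 - q.2) - f q.1‖ₑ ^ 2) :=
    (((hsm.comp_measurable (by fun_prop : Measurable fun q : Space n × Space n => q.1 - q.2)).sub
      (hsm.comp_measurable measurable_fst)).enorm).pow_const 2
  have hpt : ∀ y, ‖(∫ z, k (y - z) • f z) - f y‖ₑ ^ 2 ≤ ∫⁻ v, d v * ‖f (y - v) - f y‖ₑ ^ 2 := by
    intro y
    have h1 : ∫ z, k (y - z) • f z = ∫ v, k v • f (y - v) := by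
      rw [← integral_sub_left_eq_self (fun v => k v • f (y - v)) volume y]
      simp only [sub_sub_cancel]
    have hi : Integrable (fun v => k v • f (y - v)) :=
      ((hf.comp_measurePreserving (Measure.measurePreserving_sub_left volume y)).locallyIntegrable
        one_le_two).integrable_smul_left_of_hasCompactSupport hk hks
    have h2 : (∫ z, k (y - z) • f z) - f y = ∫ v, k v • (f (y - v) - f y) := by
      simp_rw [smul_sub]
      rw [integral_sub hi (hki.smul_const _), integral_smul_const, hk1, one_smul, h1]
    have hm : Measurable (fun v => ‖f (y - v) - f y‖ₑ) :=
      ((hsm.comp_measurable (by fun_prop : Measurable fun v : Space n => y - v)).sub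
        stronglyMeasurable_const).enorm
    rw [h2]
    calc ‖∫ v, k v • (f (y - v) - f y)‖ₑ ^ 2
        ≤ (∫⁻ v, ‖k v • (f (y - v) - f y)‖ₑ) ^ 2 := by
          gcongr; exact enorm_integral_le_lintegral_enorm _
      _ = (∫⁻ v, (d * fun v => ‖f (y - v) - f y‖ₑ) v) ^ 2 := by
          congr 2
          ext v
          rw [enorm_smul, Pi.mul_apply, hd, Real.enorm_of_nonneg (hk0 v)]
      _ ≤ ∫⁻ v, (d * fun v => ‖f (y - v) - f y‖ₑ ^ 2) v := by
          rw [← lintegral_withDensity_eq_lintegral_mul _ hdm hm,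
            ← lintegral_withDensity_eq_lintegral_mul _ hdm (hm.pow_const 2)]
          exact sq_lintegral_le_lintegral_sq hm.aemeasurable
      _ = _ := rfl
  have hsq : eLpNorm (fun y => (∫ z, k (y - z) • f z) - f y) 2 volume ^ 2 ≤ κ ^ 2 := by
    rw [eLpNorm_two_sq]
    calc ∫⁻ y, ‖(∫ z, k (y - z) • f z) - f y‖ₑ ^ 2
        ≤ ∫⁻ y, ∫⁻ v, d v * ‖f (y - v) - f y‖ₑ ^ 2 := lintegral_mono hpt
      _ = ∫⁻ v, ∫⁻ y, d v * ‖f (y - v) - f y‖ₑ ^ 2 := lintegral_lintegral_swap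
          (f := fun y v => d v * ‖f (y - v) - f y‖ₑ ^ 2)
          ((hdm.comp measurable_snd).mul hjoint).aemeasurable
      _ ≤ ∫⁻ v, d v * κ ^ 2 := by
          refine lintegral_mono fun v => ?_
          rw [lintegral_const_mul' _ _ ENNReal.ofReal_ne_top, ← eLpNorm_two_sq]
          by_cases hv : k v = 0
          · simp [hd, hv]
          · gcongr
            exact h v hv
      _ = κ ^ 2 := by rw [lintegral_mul_const _ hdm, hd1, one_mul]
  exact (ENNReal.pow_le_pow_left_iff two_ne_zero).1 hsq

end Mollify

/-! ### Density of smooth functions in `H¹(Ω)` -/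

/-- Kernels concentrated near `-ε e`, to mollify while translating by `-ε e`. -/
theorem exists_mollifier {n : ℕ} (e : Space n) {ε : ℝ} (hε : 0 < ε) :
    ∃ k : Space n → ℝ, ContDiff ℝ (⊤ : ℕ∞) k ∧ HasCompactSupport k ∧ (∀ v, 0 ≤ k v) ∧
      ∫ v, k v = 1 ∧ ∀ v, k v ≠ 0 → ‖v + ε • e‖ ≤ ε := by
  let φ : ContDiffBump (0 : Space n) := ⟨ε / 2, ε, by positivity, by linarith⟩
  refine ⟨fun v => φ.normed volume (v + ε • e), ?_, ?_, fun v => φ.nonneg_normed _, ?_, ?_⟩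
  · exact φ.contDiff_normed.comp (contDiff_id.add contDiff_const)
  · exact φ.hasCompactSupport_normed.comp_homeomorph (Homeomorph.addRight (ε • e))
  · rw [integral_add_right_eq_self (fun v => φ.normed volume v), φ.integral_normed]
  · intro v hv
    have : v + ε • e ∈ Function.support (φ.normed volume) := hv
    rw [φ.support_normed_eq, Metric.mem_ball, dist_zero_right] at this
    exact this.le

section LocalDensity

variable {n : ℕ} {Ω : Set (Space n)}

theorem _root_.ContDiff.gradient_contDiff {f : Space n → ℝ} (hf : ContDiff ℝ (⊤ : ℕ∞) f) :
    ContDiff ℝ (⊤ : ℕ∞) (gradient f) :=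
  (InnerProductSpace.toDual ℝ (Space n)).symm.contDiff.comp (hf.fderiv_right (by simp))

theorem gradient_sum {ι : Type*} {s : Finset ι} {f : ι → Space n → ℝ} {x : Space n}
    (hf : ∀ i ∈ s, DifferentiableAt ℝ (f i) x) :
    gradient (fun y => ∑ i ∈ s, f i y) x = ∑ i ∈ s, gradient (f i) x := by
  refine ext_inner_right ℝ fun v => ?_
  rw [inner_gradient_left, sum_inner, fderiv_fun_sum hf]
  simp [inner_gradient_left]

/-- The function `χ u`, extended by zero. -/
def cutFn (Ω : Set (Space n)) (χ : Space n → ℝ) (u : H1 Ω) : Space n → ℝ :=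
  Ω.indicator fun z => χ z * fn u z

/-- The weak gradient `χ ∇u + u ∇χ` of `χ u`, extended by zero. -/
def cutGrad (Ω : Set (Space n)) (χ : Space n → ℝ) (u : H1 Ω) : Space n → Space n :=
  Ω.indicator fun z => χ z • wgrad u z + fn u z • gradient χ z

variable {χ : Space n → ℝ}

theorem _root_.HasCompactSupport.gradient {n : ℕ} {χ : Space n → ℝ} (hχc : HasCompactSupport χ) :
    HasCompactSupport (gradient χ) :=
  (hχc.fderiv ℝ).comp_left (g := (InnerProductSpace.toDual ℝ (Space n)).symm) (map_zero _)

theorem stronglyMeasurable_cutFn (hΩ : MeasurableSet Ω) (hχ : Continuous χ) (u : H1 Ω) :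
    StronglyMeasurable (cutFn Ω χ u) :=
  (hχ.stronglyMeasurable.mul (Lp.stronglyMeasurable _)).indicator hΩ

theorem stronglyMeasurable_cutGrad (hΩ : MeasurableSet Ω) (hχ : ContDiff ℝ (⊤ : ℕ∞) χ) (u : H1 Ω) :
    StronglyMeasurable (cutGrad Ω χ u) :=
  ((hχ.continuous.stronglyMeasurable.smul (Lp.stronglyMeasurable (wgrad u))).add
    ((Lp.stronglyMeasurable (fn u)).smul
      hχ.gradient_contDiff.continuous.stronglyMeasurable)).indicator hΩ

theorem memLp_cutFn (hΩ : MeasurableSet Ω) (hχ : Continuous χ) (hχc : HasCompactSupport χ)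
    (u : H1 Ω) : MemLp (cutFn Ω χ u) 2 volume := by
  rw [cutFn, memLp_indicator_iff_restrict hΩ]
  exact (Lp.memLp (fn u)).mul' (hχ.memLp_top_of_hasCompactSupport hχc _)

theorem memLp_cutGrad (hΩ : MeasurableSet Ω) (hχ : ContDiff ℝ (⊤ : ℕ∞) χ)
    (hχc : HasCompactSupport χ) (u : H1 Ω) : MemLp (cutGrad Ω χ u) 2 volume := by
  rw [cutGrad, memLp_indicator_iff_restrict hΩ]
  refine MemLp.add ?_ ?_
  · exact (Lp.memLp (wgrad u)).smul (hχ.continuous.memLp_top_of_hasCompactSupport hχc _)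
  · exact MemLp.smul (p := 2) (q := ⊤)
      (hχ.gradient_contDiff.continuous.memLp_top_of_hasCompactSupport hχc.gradient _)
      (Lp.memLp (fn u))

open scoped Convolution in
/-- Where the kernel, reflected about a point `y` of `Ω` and multiplied by `χ`, is a test function
of `Ω`, mollifying `χ u` commutes with taking the gradient. -/
theorem gradient_convolution_cutFn (hΩ : IsOpen Ω) (hχ : ContDiff ℝ (⊤ : ℕ∞) χ)
    (hχc : HasCompactSupport χ) (u : H1 Ω) {k : Space n → ℝ} (hk : ContDiff ℝ (⊤ : ℕ∞) k)
    (hkc : HasCompactSupport k) {y : Space n}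
    (hy : IsTestFunction Ω (fun z => χ z * k (y - z))) :
    gradient (cutFn Ω χ u ⋆[ContinuousLinearMap.mul ℝ ℝ] k) y
      = ∫ z, k (y - z) • cutGrad Ω χ u z := by
  have hwl : LocallyIntegrable (cutFn Ω χ u) :=
    (memLp_cutFn hΩ.measurableSet hχ.continuous hχc u).locallyIntegrable one_le_two
  have hGl : LocallyIntegrable (cutGrad Ω χ u) :=
    (memLp_cutGrad hΩ.measurableSet hχ hχc u).locallyIntegrable one_le_two
  have hkr : HasCompactSupport (fun z => k (y - z)) :=
    hkc.comp_homeomorph (Homeomorph.subLeft y)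
  have hkrc : ContDiff ℝ (⊤ : ℕ∞) (fun z => k (y - z)) := hk.comp (contDiff_const.sub contDiff_id)
  have hGi : Integrable (fun z => k (y - z) • cutGrad Ω χ u z) :=
    hGl.integrable_smul_left_of_hasCompactSupport hkrc.continuous hkr
  have h1 := hkc.hasFDerivAt_convolution_right (ContinuousLinearMap.mul ℝ ℝ) hwl
    (hk.of_le (by simp)) y
  refine ext_inner_right ℝ fun v => ?_
  rw [inner_gradient_left, h1.fderiv, convolution_precompR_apply _ hwl (hkc.fderiv ℝ)
    (hk.continuous_fderiv (by simp)), real_inner_comm, ← integral_inner hGi]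
  have hθ : ∀ z, fderiv ℝ (fun z => χ z * k (y - z)) z v
      = fderiv ℝ χ z v * k (y - z) - χ z * fderiv ℝ k (y - z) v := by
    intro z
    have h2 : HasFDerivAt (fun z => k (y - z)) (-(fderiv ℝ k (y - z))) z := by
      have := ((hk.differentiable (by simp)) (y - z)).hasFDerivAt.comp z
        ((hasFDerivAt_id z).const_sub y)
      refine this.congr_fderiv ?_
      ext w; simp
    have h3 := ((hχ.differentiable (by simp)) z).hasFDerivAt.mul h2
    rw [show (fun z => χ z * k (y - z)) = χ * fun z => k (y - z) from rfl, h3.fderiv]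
    simp; ring
  have hweak := u.2 _ hy v
  have hi1 : Integrable (fun z => fn u z * fderiv ℝ (fun z => χ z * k (y - z)) z v) (vol Ω) :=
    integrable_test_left hy v _
  have hi2 : Integrable (fun z => fn u z * (fderiv ℝ χ z v * k (y - z))) (vol Ω) := by
    refine (Lp.memLp (fn u)).integrable_mul (q := 2) (MemLp.restrict _ ?_)
    refine Continuous.memLp_of_hasCompactSupport ?_ (hkr.mul_left)
    exact ((hχ.continuous_fderiv (by simp)).clm_apply continuous_const).mul hkrc.continuous
  have hi3 : Integrable (fun z => (inner ℝ (wgrad u z) v : ℝ) * (χ z * k (y - z))) (vol Ω) :=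
    integrable_test_right hy v _
  have hl : (cutFn Ω χ u ⋆[ContinuousLinearMap.mul ℝ ℝ] fun a => (fderiv ℝ k a) v) y
      = ∫ z, (fn u z * (fderiv ℝ χ z v * k (y - z))
        - fn u z * fderiv ℝ (fun z => χ z * k (y - z)) z v) ∂(vol Ω) := by
    rw [convolution_def, ← integral_indicator hΩ.measurableSet]
    congr 1 with z
    by_cases hz : z ∈ Ω
    · simp only [cutFn, Set.indicator_of_mem hz, ContinuousLinearMap.mul_apply', hθ]; ring
    · simp [cutFn, Set.indicator_of_notMem hz]
  have hr : ∫ z, (inner ℝ v (k (y - z) • cutGrad Ω χ u z) : ℝ)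
      = ∫ z, (fn u z * (fderiv ℝ χ z v * k (y - z))
        + (inner ℝ (wgrad u z) v : ℝ) * (χ z * k (y - z))) ∂(vol Ω) := by
    rw [← integral_indicator hΩ.measurableSet]
    congr 1 with z
    by_cases hz : z ∈ Ω
    · simp only [cutGrad, Set.indicator_of_mem hz]
      rw [real_inner_smul_right, inner_add_right, real_inner_smul_right, real_inner_smul_right,
        real_inner_comm, real_inner_comm (gradient χ z) v, inner_gradient_left]
      ring
    · simp [cutGrad, Set.indicator_of_notMem hz]
  rw [hl, hr, integral_sub hi2 hi1, integral_add hi2 hi3]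
  have hweak' : ∫ z, fn u z * fderiv ℝ (fun z => χ z * k (y - z)) z v ∂(vol Ω)
      = -∫ z, (inner ℝ (wgrad u z) v : ℝ) * (χ z * k (y - z)) ∂(vol Ω) := hweak
  rw [hweak', sub_neg_eq_add]

open scoped Convolution in
/-- Smooth approximation of `χ u` when `χ` is supported where the cone property holds: translating
into the cone makes the mollification well defined up to the boundary. -/
theorem exists_contDiff_approx_of_cone (hΩ : IsOpen Ω) {x e : Space n} {r : ℝ} (hr : 0 < r)
    (hcone : ∀ y ∈ Ω, ∀ z ∈ Metric.ball x r, ∀ ε : ℝ, 0 < ε → ε < r → ‖z - y - ε • e‖ ≤ ε → z ∈ Ω)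
    (hχ : ContDiff ℝ (⊤ : ℕ∞) χ) (hχs : tsupport χ ⊆ Metric.ball x r) (u : H1 Ω) {κ : ENNReal}
    (hκ : κ ≠ 0) :
    ∃ φ : Space n → ℝ, ContDiff ℝ (⊤ : ℕ∞) φ ∧
      eLpNorm (fun y => φ y - χ y * fn u y) 2 (vol Ω) ≤ κ ∧
      eLpNorm (fun y => gradient φ y - (χ y • wgrad u y + fn u y • gradient χ y)) 2 (vol Ω)
        ≤ κ := by
  have hχc : HasCompactSupport χ :=
    (Metric.isBounded_ball.subset hχs).isCompact_closure.of_isClosed_subset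
      (isClosed_tsupport χ) subset_closure
  have hw := memLp_cutFn hΩ.measurableSet hχ.continuous hχc u
  have hG := memLp_cutGrad hΩ.measurableSet hχ hχc u
  obtain ⟨δ₁, hδ₁, h₁⟩ := exists_eLpNorm_translate_sub_le hw hκ
  obtain ⟨δ₂, hδ₂, h₂⟩ := exists_eLpNorm_translate_sub_le hG hκ
  have he := norm_nonneg e
  obtain ⟨ε, hε, hεb⟩ : ∃ ε : ℝ, 0 < ε ∧ ε * (1 + ‖e‖) ≤ min δ₁ δ₂ ∧ ε < r := by
    refine ⟨min (min δ₁ δ₂ / (1 + ‖e‖)) (r / 2), by positivity, ?_, ?_⟩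
    · rw [← le_div_iff₀ (by positivity)]; exact min_le_left _ _
    · exact (min_le_right _ _).trans_lt (by linarith)
  obtain ⟨k, hk, hkc, hk0, hk1, hks⟩ := exists_mollifier e hε
  have hkn : ∀ v, k v ≠ 0 → ‖v‖ ≤ min δ₁ δ₂ := fun v hv => by
    calc ‖v‖ = ‖(v + ε • e) - ε • e‖ := by simp
      _ ≤ ‖v + ε • e‖ + ‖ε • e‖ := norm_sub_le _ _
      _ ≤ ε + ε * ‖e‖ := by rw [norm_smul, Real.norm_of_nonneg hε.le]; gcongr; exact hks v hv
      _ ≤ _ := by linarith [hεb.1]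
  have htest : ∀ y ∈ Ω, IsTestFunction Ω (fun z => χ z * k (y - z)) := by
    intro y hy
    refine ⟨hχ.mul (hk.comp (contDiff_const.sub contDiff_id)), hχc.mul_right, ?_⟩
    have hsub : tsupport (fun z => χ z * k (y - z)) ⊆ Metric.closedBall (y + ε • e) ε := by
      refine closure_minimal (fun z hz => ?_) Metric.isClosed_closedBall
      have := hks _ (right_ne_zero_of_mul hz)
      rw [Metric.mem_closedBall, dist_comm, dist_eq_norm]
      rwa [show y + ε • e - z = y - z + ε • e by abel]
    intro z hz
    refine hcone y hy z (hχs (closure_mono (fun w hw => left_ne_zero_of_mul hw) hz)) ε hε hεb.2 ?_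
    have := hsub hz
    rwa [Metric.mem_closedBall, dist_eq_norm, ← sub_sub] at this
  refine ⟨cutFn Ω χ u ⋆[ContinuousLinearMap.mul ℝ ℝ] k,
    hkc.contDiff_convolution_right _ (hw.locallyIntegrable one_le_two) hk, ?_, ?_⟩
  · refine le_trans (le_of_eq (eLpNorm_congr_ae ?_)) ((eLpNorm_mono_measure _
      Measure.restrict_le_self).trans (eLpNorm_mollify_sub_le
      (stronglyMeasurable_cutFn hΩ.measurableSet hχ.continuous u) hw hk.continuous hkc hk0 hk1
      fun v hv => h₁ v ((hkn v hv).trans (min_le_left _ _))))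
    filter_upwards [ae_restrict_mem hΩ.measurableSet] with y hy
    rw [convolution_def, cutFn, Set.indicator_of_mem hy]
    simp [mul_comm]
  · refine le_trans (le_of_eq (eLpNorm_congr_ae ?_)) ((eLpNorm_mono_measure _
      Measure.restrict_le_self).trans (eLpNorm_mollify_sub_le
      (stronglyMeasurable_cutGrad hΩ.measurableSet hχ u) hG hk.continuous hkc hk0 hk1
      fun v hv => h₂ v ((hkn v hv).trans (min_le_right _ _))))
    filter_upwards [ae_restrict_mem hΩ.measurableSet] with y hy
    rw [gradient_convolution_cutFn hΩ hχ hχc u hk hkc (htest y hy)]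
    congr 1
    rw [cutGrad, Set.indicator_of_mem hy]

end LocalDensity

open scoped Manifold in
theorem exists_partition {n : ℕ} {K : Set (Space n)} (hK : IsCompact K) {r : Space n → ℝ}
    (hr : ∀ x ∈ K, 0 < r x) : ∃ (t : Finset (Space n)) (χ : t → Space n → ℝ),
      (∀ x ∈ t, x ∈ K) ∧ (∀ i, ContDiff ℝ (⊤ : ℕ∞) (χ i)) ∧
      (∀ i, tsupport (χ i) ⊆ Metric.ball i (r i)) ∧ ∀ y ∈ K, ∑ i, χ i y = 1 := by
  obtain ⟨t, ht, hcov⟩ := hK.elim_nhds_subcover (fun x => Metric.ball x (r x))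
    fun x hx => Metric.ball_mem_nhds x (hr x hx)
  obtain ⟨f, hf⟩ := SmoothPartitionOfUnity.exists_isSubordinate 𝓘(ℝ, Space n) hK.isClosed
    (fun i : t => Metric.ball (i : Space n) (r i)) (fun _ => Metric.isOpen_ball) (by
      intro y hy
      obtain ⟨x, hx, hyx⟩ := Set.mem_iUnion₂.1 (hcov hy)
      exact Set.mem_iUnion.2 ⟨⟨x, hx⟩, hyx⟩)
  refine ⟨t, fun i => f i, ht, fun i => contMDiff_iff_contDiff.1 (f i).contMDiff, hf,
    fun y hy => ?_⟩
  rw [← finsum_eq_sum_of_fintype]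
  exact f.sum_eq_one hy

/-- Smooth functions on `ℝⁿ` are dense in `H¹(Ω)`: approximate `χ i u` for a partition of unity
`χ i` subordinate to the balls of the cone property. -/
theorem IsBoundedLipschitzDomain.exists_contDiff_approx {n : ℕ} {Ω : Set (Space n)}
    (hΩ : IsBoundedLipschitzDomain Ω) (u : H1 Ω) {κ : ENNReal} (hκ : κ ≠ 0) :
    ∃ φ : Space n → ℝ, ContDiff ℝ (⊤ : ℕ∞) φ ∧
      eLpNorm (fun y => φ y - fn u y) 2 (vol Ω) ≤ κ ∧
      eLpNorm (fun y => gradient φ y - wgrad u y) 2 (vol Ω) ≤ κ := by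
  choose! e r hr hcone using fun x (hx : x ∈ closure Ω) => hΩ.exists_cone hx
  obtain ⟨t, χ, ht, hχ, hχs, hsum⟩ := exists_partition hΩ.isBounded.isCompact_closure hr
  have hc : κ / (t.card + 1 : ℕ) ≠ 0 := ENNReal.div_ne_zero.2 ⟨hκ, ENNReal.natCast_ne_top _⟩
  choose φ hφ h1 h2 using fun i : t => exists_contDiff_approx_of_cone hΩ.isOpen (hr i (ht i i.2))
    (hcone i (ht i i.2)) (hχ i) (hχs i) u hc
  have hcard : ∑ _i : t, κ / (t.card + 1 : ℕ) ≤ κ := by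
    rw [Finset.sum_const, Finset.card_univ, Fintype.card_coe, nsmul_eq_mul]
    calc (t.card : ENNReal) * (κ / (t.card + 1 : ℕ))
        ≤ ((t.card + 1 : ℕ) : ENNReal) * (κ / (t.card + 1 : ℕ)) := by gcongr; exact Nat.le_succ _
      _ ≤ κ := ENNReal.mul_div_le
  have hd : ∀ i y, DifferentiableAt ℝ (χ i) y := fun i => (hχ i).differentiable (by simp)
  have hgsum : ∀ y ∈ Ω, ∑ i, gradient (χ i) y = 0 := by
    intro y hy
    rw [← gradient_sum fun i _ => hd i y]
    have : (fun y => ∑ i, χ i y) =ᶠ[𝓝 y] fun _ => (1 : ℝ) := by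
      filter_upwards [hΩ.isOpen.mem_nhds hy] with w hw using hsum w (subset_closure hw)
    rw [this.gradient_eq, gradient_fun_const]
  refine ⟨fun y => ∑ i, φ i y, ContDiff.sum fun i _ => hφ i, ?_, ?_⟩
  · calc eLpNorm (fun y => ∑ i, φ i y - fn u y) 2 (vol Ω)
        = eLpNorm (∑ i, fun y => φ i y - χ i y * fn u y) 2 (vol Ω) := by
          refine eLpNorm_congr_ae ?_
          filter_upwards [ae_restrict_mem hΩ.isOpen.measurableSet] with y hy
          rw [Finset.sum_apply, Finset.sum_sub_distrib, ← Finset.sum_mul,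
            hsum y (subset_closure hy), one_mul]
      _ ≤ ∑ i, eLpNorm (fun y => φ i y - χ i y * fn u y) 2 (vol Ω) :=
          eLpNorm_sum_le (fun i _ => ((hφ i).continuous.aestronglyMeasurable.sub
            ((hχ i).continuous.aestronglyMeasurable.mul (Lp.aestronglyMeasurable _)))) one_le_two
      _ ≤ κ := (Finset.sum_le_sum fun i _ => h1 i).trans hcard
  · have hm : ∀ i, AEStronglyMeasurable (fun y => gradient (φ i) y
        - (χ i y • wgrad u y + fn u y • gradient (χ i) y)) (vol Ω) := fun i => by
      have a1 := (hφ i).gradient_contDiff.continuous.aestronglyMeasurable (μ := vol Ω)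
      have a2 := (hχ i).gradient_contDiff.continuous.aestronglyMeasurable (μ := vol Ω)
      have a3 := (hχ i).continuous.aestronglyMeasurable (μ := vol Ω)
      exact a1.sub ((a3.smul (Lp.aestronglyMeasurable (wgrad u))).add
        ((Lp.aestronglyMeasurable (fn u)).smul a2))
    calc eLpNorm (fun y => gradient (fun y => ∑ i, φ i y) y - wgrad u y) 2 (vol Ω)
        = eLpNorm (∑ i, fun y => gradient (φ i) y
            - (χ i y • wgrad u y + fn u y • gradient (χ i) y)) 2 (vol Ω) := by
          refine eLpNorm_congr_ae ?_
          filter_upwards [ae_restrict_mem hΩ.isOpen.measurableSet] with y hy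
          rw [gradient_sum fun i _ => (hφ i).differentiable (by simp) y, Finset.sum_apply,
            Finset.sum_sub_distrib, Finset.sum_add_distrib, ← Finset.sum_smul, ← Finset.smul_sum,
            hsum y (subset_closure hy), hgsum y hy, one_smul, smul_zero, add_zero]
      _ ≤ ∑ i, eLpNorm (fun y => gradient (φ i) y
            - (χ i y • wgrad u y + fn u y • gradient (χ i) y)) 2 (vol Ω) :=
          eLpNorm_sum_le (fun i _ => hm i) one_le_two
      _ ≤ κ := (Finset.sum_le_sum fun i _ => h2 i).trans hcard

/-! ### The Hilbert space `H¹(Ω)` and the trace operator -/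

section L2

theorem Lp_enorm_sq {α E : Type*} [MeasurableSpace α] {μ : Measure α} [NormedAddCommGroup E]
    (F : Lp E 2 μ) : ‖F‖ₑ ^ 2 = ∫⁻ x, ‖F x‖ₑ ^ 2 ∂μ := by
  rw [Lp.enorm_def, eLpNorm_two_sq]

theorem norm_sq_le_of_enorm_sq_le {E F : Type*} [NormedAddCommGroup E] [NormedAddCommGroup F]
    {a : E} {b : F} {C : ENNReal} (hC : C ≠ ⊤) (h : ‖a‖ₑ ^ 2 ≤ C * ‖b‖ₑ ^ 2) :
    ‖a‖ ^ 2 ≤ C.toReal * ‖b‖ ^ 2 := by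
  have h1 := ENNReal.toReal_mono (ENNReal.mul_ne_top hC (ENNReal.pow_ne_top enorm_ne_top)) h
  simpa using h1

theorem memLp_restrict_of_isBounded {n : ℕ} {E : Type*} [NormedAddCommGroup E] {s : Set (Space n)}
    (hs : Bornology.IsBounded s) (hsm : MeasurableSet s) {μ : Measure (Space n)}
    [IsFiniteMeasure (μ.restrict s)] {f : Space n → E} (hf : Continuous f) (p : ENNReal) :
    MemLp f p (μ.restrict s) := by
  obtain ⟨C, hC⟩ := hs.isCompact_closure.exists_bound_of_continuousOn hf.continuousOn
  refine MemLp.of_bound ?_ C ?_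
  · exact hf.aestronglyMeasurable
  · filter_upwards [ae_restrict_mem hsm] with x hx using hC x (subset_closure hx)

end L2

section H1

variable {n : ℕ} {Ω : Set (Space n)}

/-- `u ↦ ∇u` as a bounded operator from `H¹(Ω)` to `L²(Ω)`. -/
def wgradL (Ω : Set (Space n)) : H1 Ω →L[ℝ] Lp (Space n) 2 (vol Ω) :=
  (ContinuousLinearMap.snd ℝ _ _).comp
    ((WithLp.prodContinuousLinearEquiv 2 ℝ _ _).toContinuousLinearMap.comp (H1 Ω).subtypeL)

@[simp] theorem wgradL_apply (u : H1 Ω) : wgradL Ω u = wgrad u := rfl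

theorem H1_norm_sq (u : H1 Ω) : ‖u‖ ^ 2 = ‖fn u‖ ^ 2 + ‖wgrad u‖ ^ 2 :=
  WithLp.prod_norm_sq_eq_of_L2 _

/-- Each of the identities that define the weak gradient is an equation between continuous linear
functionals of the pair `(u, ∇u)`. -/
theorem isClosed_H1 (Ω : Set (Space n)) :
    IsClosed (H1 Ω : Set (WithLp 2 (Lp ℝ 2 (vol Ω) × Lp (Space n) 2 (vol Ω)))) := by
  have hset : (H1 Ω : Set (WithLp 2 (Lp ℝ 2 (vol Ω) × Lp (Space n) 2 (vol Ω))))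
      = ⋂ (φ : Space n → ℝ) (_ : IsTestFunction Ω φ) (e : Space n),
        {p | ∫ x, p.fst x * fderiv ℝ φ x e ∂(vol Ω)
          = - ∫ x, (inner ℝ (p.snd x) e : ℝ) * φ x ∂(vol Ω)} := by
    ext p
    simp only [Set.mem_iInter, Set.mem_ofPred_eq]
    rfl
  rw [hset]
  refine isClosed_iInter fun φ => isClosed_iInter fun hφ => isClosed_iInter fun e => ?_
  have h1 : ∀ p : WithLp 2 (Lp ℝ 2 (vol Ω) × Lp (Space n) 2 (vol Ω)),
      ∫ x, p.fst x * fderiv ℝ φ x e ∂(vol Ω)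
        = inner ℝ ((hφ.memLp_fderiv e).toLp _) p.fst := fun p => by
    rw [L2.inner_def]
    refine integral_congr_ae ?_
    filter_upwards [(hφ.memLp_fderiv e).coeFn_toLp] with x hx
    rw [hx]; rfl
  have hm : MemLp (fun x => φ x • e) 2 (vol Ω) :=
    (memLp_top_const e).smul (r := 2) (p := 2) (q := ⊤) hφ.memLp
  have h2 : ∀ p : WithLp 2 (Lp ℝ 2 (vol Ω) × Lp (Space n) 2 (vol Ω)),
      ∫ x, (inner ℝ (p.snd x) e : ℝ) * φ x ∂(vol Ω) = inner ℝ (hm.toLp _) p.snd := fun p => by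
    rw [L2.inner_def]
    refine integral_congr_ae ?_
    filter_upwards [hm.coeFn_toLp] with x hx
    rw [hx, real_inner_smul_left, real_inner_comm, mul_comm]
  simp_rw [h1, h2]
  exact isClosed_eq (continuous_const.inner (WithLp.continuous_fst 2 _ _))
    (continuous_const.inner (WithLp.continuous_snd 2 _ _)).neg

instance : CompleteSpace (H1 Ω) := (isClosed_H1 Ω).completeSpace_coe

theorem IsBoundedLipschitzDomain.isFiniteMeasure_vol (hΩ : IsBoundedLipschitzDomain Ω) :
    IsFiniteMeasure (vol Ω) :=
  ⟨by rw [vol, Measure.restrict_apply_univ]; exact hΩ.isBounded.measure_lt_top⟩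

theorem IsBoundedLipschitzDomain.memLp_vol (hΩ : IsBoundedLipschitzDomain Ω) {E : Type*}
    [NormedAddCommGroup E] {f : Space n → E} (hf : Continuous f) (p : ENNReal) :
    MemLp f p (vol Ω) :=
  have := hΩ.isFiniteMeasure_vol
  memLp_restrict_of_isBounded hΩ.isBounded hΩ.isOpen.measurableSet hf p

theorem IsBoundedLipschitzDomain.memLp_surf (hΩ : IsBoundedLipschitzDomain Ω) {E : Type*}
    [NormedAddCommGroup E] {f : Space n → E} (hf : Continuous f) (p : ENNReal) :
    MemLp f p (surf Ω) :=
  have := hΩ.isFiniteMeasure_surf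
  memLp_restrict_of_isBounded hΩ.isCompact_frontier.isBounded isClosed_frontier.measurableSet hf p

/-- The smooth functions on `ℝⁿ`. -/
def smoothFn (n : ℕ) : Submodule ℝ (Space n → ℝ) where
  carrier := {f | ContDiff ℝ (⊤ : ℕ∞) f}
  zero_mem' := by
    change ContDiff ℝ (⊤ : ℕ∞) (fun _ : Space n => (0 : ℝ))
    exact contDiff_const
  add_mem' := by
    intro f g (hf : ContDiff ℝ (⊤ : ℕ∞) f) (hg : ContDiff ℝ (⊤ : ℕ∞) g)
    exact hf.add hg
  smul_mem' := by
    intro c f (hf : ContDiff ℝ (⊤ : ℕ∞) f)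
    exact hf.const_smul c

theorem contDiff_smoothFn (f : smoothFn n) : ContDiff ℝ (⊤ : ℕ∞) f.1 := f.2

theorem contDiff_one_smoothFn (f : smoothFn n) : ContDiff ℝ 1 f.1 :=
  (contDiff_smoothFn f).of_le (by simp)

/-- The constant function `1`. -/
def smoothOne (n : ℕ) : smoothFn n := ⟨fun _ => 1, by
  change ContDiff ℝ (⊤ : ℕ∞) (fun _ : Space n => (1 : ℝ))
  exact contDiff_const⟩

theorem gradient_add_smoothFn (f g : smoothFn n) :
    gradient (f + g).1 = gradient f.1 + gradient g.1 := by
  ext1 x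
  refine ext_inner_right ℝ fun v => ?_
  rw [inner_gradient_left, Pi.add_apply, inner_add_left, inner_gradient_left, inner_gradient_left,
    Submodule.coe_add, fderiv_add ((contDiff_one_smoothFn f).differentiable one_ne_zero x)
      ((contDiff_one_smoothFn g).differentiable one_ne_zero x)]
  rfl

theorem gradient_smul_smoothFn (c : ℝ) (f : smoothFn n) :
    gradient (c • f).1 = c • gradient f.1 := by
  ext1 x
  refine ext_inner_right ℝ fun v => ?_
  rw [inner_gradient_left, Pi.smul_apply, real_inner_smul_left, inner_gradient_left,
    Submodule.coe_smul, fderiv_const_smul ((contDiff_one_smoothFn f).differentiable one_ne_zero x)]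
  rfl

/-- Integration by parts: the test function removes all boundary terms. -/
theorem isWeakGradient_gradient (hΩ : IsBoundedLipschitzDomain Ω) {f : Space n → ℝ}
    (hf : ContDiff ℝ 1 f) :
    IsWeakGradient Ω ((hΩ.memLp_vol hf.continuous 2).toLp f)
      ((hΩ.memLp_vol (continuous_gradient hf) 2).toLp (gradient f)) := by
  intro φ hφ e
  have hdf := hf.continuous_fderiv one_ne_zero
  have hφd := hφ.1.continuous_fderiv (by simp)
  have hz : ∀ x ∉ Ω, φ x = 0 := fun x hx => image_eq_zero_of_notMem_tsupport fun h => hx (hφ.2.2 h)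
  have hz' : ∀ x ∉ Ω, fderiv ℝ φ x e = 0 := fun x hx => by
    rw [image_eq_zero_of_notMem_tsupport (f := fderiv ℝ φ)
      fun h => hx (hφ.2.2 (tsupport_fderiv_subset ℝ h))]
    rfl
  have h1 : ∫ x, ((hΩ.memLp_vol hf.continuous 2).toLp f) x * fderiv ℝ φ x e ∂(vol Ω)
      = ∫ x, f x * fderiv ℝ φ x e := by
    rw [← setIntegral_eq_integral_of_forall_compl_eq_zero (s := Ω) (μ := volume)
      (f := fun x => f x * fderiv ℝ φ x e) (fun x hx => by simp [hz' x hx])]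
    refine integral_congr_ae ?_
    filter_upwards [(hΩ.memLp_vol hf.continuous 2).coeFn_toLp] with x hx
    rw [hx]
  have h2 : ∫ x, (inner ℝ (((hΩ.memLp_vol (continuous_gradient hf) 2).toLp (gradient f)) x) e : ℝ)
        * φ x ∂(vol Ω) = ∫ x, fderiv ℝ f x e * φ x := by
    rw [← setIntegral_eq_integral_of_forall_compl_eq_zero (s := Ω) (μ := volume)
      (f := fun x => fderiv ℝ f x e * φ x) (fun x hx => by simp [hz x hx])]
    refine integral_congr_ae ?_
    filter_upwards [(hΩ.memLp_vol (continuous_gradient hf) 2).coeFn_toLp] with x hx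
    rw [hx, inner_gradient_left]
  rw [h1, h2]
  refine integral_mul_fderiv_eq_neg_fderiv_mul_of_integrable ?_ ?_ ?_
    (fun x _ => hf.differentiable one_ne_zero x) (fun x _ => hφ.1.differentiable (by simp) x)
  · exact ((hdf.clm_apply continuous_const).mul hφ.1.continuous).integrable_of_hasCompactSupport
      hφ.2.1.mul_left
  · exact (hf.continuous.mul (hφd.clm_apply continuous_const)).integrable_of_hasCompactSupport
      (hφ.2.1.fderiv_apply ℝ e).mul_left
  · exact (hf.continuous.mul hφ.1.continuous).integrable_of_hasCompactSupport hφ.2.1.mul_left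

/-- The restriction of smooth functions to `Ω`, as elements of `H¹(Ω)`. -/
def smoothToH1 (hΩ : IsBoundedLipschitzDomain Ω) : smoothFn n →ₗ[ℝ] H1 Ω where
  toFun f := ⟨WithLp.toLp 2 ((hΩ.memLp_vol (contDiff_one_smoothFn f).continuous 2).toLp f.1,
    (hΩ.memLp_vol (continuous_gradient (contDiff_one_smoothFn f)) 2).toLp (gradient f.1)),
    isWeakGradient_gradient hΩ (contDiff_one_smoothFn f)⟩
  map_add' f g := by
    refine Subtype.ext (congrArg (WithLp.toLp 2) (Prod.ext rfl ?_))
    simp only [gradient_add_smoothFn]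
    rfl
  map_smul' c f := by
    refine Subtype.ext (congrArg (WithLp.toLp 2) (Prod.ext rfl ?_))
    simp only [gradient_smul_smoothFn]
    rfl

theorem fn_smoothToH1 (hΩ : IsBoundedLipschitzDomain Ω) (f : smoothFn n) :
    fn (smoothToH1 hΩ f) =ᵐ[vol Ω] f.1 :=
  (hΩ.memLp_vol (contDiff_one_smoothFn f).continuous 2).coeFn_toLp

theorem wgrad_smoothToH1 (hΩ : IsBoundedLipschitzDomain Ω) (f : smoothFn n) :
    wgrad (smoothToH1 hΩ f) =ᵐ[vol Ω] gradient f.1 :=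
  (hΩ.memLp_vol (continuous_gradient (contDiff_one_smoothFn f)) 2).coeFn_toLp

/-- The restriction of smooth functions to `∂Ω`. -/
def smoothTrace (hΩ : IsBoundedLipschitzDomain Ω) : smoothFn n →ₗ[ℝ] Lp ℝ 2 (surf Ω) where
  toFun f := (hΩ.memLp_surf (contDiff_one_smoothFn f).continuous 2).toLp f.1
  map_add' _ _ := rfl
  map_smul' _ _ := rfl

theorem coeFn_smoothTrace (hΩ : IsBoundedLipschitzDomain Ω) (f : smoothFn n) :
    smoothTrace hΩ f =ᵐ[surf Ω] f.1 :=
  (hΩ.memLp_surf (contDiff_one_smoothFn f).continuous 2).coeFn_toLp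

theorem enorm_fn_smoothToH1_sub (hΩ : IsBoundedLipschitzDomain Ω) (f : smoothFn n) (u : H1 Ω) :
    ‖fn (smoothToH1 hΩ f - u)‖ₑ = eLpNorm (fun x => f.1 x - fn u x) 2 (vol Ω) := by
  rw [Lp.enorm_def]
  refine eLpNorm_congr_ae ?_
  filter_upwards [Lp.coeFn_sub (fn (smoothToH1 hΩ f)) (fn u), fn_smoothToH1 hΩ f] with x hx hx'
  rw [← hx', ← Pi.sub_apply, ← hx]; rfl

theorem enorm_wgrad_smoothToH1_sub (hΩ : IsBoundedLipschitzDomain Ω) (f : smoothFn n) (u : H1 Ω) :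
    ‖wgrad (smoothToH1 hΩ f - u)‖ₑ
      = eLpNorm (fun x => gradient f.1 x - wgrad u x) 2 (vol Ω) := by
  rw [Lp.enorm_def]
  refine eLpNorm_congr_ae ?_
  filter_upwards [Lp.coeFn_sub (wgrad (smoothToH1 hΩ f)) (wgrad u), wgrad_smoothToH1 hΩ f]
    with x hx hx'
  rw [← hx', ← Pi.sub_apply, ← hx]; rfl

theorem enorm_smoothTrace_sub (hΩ : IsBoundedLipschitzDomain Ω) (f : smoothFn n)
    (g : Lp ℝ 2 (surf Ω)) :
    ‖smoothTrace hΩ f - g‖ₑ = eLpNorm (fun x => f.1 x - g x) 2 (surf Ω) := by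
  rw [Lp.enorm_def]
  refine eLpNorm_congr_ae ?_
  filter_upwards [Lp.coeFn_sub (smoothTrace hΩ f) g, coeFn_smoothTrace hΩ f] with x hx hx'
  rw [hx, Pi.sub_apply, hx']

theorem denseRange_smoothToH1 (hΩ : IsBoundedLipschitzDomain Ω) :
    DenseRange (smoothToH1 hΩ) := by
  intro u
  rw [Metric.mem_closure_iff]
  intro ε hε
  obtain ⟨φ, hφ, h1, h2⟩ := hΩ.exists_contDiff_approx u (κ := ENNReal.ofReal (ε / 2))
    (by simpa using hε)
  refine ⟨_, ⟨⟨φ, hφ⟩, rfl⟩, ?_⟩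
  set v := smoothToH1 hΩ ⟨φ, hφ⟩ - u with hv
  have h1' : ‖fn v‖ ≤ ε / 2 := by
    rw [← enorm_fn_smoothToH1_sub hΩ ⟨φ, hφ⟩ u, ← ofReal_norm,
      ENNReal.ofReal_le_ofReal_iff (by positivity)] at h1
    exact h1
  have h2' : ‖wgrad v‖ ≤ ε / 2 := by
    rw [← enorm_wgrad_smoothToH1_sub hΩ ⟨φ, hφ⟩ u, ← ofReal_norm,
      ENNReal.ofReal_le_ofReal_iff (by positivity)] at h2
    exact h2
  rw [dist_comm, dist_eq_norm, ← hv]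
  refine lt_of_pow_lt_pow_left₀ 2 hε.le ?_
  rw [H1_norm_sq]
  nlinarith [norm_nonneg (fn v), norm_nonneg (wgrad v)]

theorem exists_norm_smoothTrace_le (hΩ : IsBoundedLipschitzDomain Ω) :
    ∃ C : ℝ, ∀ f : smoothFn n, ‖smoothTrace hΩ f‖ ≤ C * ‖smoothToH1 hΩ f‖ := by
  obtain ⟨C, hC, h⟩ := hΩ.trace_inequality
  refine ⟨Real.sqrt C.toReal, fun f => ?_⟩
  have h1 : ‖smoothTrace hΩ f‖ₑ ^ 2 ≤ C * ‖smoothToH1 hΩ f‖ₑ ^ 2 := by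
    have h2 : ‖smoothToH1 hΩ f‖ₑ ^ 2
        = ‖fn (smoothToH1 hΩ f)‖ₑ ^ 2 + ‖wgrad (smoothToH1 hΩ f)‖ₑ ^ 2 := by
      simp only [← ofReal_norm, ← ENNReal.ofReal_pow (norm_nonneg _)]
      rw [← ENNReal.ofReal_add (by positivity) (by positivity), H1_norm_sq]
    have hm : Measurable (fun x => ‖f.1 x‖ₑ ^ 2) := by
      have := (contDiff_one_smoothFn f).continuous
      fun_prop
    have e1 : ∫⁻ x, ‖smoothTrace hΩ f x‖ₑ ^ 2 ∂(surf Ω) = ∫⁻ x, ‖f.1 x‖ₑ ^ 2 ∂(surf Ω) :=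
      lintegral_congr_ae ((coeFn_smoothTrace hΩ f).mono fun x hx => by simp only [hx])
    have e2 : ∫⁻ x, ‖fn (smoothToH1 hΩ f) x‖ₑ ^ 2 ∂(vol Ω) = ∫⁻ x, ‖f.1 x‖ₑ ^ 2 ∂(vol Ω) :=
      lintegral_congr_ae ((fn_smoothToH1 hΩ f).mono fun x hx => by simp only [hx])
    have e3 : ∫⁻ x, ‖wgrad (smoothToH1 hΩ f) x‖ₑ ^ 2 ∂(vol Ω)
        = ∫⁻ x, ‖gradient f.1 x‖ₑ ^ 2 ∂(vol Ω) :=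
      lintegral_congr_ae ((wgrad_smoothToH1 hΩ f).mono fun x hx => by simp only [hx])
    rw [h2, Lp_enorm_sq, Lp_enorm_sq, Lp_enorm_sq, e1, e2, e3, ← lintegral_add_left hm]
    exact h f (contDiff_one_smoothFn f)
  have h3 := norm_sq_le_of_enorm_sq_le hC h1
  refine le_of_sq_le_sq ?_ (by positivity)
  rwa [mul_pow, Real.sq_sqrt ENNReal.toReal_nonneg]

/-- The trace operator, the continuous extension of the restriction of smooth functions. -/
def traceL (hΩ : IsBoundedLipschitzDomain Ω) : H1 Ω →L[ℝ] Lp ℝ 2 (surf Ω) :=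
  (smoothTrace hΩ).extendOfNorm (smoothToH1 hΩ)

theorem traceL_smoothToH1 (hΩ : IsBoundedLipschitzDomain Ω) (f : smoothFn n) :
    traceL hΩ (smoothToH1 hΩ f) = smoothTrace hΩ f :=
  LinearMap.extendOfNorm_eq (denseRange_smoothToH1 hΩ) (exists_norm_smoothTrace_le hΩ) f

theorem tendsto_iff_eLpNorm_smoothToH1_sub (hΩ : IsBoundedLipschitzDomain Ω) (f : ℕ → smoothFn n)
    (u : H1 Ω) : Tendsto (fun m => smoothToH1 hΩ (f m)) atTop (𝓝 u) ↔
      Tendsto (fun m => eLpNorm (fun x => (f m).1 x - fn u x) 2 (vol Ω)) atTop (𝓝 0) ∧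
      Tendsto (fun m => eLpNorm (fun x => gradient (f m).1 x - wgrad u x) 2 (vol Ω))
        atTop (𝓝 0) := by
  simp_rw [← enorm_fn_smoothToH1_sub hΩ, ← enorm_wgrad_smoothToH1_sub hΩ]
  have hE : ∀ {E : Type _} [NormedAddCommGroup E] (a : ℕ → E),
      Tendsto (fun m => ‖a m‖ₑ) atTop (𝓝 0) ↔ Tendsto (fun m => ‖a m‖) atTop (𝓝 0) := fun a => by
    rw [← ENNReal.tendsto_toReal_iff (fun _ => enorm_ne_top) ENNReal.zero_ne_top]
    simp
  rw [hE, hE, tendsto_iff_norm_sub_tendsto_zero]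
  set v : ℕ → H1 Ω := fun m => smoothToH1 hΩ (f m) - u with hv
  have hle1 : ∀ m, ‖fn (v m)‖ ≤ ‖v m‖ := fun m =>
    le_of_sq_le_sq (by rw [H1_norm_sq]; nlinarith [sq_nonneg ‖wgrad (v m)‖]) (norm_nonneg _)
  have hle2 : ∀ m, ‖wgrad (v m)‖ ≤ ‖v m‖ := fun m =>
    le_of_sq_le_sq (by rw [H1_norm_sq]; nlinarith [sq_nonneg ‖fn (v m)‖]) (norm_nonneg _)
  constructor
  · intro h
    exact ⟨squeeze_zero (fun _ => norm_nonneg _) hle1 h,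
      squeeze_zero (fun _ => norm_nonneg _) hle2 h⟩
  · rintro ⟨h1, h2⟩
    refine squeeze_zero (fun _ => norm_nonneg _) (fun m => ?_) (by simpa using h1.add h2)
    refine le_of_sq_le_sq ?_ (add_nonneg (norm_nonneg _) (norm_nonneg _))
    have := H1_norm_sq (v m)
    nlinarith [mul_nonneg (norm_nonneg (fn (v m))) (norm_nonneg (wgrad (v m)))]

/-- The approximation property that defines traces characterizes the values of the continuous
extension: existence by density, uniqueness by continuity. -/
theorem isTrace_iff (hΩ : IsBoundedLipschitzDomain Ω) (u : H1 Ω) (g : Lp ℝ 2 (surf Ω)) :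
    IsTrace Ω u g ↔ g = traceL hΩ u := by
  have hg : ∀ (f : ℕ → smoothFn n),
      Tendsto (fun m => eLpNorm (fun x => (f m).1 x - g x) 2 (surf Ω)) atTop (𝓝 0) ↔
        Tendsto (fun m => smoothTrace hΩ (f m)) atTop (𝓝 g) := fun f => by
    simp_rw [← enorm_smoothTrace_sub hΩ]
    rw [tendsto_iff_norm_sub_tendsto_zero,
      ← ENNReal.tendsto_toReal_iff (fun _ => enorm_ne_top) ENNReal.zero_ne_top]
    simp
  constructor
  · rintro ⟨φ, hφ, h1, h2, h3⟩
    have hu := (tendsto_iff_eLpNorm_smoothToH1_sub hΩ (fun m => ⟨φ m, hφ m⟩) u).2 ⟨h1, h2⟩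
    have hT := ((traceL hΩ).continuous.tendsto u).comp hu
    refine tendsto_nhds_unique ((hg fun m => ⟨φ m, hφ m⟩).1 h3) ?_
    simpa only [Function.comp_def, traceL_smoothToH1] using hT
  · rintro rfl
    obtain ⟨a, ha, hau⟩ := mem_closure_iff_seq_limit.1 (denseRange_smoothToH1 hΩ u)
    choose f hf using ha
    obtain rfl : a = fun m => smoothToH1 hΩ (f m) := funext fun m => (hf m).symm
    obtain ⟨h1, h2⟩ := (tendsto_iff_eLpNorm_smoothToH1_sub hΩ f u).1 hau
    refine ⟨fun m => f m, fun m => contDiff_smoothFn (f m), h1, h2, (hg f).2 ?_⟩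
    have hT := ((traceL hΩ).continuous.tendsto u).comp hau
    simpa only [Function.comp_def, traceL_smoothToH1] using hT

theorem trace_eq_traceL (hΩ : IsBoundedLipschitzDomain Ω) (u : H1 Ω) : trace u = traceL hΩ u := by
  have h : ∃ g, IsTrace Ω u g := ⟨_, (isTrace_iff hΩ u _).2 rfl⟩
  rw [trace, dif_pos h]
  exact (isTrace_iff hΩ u _).1 h.choose_spec

/-! ### Coercivity -/

/-- The constant function `1` in `H¹(Ω)`. -/
def oneH1 (hΩ : IsBoundedLipschitzDomain Ω) : H1 Ω := smoothToH1 hΩ (smoothOne n)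

theorem wgrad_oneH1 (hΩ : IsBoundedLipschitzDomain Ω) : wgrad (oneH1 hΩ) = 0 := by
  refine Lp.ext ((wgrad_smoothToH1 hΩ (smoothOne n)).trans ?_)
  filter_upwards [Lp.coeFn_zero (Space n) 2 (vol Ω)] with x hx
  rw [hx]
  exact gradient_fun_const _ _

theorem coeFn_trace_oneH1 (hΩ : IsBoundedLipschitzDomain Ω) :
    traceL hΩ (oneH1 hΩ) =ᵐ[surf Ω] fun _ => 1 := by
  rw [oneH1, traceL_smoothToH1]
  exact coeFn_smoothTrace hΩ _

theorem inner_trace_oneH1 (hΩ : IsBoundedLipschitzDomain Ω) (g : Lp ℝ 2 (surf Ω)) :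
    inner ℝ (traceL hΩ (oneH1 hΩ)) g = ∫ x, g x ∂(surf Ω) := by
  rw [L2.inner_def]
  refine integral_congr_ae ?_
  filter_upwards [coeFn_trace_oneH1 hΩ] with x hx
  rw [hx]; simp

theorem norm_trace_oneH1_pos (hΩ : IsBoundedLipschitzDomain Ω) (hfr : (frontier Ω).Nonempty) :
    0 < ‖traceL hΩ (oneH1 hΩ)‖ := by
  obtain ⟨x, hx⟩ := hfr
  have := hΩ.isFiniteMeasure_surf
  have h1 := inner_trace_oneH1 hΩ (traceL hΩ (oneH1 hΩ))
  rw [integral_congr_ae (coeFn_trace_oneH1 hΩ), real_inner_self_eq_norm_sq] at h1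
  have h2 : 0 < (surf Ω).real Set.univ :=
    ENNReal.toReal_pos (hΩ.surf_pos hx isOpen_univ trivial).ne' (measure_ne_top _ _)
  simp only [integral_const, smul_eq_mul, mul_one] at h1
  rw [← h1] at h2
  exact (sq_pos_iff.1 h2).lt_of_le' (norm_nonneg _)

/-- The Poincaré inequality for smooth functions, with one of the values of `f` as the constant. -/
theorem exists_norm_sub_const_le (hΩ : IsBoundedLipschitzDomain Ω) :
    ∃ K : ℝ, ∀ f : smoothFn n, ∃ c : ℝ,
      ‖smoothToH1 hΩ f - c • oneH1 hΩ‖ ≤ K * ‖wgrad (smoothToH1 hΩ f)‖ := by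
  obtain ⟨C, hC, h⟩ := hΩ.linked_self
  have hvol : volume Ω ≠ 0 := (hΩ.isOpen.measure_pos _ hΩ.isConnected.nonempty).ne'
  refine ⟨Real.sqrt ((C / volume Ω).toReal + 1), fun f => ?_⟩
  have := hΩ.isFiniteMeasure_vol
  have hf := h f (contDiff_one_smoothFn f)
  have hm : Measurable (fun y => ∫⁻ z in Ω, ‖f.1 y - f.1 z‖ₑ ^ 2) :=
    Measurable.lintegral_prod_right' (measurable_enorm_sub_sq (contDiff_one_smoothFn f))
  -- Some value of `f` does at least as well as the average over all values.
  obtain ⟨y, hy⟩ := exists_le_laverage (μ := vol Ω) (by simpa using hvol) hm.aemeasurable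
  rw [laverage_eq, vol, Measure.restrict_apply_univ] at hy
  have h1 : ∫⁻ z in Ω, ‖f.1 y - f.1 z‖ₑ ^ 2
      ≤ (C / volume Ω) * ∫⁻ y, ‖gradient f.1 y‖ₑ ^ 2 ∂(vol Ω) := by
    refine hy.trans ((ENNReal.div_le_div_right hf _).trans (le_of_eq ?_))
    rw [div_eq_mul_inv, div_eq_mul_inv]; ring
  refine ⟨f.1 y, ?_⟩
  set u := smoothToH1 hΩ f with hu
  set c := f.1 y with hc
  have hw : wgrad (u - c • oneH1 hΩ) = wgrad u := by
    rw [← wgradL_apply, map_sub, map_smul, wgradL_apply, wgradL_apply, wgrad_oneH1, smul_zero,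
      sub_zero]
  have h2 : ‖fn (u - c • oneH1 hΩ)‖ₑ ^ 2 ≤ (C / volume Ω) * ‖wgrad u‖ₑ ^ 2 := by
    rw [Lp_enorm_sq, Lp_enorm_sq]
    refine le_trans (le_of_eq ?_) (h1.trans (le_of_eq ?_))
    · refine lintegral_congr_ae ?_
      filter_upwards [Lp.coeFn_sub (fn u) (fn (c • oneH1 hΩ)), Lp.coeFn_smul c (fn (oneH1 hΩ)),
        fn_smoothToH1 hΩ f, fn_smoothToH1 hΩ (smoothOne n)] with x h1 h2 h3 h4
      have h5 : fn (u - c • oneH1 hΩ) x = f.1 x - c * 1 := by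
        refine h1.trans ?_
        rw [Pi.sub_apply, h3]
        congr 1
        refine h2.trans ?_
        rw [Pi.smul_apply, oneH1, h4]; rfl
      rw [h5, mul_one, ← enorm_neg, neg_sub]
    · congr 1
      refine lintegral_congr_ae ?_
      filter_upwards [wgrad_smoothToH1 hΩ f] with x hx
      rw [hx]
  have h3 := norm_sq_le_of_enorm_sq_le (ENNReal.div_ne_top hC hvol) h2
  refine le_of_sq_le_sq ?_ (by positivity)
  rw [mul_pow, Real.sq_sqrt (by positivity), H1_norm_sq, hw]
  linarith

/-- The mean value of the trace, written with the trace of the constant one: the square of its norm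
is the surface area of `∂Ω`, and the inner product with it is the integral over `∂Ω`. -/
def bdryMean (hΩ : IsBoundedLipschitzDomain Ω) : H1 Ω →L[ℝ] ℝ :=
  (‖traceL hΩ (oneH1 hΩ)‖ ^ 2)⁻¹ • (innerSL ℝ (traceL hΩ (oneH1 hΩ))).comp (traceL hΩ)

theorem bdryMean_oneH1 (hΩ : IsBoundedLipschitzDomain Ω) (hfr : (frontier Ω).Nonempty) :
    bdryMean hΩ (oneH1 hΩ) = 1 := by
  have := norm_trace_oneH1_pos hΩ hfr
  simp only [bdryMean, _root_.smul_apply, ContinuousLinearMap.comp_apply, innerSL_apply_apply,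
    real_inner_self_eq_norm_sq, smul_eq_mul]
  field_simp

/-- The Poincaré inequality in `H¹(Ω)`, normalized by the mean value of the trace. -/
theorem exists_norm_sub_bdryMean_le (hΩ : IsBoundedLipschitzDomain Ω)
    (hfr : (frontier Ω).Nonempty) :
    ∃ K : ℝ, 0 ≤ K ∧ ∀ u : H1 Ω, ‖u - bdryMean hΩ u • oneH1 hΩ‖ ≤ K * ‖wgrad u‖ := by
  obtain ⟨K, hK⟩ := exists_norm_sub_const_le hΩ
  set M : ℝ := 1 + ‖bdryMean hΩ‖ * ‖oneH1 hΩ‖ with hM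
  have hM0 : 0 ≤ M := by positivity
  refine ⟨M * |K|, by positivity, fun u => ?_⟩
  refine (denseRange_smoothToH1 hΩ).induction_on (p := fun u : H1 Ω =>
    ‖u - bdryMean hΩ u • oneH1 hΩ‖ ≤ M * |K| * ‖wgrad u‖) u ?_ ?_
  · have h1 := (wgradL Ω).continuous
    have h2 := (bdryMean hΩ).continuous
    exact isClosed_le (by fun_prop) (continuous_const.mul h1.norm)
  · intro f
    obtain ⟨c, hc⟩ := hK f
    set u := smoothToH1 hΩ f
    -- Subtracting a constant from `u` does not change `u` minus its mean.
    have h1 : u - bdryMean hΩ u • oneH1 hΩ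
        = (u - c • oneH1 hΩ) - bdryMean hΩ (u - c • oneH1 hΩ) • oneH1 hΩ := by
      rw [map_sub, map_smul, bdryMean_oneH1 hΩ hfr, smul_eq_mul, mul_one, sub_smul]
      abel
    have h2 : ∀ w : H1 Ω, ‖w - bdryMean hΩ w • oneH1 hΩ‖ ≤ M * ‖w‖ := fun w => by
      have h3 : ‖bdryMean hΩ w • oneH1 hΩ‖ ≤ ‖bdryMean hΩ‖ * ‖w‖ * ‖oneH1 hΩ‖ := by
        rw [norm_smul]
        exact mul_le_mul_of_nonneg_right ((bdryMean hΩ).le_opNorm _) (norm_nonneg _)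
      have h4 := norm_sub_le w (bdryMean hΩ w • oneH1 hΩ)
      have h5 : M * ‖w‖ = ‖w‖ + ‖bdryMean hΩ‖ * ‖w‖ * ‖oneH1 hΩ‖ := by rw [hM]; ring
      linarith
    have h6 : K * ‖wgrad u‖ ≤ |K| * ‖wgrad u‖ :=
      mul_le_mul_of_nonneg_right (le_abs_self K) (norm_nonneg _)
    rw [h1, mul_assoc]
    exact (h2 _).trans (mul_le_mul_of_nonneg_left (hc.trans h6) hM0)

end H1

/-! ### Analytic dependence of the solutions on the coefficient -/

section Abstract

variable {P H F G : Type*} [NormedAddCommGroup P] [NormedSpace ℝ P] [NormedAddCommGroup H]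
  [NormedSpace ℝ H] [NormedAddCommGroup F] [NormedSpace ℝ F]
  [NormedAddCommGroup G] [NormedSpace ℝ G]

/-- The solution operator `f ↦ T (B + A γ)⁻¹ S f`. Where `B + A γ` is not invertible,
`Ring.inverse` makes it zero. -/
def solOp (A : P →L[ℝ] H →L[ℝ] H) (B : H →L[ℝ] H) (S : F →L[ℝ] H) (T : H →L[ℝ] G) (γ : P) :
    F →L[ℝ] G :=
  T.comp ((Ring.inverse (B + A γ)).comp S)

variable {A : P →L[ℝ] H →L[ℝ] H} {B : H →L[ℝ] H} {S : F →L[ℝ] H} {T : H →L[ℝ] G} {γ : P}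

theorem inverse_apply_eq_iff {M : H →L[ℝ] H} (hM : IsUnit M) (g u : H) :
    Ring.inverse M g = u ↔ M u = g := by
  constructor
  · rintro rfl
    exact congrArg (fun N : H →L[ℝ] H => N g) (Ring.mul_inverse_cancel M hM)
  · rintro rfl
    exact congrArg (fun N : H →L[ℝ] H => N u) (Ring.inverse_mul_cancel M hM)

/-- The map `N ↦ T N S`. -/
def sandwich (S : F →L[ℝ] H) (T : H →L[ℝ] G) : (H →L[ℝ] H) →L[ℝ] (F →L[ℝ] G) :=
  (ContinuousLinearMap.compL ℝ F H G T).comp ((ContinuousLinearMap.compL ℝ F H H).flip S)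

theorem sandwich_apply (N : H →L[ℝ] H) : sandwich S T N = T.comp (N.comp S) := rfl

theorem analyticAt_solOp [CompleteSpace H] (h : IsUnit (B + A γ)) :
    AnalyticAt ℝ (solOp A B S T) γ := by
  obtain ⟨z, hz⟩ := h
  have h1 : AnalyticAt ℝ (fun γ => B + A γ) γ := analyticAt_const.add (A.analyticAt γ)
  have h2 : AnalyticAt ℝ (fun γ => Ring.inverse (B + A γ)) γ := by
    refine AnalyticAt.fun_comp (g := Ring.inverse) ?_ h1
    rw [← hz]
    exact analyticAt_inverse z
  exact ((sandwich S T).analyticAt _).fun_comp h2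

/-- Differentiating `(B + A γ) u = S f` in the direction `η` gives the equation
`(B + A γ) u' = -A η u` for the derivative. -/
theorem fderiv_solOp_apply [CompleteSpace H] (h : IsUnit (B + A γ)) {η : P} {f : F} {u u' : H}
    (hu : (B + A γ) u = S f) (hu' : (B + A γ) u' = -A η u) :
    fderiv ℝ (solOp A B S T) γ η f = T u' := by
  set R := Ring.inverse (B + A γ) with hR
  have h4 : R (S f) = u := (inverse_apply_eq_iff h _ _).2 hu
  have h5 : R (-A η u) = u' := (inverse_apply_eq_iff h _ _).2 hu'
  have hinv : HasFDerivAt Ring.inverse (-ContinuousLinearMap.mulLeftRight ℝ (H →L[ℝ] H) R R)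
      (B + A γ) := by
    have h0 := hasFDerivAt_ringInverse (𝕜 := ℝ) h.unit
    rwa [← Ring.inverse_unit h.unit, h.unit_spec] at h0
  have h1 : HasFDerivAt (fun γ => B + A γ) A γ := A.hasFDerivAt.const_add B
  have h2 : HasFDerivAt (fun γ => Ring.inverse (B + A γ))
      ((-ContinuousLinearMap.mulLeftRight ℝ (H →L[ℝ] H) R R).comp A) γ :=
    HasFDerivAt.comp (g := Ring.inverse) γ hinv h1
  have h3 : HasFDerivAt (fun γ => sandwich S T (Ring.inverse (B + A γ))) _ γ :=
    (sandwich S T).hasFDerivAt.comp γ h2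
  have h6 : fderiv ℝ (solOp A B S T) γ = _ := h3.fderiv
  rw [h6, ← h5, ← h4, map_neg]
  simp [sandwich_apply]

end Abstract

section Coercive

variable {H : Type*} [NormedAddCommGroup H] [InnerProductSpace ℝ H]

theorem isUnit_of_coercive [CompleteSpace H] {M : H →L[ℝ] H} {C : ℝ}
    (h : ∀ u, ‖u‖ ^ 2 ≤ C * inner ℝ (M u) u) : IsUnit M := by
  have hC : 0 < |C| + 1 := by positivity
  have hC' : 0 < (|C| + 1)⁻¹ := inv_pos.2 hC
  refine M.isUnit_of_forall_le_norm_inner_map (c := ⟨(|C| + 1)⁻¹, hC'.le⟩) hC' fun u => ?_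
  change ‖u‖ ^ 2 * (|C| + 1)⁻¹ ≤ |inner ℝ (M u) u|
  rw [← div_eq_mul_inv, div_le_iff₀ hC]
  calc ‖u‖ ^ 2 ≤ C * inner ℝ (M u) u := h u
    _ ≤ |C * inner ℝ (M u) u| := le_abs_self _
    _ ≤ |inner ℝ (M u) u| * (|C| + 1) := by
      rw [abs_mul]
      nlinarith [abs_nonneg (inner ℝ (M u) u)]

/-- The operator of the form `⟪r, u⟫ ⟪r, w⟫`. -/
def rankOne (r : H) : H →L[ℝ] H := (innerSL ℝ r).smulRight r

theorem inner_rankOne (r u w : H) : inner ℝ (rankOne r u) w = inner ℝ r u * inner ℝ r w := by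
  rw [rankOne, ContinuousLinearMap.smulRight_apply, innerSL_apply_apply, real_inner_smul_left]

theorem inner_rankOne_add (r : H) (A : H →L[ℝ] H) (u w : H) :
    inner ℝ ((rankOne r + A) u) w = inner ℝ r u * inner ℝ r w + inner ℝ (A u) w := by
  rw [_root_.add_apply, inner_add_left, inner_rankOne]

/-- If `A` controls every vector up to the component along `o` measured by `r`, then adding the
form `⟪r, u⟫ ⟪r, w⟫` makes it coercive. -/
theorem isUnit_rankOne_add [CompleteSpace H] {r o : H} {A : H →L[ℝ] H} {c K s : ℝ} {g : H → ℝ}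
    (hc : 0 < c) (hP : ∀ u, ‖u - (s * inner ℝ r u) • o‖ ≤ K * g u)
    (hE : ∀ u, c * g u ^ 2 ≤ inner ℝ (A u) u) : IsUnit (rankOne r + A) := by
  refine isUnit_of_coercive (C := 2 * (K ^ 2 * c⁻¹ + (s * ‖o‖) ^ 2)) fun u => ?_
  have h2 : ‖u‖ ≤ K * g u + |s * inner ℝ r u| * ‖o‖ := by
    have h3 := norm_add_le (u - (s * inner ℝ r u) • o) ((s * inner ℝ r u) • o)
    rw [sub_add_cancel, norm_smul, Real.norm_eq_abs] at h3
    linarith [hP u]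
  have h1 := hE u
  rw [inner_rankOne_add]
  generalize inner ℝ r u = τ at *
  generalize inner ℝ (A u) u = e at *
  generalize g u = G at *
  have hU : 0 ≤ ‖u‖ := norm_nonneg u
  generalize ‖u‖ = U at *
  generalize ‖o‖ = N at *
  have h5 : G ^ 2 ≤ c⁻¹ * e := by
    rw [inv_mul_eq_div, le_div_iff₀ hc]
    linarith
  have h0 : 0 ≤ e := le_trans (by positivity) h1
  have h6 : U ^ 2 ≤ (K * G + |s * τ| * N) ^ 2 := by gcongr
  have h7 : (K * G + |s * τ| * N) ^ 2 ≤ 2 * (K ^ 2 * G ^ 2 + (s * N) ^ 2 * τ ^ 2) := by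
    have : (|s * τ| * N) ^ 2 = (s * N) ^ 2 * τ ^ 2 := by
      rw [mul_pow, sq_abs]
      ring
    nlinarith [sq_nonneg (K * G - |s * τ| * N)]
  have h8 : K ^ 2 * G ^ 2 ≤ K ^ 2 * (c⁻¹ * e) := mul_le_mul_of_nonneg_left h5 (sq_nonneg _)
  have h9 : 0 ≤ K ^ 2 * c⁻¹ * τ ^ 2 := by positivity
  have h10 : 0 ≤ (s * N) ^ 2 * e := by positivity
  nlinarith

end Coercive

/-! ### The energy form -/

section Energy

variable {n : ℕ} {Ω : Set (Space n)}

/-- Multiplication of square integrable vector fields by bounded functions. -/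
def mulField (Ω : Set (Space n)) :
    Linfty Ω →L[ℝ] Lp (Space n) 2 (vol Ω) →L[ℝ] Lp (Space n) 2 (vol Ω) :=
  (ContinuousLinearMap.lsmul ℝ ℝ).holderL (vol Ω) ⊤ 2 2

theorem coeFn_mulField (a : Linfty Ω) (v : Lp (Space n) 2 (vol Ω)) :
    mulField Ω a v =ᵐ[vol Ω] fun x => a x • v x :=
  ContinuousLinearMap.coeFn_holder _ a v

theorem energy_eq_inner (a : Linfty Ω) (u w : H1 Ω) :
    energy a u w = inner ℝ (mulField Ω a (wgrad u)) (wgrad w) := by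
  rw [L2.inner_def]
  refine integral_congr_ae ?_
  filter_upwards [coeFn_mulField a (wgrad u)] with x hx
  rw [hx, real_inner_smul_left]

/-- The operator of the energy form: `⟪energyOp Ω a u, w⟫ = ∫_Ω a ∇u · ∇w`. -/
def energyOp (Ω : Set (Space n)) : Linfty Ω →L[ℝ] H1 Ω →L[ℝ] H1 Ω :=
  (ContinuousLinearMap.postcomp (H1 Ω) (wgradL Ω).adjoint).comp
    ((ContinuousLinearMap.precomp (Lp (Space n) 2 (vol Ω)) (wgradL Ω)).comp (mulField Ω))

theorem inner_energyOp (a : Linfty Ω) (u w : H1 Ω) :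
    inner ℝ (energyOp Ω a u) w = energy a u w := by
  rw [energy_eq_inner]
  exact ContinuousLinearMap.adjoint_inner_left (wgradL Ω) _ _

theorem exists_energy_ge {γ : Linfty Ω} (hγ : γ ∈ LinftyPlus Ω) :
    ∃ c : ℝ, 0 < c ∧ ∀ u : H1 Ω, c * ‖wgrad u‖ ^ 2 ≤ energy γ u u := by
  obtain ⟨c, hc, h⟩ := hγ
  refine ⟨c, hc, fun u => ?_⟩
  have h1 : c * ‖wgrad u‖ ^ 2 = ∫ x, c * (inner ℝ (wgrad u x) (wgrad u x) : ℝ) ∂(vol Ω) := by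
    rw [integral_const_mul, ← real_inner_self_eq_norm_sq, L2.inner_def]
  rw [h1, energy]
  refine integral_mono_ae ((L2.integrable_inner _ _).const_mul c) ?_ ?_
  · refine (integrable_congr ?_).1 (L2.integrable_inner (𝕜 := ℝ) (mulField Ω γ (wgrad u)) (wgrad u))
    filter_upwards [coeFn_mulField γ (wgrad u)] with x hx
    rw [hx, real_inner_smul_left]
  · filter_upwards [h] with x hx
    exact mul_le_mul_of_nonneg_right hx real_inner_self_nonneg

theorem isOpen_LinftyPlus (Ω : Set (Space n)) : IsOpen (LinftyPlus Ω) := by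
  rw [Metric.isOpen_iff]
  rintro γ ⟨c, hc, h⟩
  refine ⟨c / 2, half_pos hc, fun γ' hγ' => ⟨c / 2, half_pos hc, ?_⟩⟩
  rw [Metric.mem_ball, dist_eq_norm] at hγ'
  have h1 : ∀ᵐ x ∂(vol Ω), ‖(γ' - γ) x‖ₑ ≤ ‖γ' - γ‖ₑ := by
    rw [Lp.enorm_def, eLpNorm_exponent_top]
    exact enorm_ae_le_eLpNormEssSup _ _
  filter_upwards [h, h1, Lp.coeFn_sub γ' γ] with x hx hx1 hx2
  rw [← ofReal_norm, ← ofReal_norm, ENNReal.ofReal_le_ofReal_iff (norm_nonneg _), hx2, Pi.sub_apply,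
    Real.norm_eq_abs] at hx1
  linarith [neg_abs_le (γ' x - γ x)]

theorem energy_oneH1 (hΩ : IsBoundedLipschitzDomain Ω) (a : Linfty Ω) (u : H1 Ω) :
    energy a u (oneH1 hΩ) = 0 := by
  rw [energy_eq_inner, wgrad_oneH1, inner_zero_right]

end Energy

section Boundary

variable {n : ℕ} {Ω : Set (Space n)}

theorem IsBoundedLipschitzDomain.nonempty_frontier (hΩ : IsBoundedLipschitzDomain Ω) (hn : n ≠ 0) :
    (frontier Ω).Nonempty := by
  have : Nonempty (Fin n) := ⟨⟨0, Nat.pos_of_ne_zero hn⟩⟩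
  refine nonempty_frontier_iff.2 ⟨hΩ.isConnected.nonempty, fun h => ?_⟩
  have h1 := hΩ.isBounded
  rw [h] at h1
  exact NormedSpace.unbounded_univ ℝ (Space n) h1

theorem mem_L2Diamond_iff (hΩ : IsBoundedLipschitzDomain Ω) (g : Lp ℝ 2 (surf Ω)) :
    g ∈ L2Diamond Ω ↔ inner ℝ (traceL hΩ (oneH1 hΩ)) g = 0 := by
  have := hΩ.isFiniteMeasure_surf
  rw [inner_trace_oneH1]
  exact ⟨fun h => h.2, fun h => ⟨(Lp.memLp g).integrable one_le_two, h⟩⟩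

theorem completeSpace_L2Diamond (hΩ : IsBoundedLipschitzDomain Ω) :
    CompleteSpace (L2Diamond Ω) := by
  have h : (L2Diamond Ω : Set (Lp ℝ 2 (surf Ω))) = {g | inner ℝ (traceL hΩ (oneH1 hΩ)) g = 0} := by
    ext g
    exact mem_L2Diamond_iff hΩ g
  have hc : IsClosed (L2Diamond Ω : Set (Lp ℝ 2 (surf Ω))) := by
    rw [h]
    exact isClosed_eq (continuous_const.inner continuous_id) continuous_const
  exact hc.completeSpace_coe

/-! ### The continuum model as an operator equation -/

/-- The Riesz representative of `u ↦ ∫_{∂Ω} u dS`. -/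
def traceInt (hΩ : IsBoundedLipschitzDomain Ω) : H1 Ω :=
  (traceL hΩ).adjoint (traceL hΩ (oneH1 hΩ))

theorem inner_traceInt (hΩ : IsBoundedLipschitzDomain Ω) (u : H1 Ω) :
    inner ℝ (traceInt hΩ) u = inner ℝ (traceL hΩ (oneH1 hΩ)) (traceL hΩ u) := by
  rw [traceInt, ContinuousLinearMap.adjoint_inner_left]

theorem trace_mem_L2Diamond_iff (hΩ : IsBoundedLipschitzDomain Ω) (u : H1 Ω) :
    trace u ∈ L2Diamond Ω ↔ inner ℝ (traceInt hΩ) u = 0 := by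
  rw [trace_eq_traceL hΩ, mem_L2Diamond_iff hΩ, inner_traceInt]

/-- The operator of the form `(∫_{∂Ω} u dS) (∫_{∂Ω} w dS)`. -/
def meanOp (hΩ : IsBoundedLipschitzDomain Ω) : H1 Ω →L[ℝ] H1 Ω :=
  rankOne (traceInt hΩ)

theorem inner_meanOp_add (hΩ : IsBoundedLipschitzDomain Ω) (γ : Linfty Ω) (u w : H1 Ω) :
    inner ℝ ((meanOp hΩ + energyOp Ω γ) u) w
      = inner ℝ (traceInt hΩ) u * inner ℝ (traceInt hΩ) w + energy γ u w := by
  rw [meanOp, inner_rankOne_add, inner_energyOp]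

theorem bdryMean_eq_inner (hΩ : IsBoundedLipschitzDomain Ω) (u : H1 Ω) :
    bdryMean hΩ u = (‖traceL hΩ (oneH1 hΩ)‖ ^ 2)⁻¹ * inner ℝ (traceInt hΩ) u := by
  rw [inner_traceInt]
  rfl

/-- Without the constraint on the mean, the form `∫ γ ∇u·∇w + (∫_{∂Ω} u) (∫_{∂Ω} w)` is coercive on
all of `H¹(Ω)`. -/
theorem isUnit_meanOp_add (hΩ : IsBoundedLipschitzDomain Ω) (hfr : (frontier Ω).Nonempty)
    {γ : Linfty Ω} (hγ : γ ∈ LinftyPlus Ω) : IsUnit (meanOp hΩ + energyOp Ω γ) := by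
  obtain ⟨c, hc, hE⟩ := exists_energy_ge hγ
  obtain ⟨K, -, hP⟩ := exists_norm_sub_bdryMean_le hΩ hfr
  simp_rw [bdryMean_eq_inner] at hP
  simp_rw [← inner_energyOp] at hE
  exact isUnit_rankOne_add hc hP hE

/-- The mean of a solution vanishes automatically when the right-hand side annihilates the
constants. -/
theorem meanOp_add_eq_iff (hΩ : IsBoundedLipschitzDomain Ω) (hfr : (frontier Ω).Nonempty)
    (γ : Linfty Ω) {g : H1 Ω} (hg : inner ℝ g (oneH1 hΩ) = 0) (u : H1 Ω) :
    (meanOp hΩ + energyOp Ω γ) u = g ↔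
      trace u ∈ L2Diamond Ω ∧ ∀ w : H1 Ω, energy γ u w = inner ℝ g w := by
  have hin := inner_meanOp_add hΩ γ u
  rw [trace_mem_L2Diamond_iff hΩ]
  constructor
  · rintro rfl
    have h1 := hin (oneH1 hΩ)
    rw [hg, energy_oneH1, add_zero, inner_traceInt hΩ (oneH1 hΩ), real_inner_self_eq_norm_sq] at h1
    have h2 : inner ℝ (traceInt hΩ) u = 0 := by
      rcases mul_eq_zero.1 h1.symm with h | h
      · exact h
      · exact absurd h (pow_pos (norm_trace_oneH1_pos hΩ hfr) 2).ne'
    exact ⟨h2, fun w => by rw [hin, h2, zero_mul, zero_add]⟩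
  · rintro ⟨h1, h2⟩
    refine ext_inner_right ℝ fun w => ?_
    rw [hin, h1, zero_mul, zero_add, h2]

theorem inner_traceL_eq_integral (hΩ : IsBoundedLipschitzDomain Ω) (g : Lp ℝ 2 (surf Ω))
    (w : H1 Ω) : inner ℝ g (traceL hΩ w) = ∫ x, g x * trace w x ∂(surf Ω) := by
  rw [L2.inner_def, trace_eq_traceL hΩ]
  exact integral_congr_ae (Eventually.of_forall fun x => mul_comm _ _)

/-- The boundary data `f` as a functional on `H¹(Ω)`: `⟪fluxL hΩ f, w⟫ = ∫_{∂Ω} f w dS`. -/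
def fluxL (hΩ : IsBoundedLipschitzDomain Ω) : L2Diamond Ω →L[ℝ] H1 Ω :=
  (traceL hΩ).adjoint.comp (L2Diamond Ω).subtypeL

theorem inner_fluxL (hΩ : IsBoundedLipschitzDomain Ω) (f : L2Diamond Ω) (w : H1 Ω) :
    inner ℝ (fluxL hΩ f) w = ∫ x, f.1 x * trace w x ∂(surf Ω) := by
  have h1 : inner ℝ (fluxL hΩ f) w = inner ℝ f.1 (traceL hΩ w) := by
    rw [fluxL, ContinuousLinearMap.comp_apply, ContinuousLinearMap.adjoint_inner_left]
    rfl
  rw [h1, inner_traceL_eq_integral]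

theorem inner_fluxL_oneH1 (hΩ : IsBoundedLipschitzDomain Ω) (f : L2Diamond Ω) :
    inner ℝ (fluxL hΩ f) (oneH1 hΩ) = 0 := by
  have h1 : inner ℝ (fluxL hΩ f) (oneH1 hΩ) = inner ℝ f.1 (traceL hΩ (oneH1 hΩ)) := by
    rw [fluxL, ContinuousLinearMap.comp_apply, ContinuousLinearMap.adjoint_inner_left]
    rfl
  rw [h1, real_inner_comm]
  exact (mem_L2Diamond_iff hΩ _).1 f.2

theorem isCMSolution_iff (hΩ : IsBoundedLipschitzDomain Ω) (hfr : (frontier Ω).Nonempty)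
    (γ : Linfty Ω) (f : L2Diamond Ω) (u : H1 Ω) :
    IsCMSolution γ f u ↔ (meanOp hΩ + energyOp Ω γ) u = fluxL hΩ f := by
  rw [meanOp_add_eq_iff hΩ hfr γ (inner_fluxL_oneH1 hΩ f)]
  simp_rw [inner_fluxL]
  rfl

/-- The trace followed by the projection that subtracts the mean value: a bounded operator into
`L²_⋄(∂Ω)` that is the trace on the elements of `H¹_⋄(Ω)`. -/
def traceDiamond (hΩ : IsBoundedLipschitzDomain Ω) (hfr : (frontier Ω).Nonempty) :
    H1 Ω →L[ℝ] L2Diamond Ω :=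
  ((traceL hΩ).comp (ContinuousLinearMap.id ℝ _ - (bdryMean hΩ).smulRight (oneH1 hΩ))).codRestrict
    (L2Diamond Ω) fun u => by
      rw [mem_L2Diamond_iff hΩ]
      have h0 := (norm_trace_oneH1_pos hΩ hfr).ne'
      have h1 : bdryMean hΩ u = (‖traceL hΩ (oneH1 hΩ)‖ ^ 2)⁻¹ *
        inner ℝ (traceL hΩ (oneH1 hΩ)) (traceL hΩ u) := rfl
      simp only [ContinuousLinearMap.comp_apply, _root_.sub_apply,
        ContinuousLinearMap.id_apply, ContinuousLinearMap.smulRight_apply, map_sub, map_smul,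
        inner_sub_right, real_inner_smul_right, real_inner_self_eq_norm_sq, h1]
      field_simp
      ring

theorem coe_traceDiamond (hΩ : IsBoundedLipschitzDomain Ω) (hfr : (frontier Ω).Nonempty) {u : H1 Ω}
    (hu : trace u ∈ L2Diamond Ω) : (traceDiamond hΩ hfr u : Lp ℝ 2 (surf Ω)) = trace u := by
  rw [trace_mem_L2Diamond_iff hΩ, inner_traceInt] at hu
  have h1 : bdryMean hΩ u = (‖traceL hΩ (oneH1 hΩ)‖ ^ 2)⁻¹ *
    inner ℝ (traceL hΩ (oneH1 hΩ)) (traceL hΩ u) := rfl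
  have h2 : (traceDiamond hΩ hfr u : Lp ℝ 2 (surf Ω))
      = traceL hΩ (u - bdryMean hΩ u • oneH1 hΩ) := rfl
  rw [h2, h1, hu, mul_zero, zero_smul, sub_zero, trace_eq_traceL hΩ]

theorem existsUnique_isCMSolution (hΩ : IsBoundedLipschitzDomain Ω) (hfr : (frontier Ω).Nonempty)
    {γ : Linfty Ω} (hγ : γ ∈ LinftyPlus Ω) (f : L2Diamond Ω) : ∃! u : H1 Ω, IsCMSolution γ f u := by
  have hU := isUnit_meanOp_add hΩ hfr hγ
  simp_rw [isCMSolution_iff hΩ hfr, ← inverse_apply_eq_iff hU]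
  exact ⟨_, rfl, fun _ h => h.symm⟩

theorem isNDMap_solOp (hΩ : IsBoundedLipschitzDomain Ω) (hfr : (frontier Ω).Nonempty)
    {γ : Linfty Ω} (hγ : γ ∈ LinftyPlus Ω) :
    IsNDMap γ (solOp (energyOp Ω) (meanOp hΩ) (fluxL hΩ) (traceDiamond hΩ hfr) γ) := by
  intro f
  obtain ⟨u, hu, -⟩ := existsUnique_isCMSolution hΩ hfr hγ f
  refine ⟨u, hu, ?_⟩
  have h1 := (inverse_apply_eq_iff (isUnit_meanOp_add hΩ hfr hγ) _ _).2
    ((isCMSolution_iff hΩ hfr γ f u).1 hu)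
  rw [solOp, ContinuousLinearMap.comp_apply, ContinuousLinearMap.comp_apply, h1,
    coe_traceDiamond hΩ hfr hu.1]

theorem isNDMap_unique (hΩ : IsBoundedLipschitzDomain Ω) (hfr : (frontier Ω).Nonempty)
    {γ : Linfty Ω} (hγ : γ ∈ LinftyPlus Ω) {T T' : L2Diamond Ω →L[ℝ] L2Diamond Ω}
    (h : IsNDMap γ T) (h' : IsNDMap γ T') : T = T' := by
  ext1 f
  obtain ⟨u, hu, hT⟩ := h f
  obtain ⟨u', hu', hT'⟩ := h' f
  have := (existsUnique_isCMSolution hΩ hfr hγ f).unique hu hu'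
  subst this
  exact Subtype.ext (hT.symm.trans hT')

theorem isNDMap_ndMap (hΩ : IsBoundedLipschitzDomain Ω) (hfr : (frontier Ω).Nonempty)
    {γ : Linfty Ω} (hγ : γ ∈ LinftyPlus Ω) : IsNDMap γ (ndMap Ω γ) := by
  have h : ∃ T, IsNDMap γ T := ⟨_, isNDMap_solOp hΩ hfr hγ⟩
  rw [ndMap, dif_pos h]
  exact h.choose_spec

theorem ndMap_eq_solOp (hΩ : IsBoundedLipschitzDomain Ω) (hfr : (frontier Ω).Nonempty)
    {γ : Linfty Ω} (hγ : γ ∈ LinftyPlus Ω) :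
    ndMap Ω γ = solOp (energyOp Ω) (meanOp hΩ) (fluxL hΩ) (traceDiamond hΩ hfr) γ :=
  isNDMap_unique hΩ hfr hγ (isNDMap_ndMap hΩ hfr hγ) (isNDMap_solOp hΩ hfr hγ)

theorem ndMap_eventuallyEq (hΩ : IsBoundedLipschitzDomain Ω) (hfr : (frontier Ω).Nonempty)
    {γ : Linfty Ω} (hγ : γ ∈ LinftyPlus Ω) :
    ndMap Ω =ᶠ[𝓝 γ] solOp (energyOp Ω) (meanOp hΩ) (fluxL hΩ) (traceDiamond hΩ hfr) := by
  filter_upwards [(isOpen_LinftyPlus Ω).mem_nhds hγ] with γ' hγ' using ndMap_eq_solOp hΩ hfr hγ'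

end Boundary

/-! ### The complete electrode model as an operator equation -/

section Gram

theorem inner_smul_gram {W L : Type*} [NormedAddCommGroup W] [InnerProductSpace ℝ W]
    [CompleteSpace W] [NormedAddCommGroup L] [InnerProductSpace ℝ L] [CompleteSpace L]
    (D : W →L[ℝ] L) (ζ : ℝ) (p q : W) :
    inner ℝ ((ζ • D.adjoint.comp D) p) q = ζ * inner ℝ (D p) (D q) := by
  rw [_root_.smul_apply, real_inner_smul_left, ContinuousLinearMap.comp_apply,
    ContinuousLinearMap.adjoint_inner_left]

end Gram

section AbstractElectrodes

variable {k : ℕ} {H : Type*} [NormedAddCommGroup H] [InnerProductSpace ℝ H]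
  {L : Fin k → Type*} [∀ j, NormedAddCommGroup (L j)] [∀ j, InnerProductSpace ℝ (L j)]
  {P : Type*} [NormedAddCommGroup P] [NormedSpace ℝ P]

/-- The Hilbert space of pairs `(v, V)` of a potential and electrode voltages. -/
abbrev ElectrodeSpace (H : Type*) (k : ℕ) : Type _ := WithLp 2 (H × RDiamond k)

/-- The voltage drop `t_j (v - V_j o)` at the `j`-th electrode, where `t_j` restricts to the
electrode and `o` is the constant one. -/
def voltageDrop (t : ∀ j, H →L[ℝ] L j) (o : H) (j : Fin k) : ElectrodeSpace H k →L[ℝ] L j :=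
  (t j).comp (WithLp.fstL 2 ℝ H (RDiamond k) -
    (((EuclideanSpace.proj j).comp (RDiamond k).subtypeL).comp
      (WithLp.sndL 2 ℝ H (RDiamond k))).smulRight o)

variable [CompleteSpace H] [∀ j, CompleteSpace (L j)]

/-- The operator of the form `∑_j ζ_j ⟪t_j (v - V_j o), t_j (w - W_j o)⟫`. -/
def electrodeOp (t : ∀ j, H →L[ℝ] L j) (o : H) (ζ : Fin k → ℝ) :
    ElectrodeSpace H k →L[ℝ] ElectrodeSpace H k :=
  ∑ j, ζ j • (voltageDrop t o j).adjoint.comp (voltageDrop t o j)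

/-- An operator on the potentials, as an operator on the pairs `(v, V)`. -/
def liftOp (k : ℕ) (A : P →L[ℝ] H →L[ℝ] H) :
    P →L[ℝ] ElectrodeSpace H k →L[ℝ] ElectrodeSpace H k :=
  (sandwich (WithLp.fstL 2 ℝ H (RDiamond k)) (WithLp.fstL 2 ℝ H (RDiamond k)).adjoint).comp A

theorem inner_liftOp (A : P →L[ℝ] H →L[ℝ] H) (γ : P) (p q : ElectrodeSpace H k) :
    inner ℝ (liftOp k A γ p) q = inner ℝ (A γ p.fst) q.fst := by
  rw [liftOp, ContinuousLinearMap.comp_apply, sandwich_apply, ContinuousLinearMap.comp_apply,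
    ContinuousLinearMap.adjoint_inner_left]
  rfl

theorem inner_electrodeOp (t : ∀ j, H →L[ℝ] L j) (o : H) (ζ : Fin k → ℝ)
    (p q : ElectrodeSpace H k) : inner ℝ (electrodeOp t o ζ p) q
      = ∑ j, ζ j * inner ℝ (voltageDrop t o j p) (voltageDrop t o j q) := by
  rw [electrodeOp, _root_.sum_apply, sum_inner]
  exact Finset.sum_congr rfl fun j _ => inner_smul_gram _ _ _ _

theorem inner_electrodeOp_add (t : ∀ j, H →L[ℝ] L j) (o : H) (ζ : Fin k → ℝ)
    (A : P →L[ℝ] H →L[ℝ] H) (γ : P) (p q : ElectrodeSpace H k) :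
    inner ℝ ((electrodeOp t o ζ + liftOp k A γ) p) q = inner ℝ (A γ p.fst) q.fst +
      ∑ j, ζ j * inner ℝ (t j (p.fst - p.snd.1 j • o)) (t j (q.fst - q.snd.1 j • o)) := by
  rw [_root_.add_apply, inner_add_left, inner_electrodeOp, inner_liftOp, add_comm]
  rfl

/-- The net currents `I` as a functional on the pairs `(w, W)`, represented by a vector. -/
def currentL (H : Type*) [NormedAddCommGroup H] [InnerProductSpace ℝ H] [CompleteSpace H] (k : ℕ) :
    RDiamond k →L[ℝ] ElectrodeSpace H k :=
  (WithLp.sndL 2 ℝ H (RDiamond k)).adjoint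

theorem inner_currentL (I : RDiamond k) (q : ElectrodeSpace H k) :
    inner ℝ (currentL H k I) q = ∑ j, I.1 j * q.snd.1 j := by
  rw [currentL, ContinuousLinearMap.adjoint_inner_left]
  change inner ℝ I.1 q.snd.1 = _
  rw [PiLp.inner_apply]
  exact Finset.sum_congr rfl fun j _ => mul_comm _ _

theorem norm_le_sum_abs (V : RDiamond k) : ‖V‖ ≤ ∑ j, |V.1 j| := by
  rw [← Submodule.norm_coe, EuclideanSpace.norm_eq]
  refine Real.sqrt_le_iff.2 ⟨by positivity, ?_⟩
  simp_rw [Real.norm_eq_abs]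
  exact Finset.sum_sq_le_sq_sum_of_nonneg fun j _ => abs_nonneg _

/-- The differences of the mean `ℓ v` and the voltages are controlled by the energy, since each
electrode sees the constants; the voltages sum to zero, hence the mean is controlled too. -/
theorem isUnit_electrodeOp_add (hk : 1 ≤ k) {t : ∀ j, H →L[ℝ] L j} {o : H} {ζ : Fin k → ℝ}
    (hζ : ∀ j, 0 < ζ j) (ht : ∀ j, t j o ≠ 0) {A : P →L[ℝ] H →L[ℝ] H} {γ : P} {g ℓ : H → ℝ}
    (hP : ∃ K : ℝ, 0 ≤ K ∧ ∀ u, ‖u - ℓ u • o‖ ≤ K * g u)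
    (hE : ∃ c : ℝ, 0 < c ∧ ∀ u, c * g u ^ 2 ≤ inner ℝ (A γ u) u) :
    IsUnit (electrodeOp t o ζ + liftOp k A γ) := by
  obtain ⟨K, hK, hP⟩ := hP
  obtain ⟨c, hc, hE⟩ := hE
  -- `q p` is the energy norm of `p = (v, V)`; multiples of it bound all the quantities
  -- below.
  set q : ElectrodeSpace H k → ℝ :=
    fun p => √(inner ℝ ((electrodeOp t o ζ + liftOp k A γ) p) p) with hq
  have hA : ∀ u, 0 ≤ inner ℝ (A γ u) u := fun u => le_trans (by positivity) (hE u)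
  have hD : ∀ (p : ElectrodeSpace H k) j, 0 ≤
      ζ j * inner ℝ (t j (p.fst - p.snd.1 j • o)) (t j (p.fst - p.snd.1 j • o)) :=
    fun p j => mul_nonneg (hζ j).le real_inner_self_nonneg
  have hin := fun p : ElectrodeSpace H k => inner_electrodeOp_add t o ζ A γ p p
  have hS : ∀ p : ElectrodeSpace H k, 0 ≤ ∑ j, ζ j *
      inner ℝ (t j (p.fst - p.snd.1 j • o)) (t j (p.fst - p.snd.1 j • o)) :=
    fun p => Finset.sum_nonneg fun j _ => hD p j
  have hQ : ∀ p, 0 ≤ inner ℝ ((electrodeOp t o ζ + liftOp k A γ) p) p := fun p => by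
    rw [hin]
    exact add_nonneg (hA _) (hS p)
  have hgq : ∀ p : ElectrodeSpace H k, g p.fst ≤ (√c)⁻¹ * q p := fun p => by
    rw [hq, inv_mul_eq_div, ← Real.sqrt_div' _ hc.le]
    refine Real.le_sqrt_of_sq_le ?_
    rw [le_div_iff₀ hc, hin]
    linarith [hE p.fst, hS p]
  have hDq : ∀ (p : ElectrodeSpace H k) j,
      ‖t j (p.fst - p.snd.1 j • o)‖ ≤ (√(ζ j))⁻¹ * q p := fun p j => by
    rw [hq, inv_mul_eq_div, ← Real.sqrt_div' _ (hζ j).le]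
    refine Real.le_sqrt_of_sq_le ?_
    rw [le_div_iff₀ (hζ j), hin, ← real_inner_self_eq_norm_sq, mul_comm]
    have h1 := Finset.single_le_sum (fun i _ => hD p i) (Finset.mem_univ j)
    linarith [hA p.fst]
  have hPq : ∀ p : ElectrodeSpace H k, ‖p.fst - ℓ p.fst • o‖ ≤ K * ((√c)⁻¹ * q p) := fun p =>
    (hP _).trans (mul_le_mul_of_nonneg_left (hgq p) hK)
  have hVj : ∀ j, ∃ C : ℝ, ∀ p : ElectrodeSpace H k, |ℓ p.fst - p.snd.1 j| ≤ C * q p := fun j => by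
    have ho : 0 < ‖t j o‖ := norm_pos_iff.2 (ht j)
    refine ⟨‖t j o‖⁻¹ * ((√(ζ j))⁻¹ + ‖t j‖ * (K * (√c)⁻¹)), fun p => ?_⟩
    have h1 : (ℓ p.fst - p.snd.1 j) • t j o
        = t j (p.fst - p.snd.1 j • o) - t j (p.fst - ℓ p.fst • o) := by
      rw [← map_sub, ← map_smul]
      congr 1
      module
    have h2 := norm_sub_le (t j (p.fst - p.snd.1 j • o)) (t j (p.fst - ℓ p.fst • o))
    rw [← h1, norm_smul, Real.norm_eq_abs] at h2
    have h3 := (t j).le_opNorm_of_le (hPq p)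
    rw [mul_assoc, inv_mul_eq_div, le_div_iff₀ ho]
    linarith [hDq p j]
  choose C hC using hVj
  -- `∑ V_j = 0`, so the mean is the average of the differences `ℓ v - V_j`.
  have hm : ∀ p : ElectrodeSpace H k, |ℓ p.fst| ≤ (∑ j, C j) * q p := fun p => by
    have h1 : ∑ j, (ℓ p.fst - p.snd.1 j) = k * ℓ p.fst := by
      have h2 : ∑ j, p.snd.1 j = 0 := p.snd.2
      rw [Finset.sum_sub_distrib, h2, sub_zero, Finset.sum_const, Finset.card_univ,
        Fintype.card_fin, nsmul_eq_mul]
    have h2 : |(k : ℝ) * ℓ p.fst| ≤ (∑ j, C j) * q p := by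
      rw [← h1, Finset.sum_mul]
      exact (Finset.abs_sum_le_sum_abs _ _).trans (Finset.sum_le_sum fun j _ => hC j p)
    rw [abs_mul, Nat.abs_cast] at h2
    refine le_trans ?_ h2
    have h3 : (1 : ℝ) ≤ k := by exact_mod_cast hk
    nlinarith [abs_nonneg (ℓ p.fst)]
  set C' : ℝ := K * (√c)⁻¹ + (∑ j, C j) * ‖o‖ + ∑ j, (C j + ∑ i, C i) with hC'
  have hp : ∀ p : ElectrodeSpace H k, ‖p‖ ≤ C' * q p := fun p => by
    have h1 : ‖p‖ ≤ ‖p.fst‖ + ‖p.snd‖ := by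
      rw [WithLp.prod_norm_eq_of_L2]
      refine Real.sqrt_le_iff.2 ⟨by positivity, ?_⟩
      nlinarith [norm_nonneg p.fst, norm_nonneg p.snd]
    have h2 : ‖p.fst‖ ≤ K * ((√c)⁻¹ * q p) + (∑ j, C j) * q p * ‖o‖ := by
      have h3 := norm_add_le (p.fst - ℓ p.fst • o) (ℓ p.fst • o)
      rw [sub_add_cancel, norm_smul, Real.norm_eq_abs] at h3
      have h4 := mul_le_mul_of_nonneg_right (hm p) (norm_nonneg o)
      linarith [hPq p]
    have h3 : ‖p.snd‖ ≤ ∑ j, (C j + ∑ i, C i) * q p := by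
      refine (norm_le_sum_abs _).trans (Finset.sum_le_sum fun j _ => ?_)
      have h4 := hC j p
      have h5 := hm p
      rw [abs_le] at h4 h5 ⊢
      constructor <;> linarith
    rw [← Finset.sum_mul] at h3
    rw [hC']
    linarith
  refine isUnit_of_coercive (C := C' ^ 2) fun p => ?_
  rw [← Real.sq_sqrt (hQ p), ← mul_pow]
  exact pow_le_pow_left₀ (norm_nonneg p) (hp p) 2

end AbstractElectrodes

section Electrodes

variable {n k : ℕ} {Ω : Set (Space n)} {E : Fin k → Set (Space n)} {z : Fin k → ℝ}

theorem IsElectrodes.measurableSet (hE : IsElectrodes Ω E) (j : Fin k) : MeasurableSet (E j) := by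
  obtain ⟨U, hU, h⟩ := hE.relOpen j
  rw [h]
  exact hU.measurableSet.inter isClosed_frontier.measurableSet

theorem IsElectrodes.surf_ne_zero (hΩ : IsBoundedLipschitzDomain Ω) (hE : IsElectrodes Ω E)
    (j : Fin k) : surf Ω (E j) ≠ 0 := by
  obtain ⟨U, hU, h⟩ := hE.relOpen j
  obtain ⟨x, hx⟩ := (hE.connected j).nonempty
  rw [h] at hx
  have h1 := hΩ.surf_pos hx.2 hU hx.1
  have h2 : surf Ω (E j) = surf Ω U := by
    rw [surf, Measure.restrict_apply (hE.measurableSet j), Measure.restrict_apply hU.measurableSet,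
      h, Set.inter_assoc, Set.inter_self]
  rw [h2]
  exact h1.ne'

/-- The trace on the `j`-th electrode. -/
def electrodeTrace (hΩ : IsBoundedLipschitzDomain Ω) (E : Fin k → Set (Space n)) (j : Fin k) :
    H1 Ω →L[ℝ] Lp ℝ 2 ((surf Ω).restrict (E j)) :=
  (LpToLpRestrictCLM (Space n) ℝ ℝ (surf Ω) 2 (E j)).comp (traceL hΩ)

theorem coeFn_electrodeTrace_sub (hΩ : IsBoundedLipschitzDomain Ω) (j : Fin k) (v : H1 Ω) (c : ℝ) :
    electrodeTrace hΩ E j (v - c • oneH1 hΩ)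
      =ᵐ[(surf Ω).restrict (E j)] fun x => trace v x - c := by
  have h1 : electrodeTrace hΩ E j (v - c • oneH1 hΩ) = LpToLpRestrictCLM (Space n) ℝ ℝ (surf Ω) 2
      (E j) (traceL hΩ v - c • traceL hΩ (oneH1 hΩ)) := by
    rw [← map_smul, ← map_sub]
    rfl
  rw [h1, trace_eq_traceL hΩ]
  filter_upwards [LpToLpRestrictCLM_coeFn ℝ (E j) (traceL hΩ v - c • traceL hΩ (oneH1 hΩ)),
    ae_restrict_of_ae (Lp.coeFn_sub (traceL hΩ v) (c • traceL hΩ (oneH1 hΩ))),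
    ae_restrict_of_ae (Lp.coeFn_smul c (traceL hΩ (oneH1 hΩ))),
    ae_restrict_of_ae (coeFn_trace_oneH1 hΩ)] with x h2 h3 h4 h5
  rw [h2, h3, Pi.sub_apply, h4, Pi.smul_apply, h5, smul_eq_mul, mul_one]

theorem electrodeTrace_oneH1_ne_zero (hΩ : IsBoundedLipschitzDomain Ω) (hE : IsElectrodes Ω E)
    (j : Fin k) : electrodeTrace hΩ E j (oneH1 hΩ) ≠ 0 := by
  intro h
  refine hE.surf_ne_zero hΩ j ?_
  have h1 : ∀ᵐ x ∂((surf Ω).restrict (E j)), False := by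
    have h2 := LpToLpRestrictCLM_coeFn ℝ (E j) (traceL hΩ (oneH1 hΩ))
    have h3 : LpToLpRestrictCLM (Space n) ℝ ℝ (surf Ω) 2 (E j) (traceL hΩ (oneH1 hΩ)) = 0 := h
    rw [h3] at h2
    filter_upwards [h2, ae_restrict_of_ae (coeFn_trace_oneH1 hΩ),
      Lp.coeFn_zero ℝ 2 ((surf Ω).restrict (E j))] with x h4 h5 h6
    rw [h5, h6, Pi.zero_apply] at h4
    exact zero_ne_one h4
  rwa [ae_iff, not_false_eq_true, Set.ofPred_true, Measure.restrict_apply_univ] at h1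

theorem inner_electrodeTrace (hΩ : IsBoundedLipschitzDomain Ω) (j : Fin k) (v w : H1 Ω) (a b : ℝ) :
    inner ℝ (electrodeTrace hΩ E j (v - a • oneH1 hΩ)) (electrodeTrace hΩ E j (w - b • oneH1 hΩ))
      = ∫ x in E j, (trace v x - a) * (trace w x - b) ∂(surf Ω) := by
  rw [L2.inner_def]
  refine integral_congr_ae ?_
  filter_upwards [coeFn_electrodeTrace_sub hΩ j v a, coeFn_electrodeTrace_sub hΩ j w b] with x h1 h2
  rw [h1, h2]
  exact mul_comm _ _

/-- The operator of the boundary form of the complete electrode model. -/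
def contactOp (hΩ : IsBoundedLipschitzDomain Ω) (E : Fin k → Set (Space n)) (z : Fin k → ℝ) :
    ElectrodeSpace (H1 Ω) k →L[ℝ] ElectrodeSpace (H1 Ω) k :=
  electrodeOp (electrodeTrace hΩ E) (oneH1 hΩ) fun j => 1 / z j

theorem inner_contactOp_add (hΩ : IsBoundedLipschitzDomain Ω) (γ : Linfty Ω)
    (p q : ElectrodeSpace (H1 Ω) k) :
    inner ℝ ((contactOp hΩ E z + liftOp k (energyOp Ω) γ) p) q = energy γ p.fst q.fst +
      ∑ j, ∫ x in E j, 1 / z j *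
        ((trace p.fst x - p.snd.1 j) * (trace q.fst x - q.snd.1 j)) ∂(surf Ω) := by
  refine (inner_electrodeOp_add (electrodeTrace hΩ E) (oneH1 hΩ) (fun j => 1 / z j) (energyOp Ω) γ
    p q).trans ?_
  rw [inner_energyOp]
  congr 1
  refine Finset.sum_congr rfl fun j _ => ?_
  rw [inner_electrodeTrace, integral_const_mul]

/-- A pair satisfies the weak form of the electrode problem with right-hand side `r` if and only if
it solves the operator equation. -/
theorem contactOp_add_eq_iff (hΩ : IsBoundedLipschitzDomain Ω) (γ : Linfty Ω) (v : H1 Ω)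
    (V : RDiamond k) (r : ElectrodeSpace (H1 Ω) k) :
    (contactOp hΩ E z + liftOp k (energyOp Ω) γ) (WithLp.toLp 2 (v, V)) = r ↔
      ∀ (w : H1 Ω) (W : RDiamond k), energy γ v w +
        ∑ j, ∫ x in E j, 1 / z j * ((trace v x - V.1 j) * (trace w x - W.1 j)) ∂(surf Ω)
          = inner ℝ r (WithLp.toLp 2 (w, W)) := by
  constructor
  · rintro rfl w W
    rw [inner_contactOp_add]
    rfl
  · intro h
    refine ext_inner_right ℝ fun q => ?_
    rw [inner_contactOp_add]
    exact h q.fst q.snd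

theorem isCEMSolution_iff (hΩ : IsBoundedLipschitzDomain Ω) (γ : Linfty Ω) (I : RDiamond k)
    (v : H1 Ω) (V : RDiamond k) :
    IsCEMSolution E z γ I v V ↔ (contactOp hΩ E z + liftOp k (energyOp Ω) γ)
      (WithLp.toLp 2 (v, V)) = currentL (H1 Ω) k I := by
  rw [contactOp_add_eq_iff]
  simp_rw [inner_currentL]
  rfl

theorem isUnit_contactOp_add (hΩ : IsBoundedLipschitzDomain Ω) (hfr : (frontier Ω).Nonempty)
    (hk : 1 ≤ k) (hE : IsElectrodes Ω E) (hz : ∀ j, 0 < z j) {γ : Linfty Ω}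
    (hγ : γ ∈ LinftyPlus Ω) : IsUnit (contactOp hΩ E z + liftOp k (energyOp Ω) γ) := by
  have h := exists_energy_ge hγ
  simp_rw [← inner_energyOp] at h
  exact isUnit_electrodeOp_add hk (fun j => one_div_pos.2 (hz j))
    (electrodeTrace_oneH1_ne_zero hΩ hE) (exists_norm_sub_bdryMean_le hΩ hfr) h

theorem existsUnique_pair_of_isUnit {M : ElectrodeSpace (H1 Ω) k →L[ℝ] ElectrodeSpace (H1 Ω) k}
    (hM : IsUnit M) (r : ElectrodeSpace (H1 Ω) k) :
    ∃! p : H1 Ω × RDiamond k, M (WithLp.toLp 2 (p.1, p.2)) = r := by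
  refine ⟨(Ring.inverse M r).ofLp, (inverse_apply_eq_iff hM _ _).1 rfl, fun p hp => ?_⟩
  exact congrArg WithLp.ofLp ((inverse_apply_eq_iff hM _ _).2 hp).symm

theorem existsUnique_isCEMSolution (hΩ : IsBoundedLipschitzDomain Ω) (hfr : (frontier Ω).Nonempty)
    (hk : 1 ≤ k) (hE : IsElectrodes Ω E) (hz : ∀ j, 0 < z j) {γ : Linfty Ω}
    (hγ : γ ∈ LinftyPlus Ω) (I : RDiamond k) :
    ∃! p : H1 Ω × RDiamond k, IsCEMSolution E z γ I p.1 p.2 := by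
  simp_rw [isCEMSolution_iff hΩ]
  exact existsUnique_pair_of_isUnit (isUnit_contactOp_add hΩ hfr hk hE hz hγ) _

theorem isCEMMap_solOp (hΩ : IsBoundedLipschitzDomain Ω) (hfr : (frontier Ω).Nonempty)
    (hk : 1 ≤ k) (hE : IsElectrodes Ω E) (hz : ∀ j, 0 < z j) {γ : Linfty Ω}
    (hγ : γ ∈ LinftyPlus Ω) :
    IsCEMMap E z γ (solOp (liftOp k (energyOp Ω)) (contactOp hΩ E z) (currentL (H1 Ω) k)
      (WithLp.sndL 2 ℝ (H1 Ω) (RDiamond k)) γ) := by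
  intro I
  obtain ⟨p, hp, -⟩ := existsUnique_isCEMSolution hΩ hfr hk hE hz hγ I
  refine ⟨p.1, ?_⟩
  have h1 := (inverse_apply_eq_iff (isUnit_contactOp_add hΩ hfr hk hE hz hγ) _ _).2
    ((isCEMSolution_iff hΩ γ I p.1 p.2).1 hp)
  rw [solOp, ContinuousLinearMap.comp_apply, ContinuousLinearMap.comp_apply, h1]
  exact hp

theorem isCEMMap_cemMap (hΩ : IsBoundedLipschitzDomain Ω) (hfr : (frontier Ω).Nonempty)
    (hk : 1 ≤ k) (hE : IsElectrodes Ω E) (hz : ∀ j, 0 < z j) {γ : Linfty Ω}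
    (hγ : γ ∈ LinftyPlus Ω) : IsCEMMap E z γ (cemMap Ω E z γ) := by
  have h : ∃ T, IsCEMMap E z γ T := ⟨_, isCEMMap_solOp hΩ hfr hk hE hz hγ⟩
  rw [cemMap, dif_pos h]
  exact h.choose_spec

theorem isCEMMap_unique (hΩ : IsBoundedLipschitzDomain Ω) (hfr : (frontier Ω).Nonempty)
    (hk : 1 ≤ k) (hE : IsElectrodes Ω E) (hz : ∀ j, 0 < z j) {γ : Linfty Ω}
    (hγ : γ ∈ LinftyPlus Ω) {T T' : RDiamond k →L[ℝ] RDiamond k} (h : IsCEMMap E z γ T)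
    (h' : IsCEMMap E z γ T') : T = T' := by
  ext1 I
  obtain ⟨v, hv⟩ := h I
  obtain ⟨v', hv'⟩ := h' I
  exact congrArg Prod.snd ((existsUnique_isCEMSolution hΩ hfr hk hE hz hγ I).unique
    (y₁ := (v, T I)) (y₂ := (v', T' I)) hv hv')

theorem cemMap_eventuallyEq (hΩ : IsBoundedLipschitzDomain Ω) (hfr : (frontier Ω).Nonempty)
    (hk : 1 ≤ k) (hE : IsElectrodes Ω E) (hz : ∀ j, 0 < z j) {γ : Linfty Ω}
    (hγ : γ ∈ LinftyPlus Ω) :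
    cemMap Ω E z =ᶠ[𝓝 γ] solOp (liftOp k (energyOp Ω)) (contactOp hΩ E z) (currentL (H1 Ω) k)
      (WithLp.sndL 2 ℝ (H1 Ω) (RDiamond k)) := by
  filter_upwards [(isOpen_LinftyPlus Ω).mem_nhds hγ] with γ' hγ' using isCEMMap_unique hΩ hfr hk hE
    hz hγ' (isCEMMap_cemMap hΩ hfr hk hE hz hγ') (isCEMMap_solOp hΩ hfr hk hE hz hγ')

end Electrodes

/-! ### Weak form of the sensitivity problems -/

section Cutoff

open scoped Manifold in
/-- Smooth cutoff functions; `tsupport χ ⊆ U` is expressed as vanishing near the points off `U`. -/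
theorem exists_cutoff {n : ℕ} {K U : Set (Space n)} (hK : IsClosed K) (hU : IsOpen U) (h : K ⊆ U) :
    ∃ χ : smoothFn n, (∀ x ∈ K, χ.1 =ᶠ[𝓝 x] 1) ∧ ∀ x ∉ U, χ.1 =ᶠ[𝓝 x] 0 := by
  obtain ⟨f, h0, h1, -⟩ := exists_contMDiffMap_zero_one_nhds_of_isClosed (n := (⊤ : ℕ∞))
    𝓘(ℝ, Space n) hU.isClosed_compl hK (Set.disjoint_compl_left_iff_subset.2 h)
  exact ⟨⟨f, contMDiff_iff_contDiff.1 f.contMDiff⟩,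
    fun x hx => eventually_nhdsSet_iff_forall.1 h1 x hx, fun x hx => eventually_nhdsSet_iff_forall.1 h0 x hx⟩

theorem gradient_eq_zero_of_notMem_tsupport {n : ℕ} {f : Space n → ℝ} {x : Space n}
    (h : x ∉ tsupport f) : gradient f x = 0 := by
  rw [(notMem_tsupport_iff_eventuallyEq.1 h).gradient_eq]
  exact gradient_const x 0

variable {n : ℕ} {Ω K U : Set (Space n)}

theorem IsBoundedLipschitzDomain.notMem_of_mem_frontier (hΩ : IsBoundedLipschitzDomain Ω)
    {x : Space n} (hx : x ∈ frontier Ω) : x ∉ Ω :=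
  fun h => hx.2 (by rwa [hΩ.isOpen.interior_eq])

/-- On `Ω`, a smooth function is the sum of a test function and of a smooth function supported
near `∂Ω`, away from a given compact set. -/
theorem exists_smooth_split (hΩ : IsBoundedLipschitzDomain Ω) (hK : IsClosed K) (hKΩ : K ⊆ Ω)
    (hU : IsOpen U) (hfU : frontier Ω ⊆ U) (f : smoothFn n) :
    ∃ a b : smoothFn n, IsTestFunction Ω a.1 ∧ tsupport b.1 ⊆ U ∧ tsupport b.1 ⊆ Kᶜ ∧
      Set.EqOn (a + b).1 f.1 Ω := by
  have h1 : closure Ω \ U ∪ K ⊆ Ω := by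
    refine Set.union_subset (fun x hx => ?_) hKΩ
    by_contra h
    exact hx.2 (hfU ⟨hx.1, by rwa [hΩ.isOpen.interior_eq]⟩)
  have hcl : closure Ω ⊆ Ω ∪ U := fun x hx => by
    by_cases h : x ∈ Ω
    · exact Or.inl h
    · exact Or.inr (hfU ⟨hx, by rwa [hΩ.isOpen.interior_eq]⟩)
  -- `χ = 1` near the part of `closure Ω` where `b` must vanish; `θ` cuts off outside `Ω ∪ U`.
  obtain ⟨χ, hχ1, hχ0⟩ := exists_cutoff ((isClosed_closure.sdiff hU).union hK) hΩ.isOpen h1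
  obtain ⟨θ, hθ1, hθ0⟩ := exists_cutoff isClosed_closure (hΩ.isOpen.union hU) hcl
  have hb : ∀ x, x ∉ U ∨ x ∈ K → (fun y => (θ.1 y - χ.1 y) * f.1 y) =ᶠ[𝓝 x] 0 := by
    intro x hx
    have h2 : θ.1 =ᶠ[𝓝 x] χ.1 := by
      by_cases hxc : x ∈ closure Ω
      · have hx' : x ∈ closure Ω \ U ∪ K := hx.imp (fun h => ⟨hxc, h⟩) id
        exact (hθ1 x hxc).trans (hχ1 x hx').symm
      · have hxΩ : x ∉ Ω := fun h => hxc (subset_closure h)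
        have hxU : x ∉ U := hx.resolve_right fun h => hxΩ (hKΩ h)
        exact (hθ0 x (not_or.2 ⟨hxΩ, hxU⟩)).trans (hχ0 x hxΩ).symm
    filter_upwards [h2] with y hy
    rw [hy, sub_self, zero_mul, Pi.zero_apply]
  have ha : tsupport (fun y => χ.1 y * f.1 y) ⊆ Ω := by
    intro x hx
    by_contra h
    refine notMem_tsupport_iff_eventuallyEq.2 ?_ hx
    filter_upwards [hχ0 x h] with y hy
    rw [hy, Pi.zero_apply, zero_mul]
  have hac : ContDiff ℝ (⊤ : ℕ∞) (fun y => χ.1 y * f.1 y) :=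
    (contDiff_smoothFn χ).mul (contDiff_smoothFn f)
  refine ⟨⟨_, hac⟩, ⟨fun y => (θ.1 y - χ.1 y) * f.1 y, ((contDiff_smoothFn θ).sub
    (contDiff_smoothFn χ)).mul (contDiff_smoothFn f)⟩, ⟨hac, ?_, ha⟩, ?_, ?_, ?_⟩
  · exact HasCompactSupport.of_support_subset_isCompact hΩ.isBounded.isCompact_closure
      ((subset_tsupport _).trans (ha.trans subset_closure))
  · intro x hx
    by_contra h
    exact notMem_tsupport_iff_eventuallyEq.2 (hb x (Or.inl h)) hx
  · intro x hx h
    exact notMem_tsupport_iff_eventuallyEq.2 (hb x (Or.inr h)) hx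
  · intro x hx
    change χ.1 x * f.1 x + (θ.1 x - χ.1 x) * f.1 x = f.1 x
    rw [← add_mul, add_sub_cancel, (hθ1 x (subset_closure hx)).self_of_nhds, Pi.one_apply, one_mul]

theorem smoothToH1_congr (hΩ : IsBoundedLipschitzDomain Ω) {f g : smoothFn n}
    (h : Set.EqOn f.1 g.1 Ω) : smoothToH1 hΩ f = smoothToH1 hΩ g := by
  have h1 : fn (smoothToH1 hΩ f) = fn (smoothToH1 hΩ g) := by
    refine Lp.ext ?_
    filter_upwards [fn_smoothToH1 hΩ f, fn_smoothToH1 hΩ g, ae_restrict_mem hΩ.isOpen.measurableSet]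
      with x hf hg hx
    rw [hf, hg, h hx]
  have h2 : wgrad (smoothToH1 hΩ f) = wgrad (smoothToH1 hΩ g) := by
    refine Lp.ext ?_
    filter_upwards [wgrad_smoothToH1 hΩ f, wgrad_smoothToH1 hΩ g,
      ae_restrict_mem hΩ.isOpen.measurableSet] with x hf hg hx
    rw [hf, hg]
    exact (h.eventuallyEq_of_mem (hΩ.isOpen.mem_nhds hx)).gradient_eq
  exact Subtype.ext (congrArg (WithLp.toLp 2) (Prod.ext h1 h2))

end Cutoff

section Residual

theorem inner_add_sub_adjoint {H F : Type*} [NormedAddCommGroup H] [InnerProductSpace ℝ H]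
    [CompleteSpace H] [NormedAddCommGroup F] [InnerProductSpace ℝ F] [CompleteSpace F]
    (T : H →L[ℝ] F) (a b w : H) (g : F) :
    inner ℝ (a + b - T.adjoint g) w = inner ℝ a w + inner ℝ b w - inner ℝ g (T w) := by
  rw [inner_sub_left, inner_add_left, ContinuousLinearMap.adjoint_inner_left]

theorem inner_eq_zero_of_denseRange {H ι : Type*} [NormedAddCommGroup H] [InnerProductSpace ℝ H]
    {J : ι → H} (hJ : DenseRange J) {r : H} (h : ∀ i, inner ℝ r (J i) = 0) (w : H) :
    inner ℝ r w = 0 :=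
  hJ.induction_on w (isClosed_eq (continuous_const.inner continuous_id) continuous_const) h

variable {n : ℕ} {Ω : Set (Space n)}

/-- The Riesz representative of `w ↦ ∫ γ ∇u'·∇w + ∫ η ∇u·∇w - ∫_{∂Ω} g w dS`. -/
def residual (hΩ : IsBoundedLipschitzDomain Ω) (γ η : Linfty Ω) (u u' : H1 Ω)
    (g : Lp ℝ 2 (surf Ω)) : H1 Ω :=
  energyOp Ω γ u' + energyOp Ω η u - (traceL hΩ).adjoint g

theorem inner_residual (hΩ : IsBoundedLipschitzDomain Ω) (γ η : Linfty Ω) (u u' : H1 Ω)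
    (g : Lp ℝ 2 (surf Ω)) (w : H1 Ω) : inner ℝ (residual hΩ γ η u u' g) w
      = energy γ u' w + energy η u w - ∫ x, g x * trace w x ∂(surf Ω) := by
  rw [residual, inner_add_sub_adjoint, inner_energyOp, inner_energyOp, inner_traceL_eq_integral]

theorem energy_smoothToH1 (hΩ : IsBoundedLipschitzDomain Ω) (a : Linfty Ω) (u : H1 Ω)
    (f : smoothFn n) : energy a u (smoothToH1 hΩ f)
      = ∫ x, a x * (inner ℝ (wgrad u x) (gradient f.1 x) : ℝ) ∂(vol Ω) := by
  refine integral_congr_ae ?_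
  filter_upwards [wgrad_smoothToH1 hΩ f] with x hx
  rw [hx]

theorem inner_residual_smoothToH1 (hΩ : IsBoundedLipschitzDomain Ω) (γ η : Linfty Ω) (u u' : H1 Ω)
    (g : Lp ℝ 2 (surf Ω)) (f : smoothFn n) :
    inner ℝ (residual hΩ γ η u u' g) (smoothToH1 hΩ f)
      = ∫ x, γ x * (inner ℝ (wgrad u' x) (gradient f.1 x) : ℝ) ∂(vol Ω)
        + ∫ x, η x * (inner ℝ (wgrad u x) (gradient f.1 x) : ℝ) ∂(vol Ω)
        - ∫ x, g x * f.1 x ∂(surf Ω) := by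
  rw [inner_residual, energy_smoothToH1, energy_smoothToH1]
  congr 1
  refine integral_congr_ae ?_
  rw [trace_eq_traceL hΩ, traceL_smoothToH1]
  filter_upwards [coeFn_smoothTrace hΩ f] with x hx
  rw [hx]

theorem integral_surf_eq_zero (hΩ : IsBoundedLipschitzDomain Ω) {f : Space n → ℝ}
    (hf : tsupport f ⊆ Ω) (g : Space n → ℝ) : ∫ x, g x * f x ∂(surf Ω) = 0 := by
  refine integral_eq_zero_of_ae ?_
  filter_upwards [ae_restrict_mem isClosed_frontier.measurableSet] with x hx
  rw [image_eq_zero_of_notMem_tsupport fun h => hΩ.notMem_of_mem_frontier hx (hf h), mul_zero,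
    Pi.zero_apply]

theorem integral_gradient_eq_zero {η : Linfty Ω} {K : Set (Space n)}
    (hη : ∀ᵐ x ∂(vol Ω), x ∉ K → η x = 0) (u : H1 Ω) {f : Space n → ℝ} (hf : tsupport f ⊆ Kᶜ) :
    ∫ x, η x * (inner ℝ (wgrad u x) (gradient f x) : ℝ) ∂(vol Ω) = 0 := by
  refine integral_eq_zero_of_ae ?_
  filter_upwards [hη] with x hx
  by_cases h : x ∈ K
  · rw [gradient_eq_zero_of_notMem_tsupport fun h' => hf h' h, inner_zero_right, mul_zero,
      Pi.zero_apply]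
  · rw [hx h, zero_mul, Pi.zero_apply]

/-- For `η` of compact support, the equation in `Ω` in the sense of distributions together with the
conormal derivative on `∂Ω` is equivalent to the weak form with test functions in `H¹(Ω)`. -/
theorem sensitivityEq_and_hasConormalDerivative_iff (hΩ : IsBoundedLipschitzDomain Ω)
    {γ η : Linfty Ω} (hη : CompactlySupported η) (u u' : H1 Ω) (g : Lp ℝ 2 (surf Ω)) :
    SensitivityEq γ η u u' ∧ HasConormalDerivative γ u' g ↔
      ∀ w : H1 Ω, energy γ u' w = -energy η u w + ∫ x, g x * trace w x ∂(surf Ω) := by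
  obtain ⟨K, hK, hKΩ, hη⟩ := hη
  have hiff : (∀ w : H1 Ω, energy γ u' w = -energy η u w + ∫ x, g x * trace w x ∂(surf Ω)) ↔
      ∀ w : H1 Ω, inner ℝ (residual hΩ γ η u u' g) w = 0 := by
    refine forall_congr' fun w => ?_
    rw [inner_residual]
    constructor <;> intro h <;> linarith
  rw [hiff]
  constructor
  · rintro ⟨h1, U, hU, hfU, h2⟩
    refine inner_eq_zero_of_denseRange (denseRange_smoothToH1 hΩ) fun f => ?_
    obtain ⟨a, b, ha, hbU, hbK, hab⟩ := exists_smooth_split hΩ hK.isClosed hKΩ hU hfU f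
    rw [← smoothToH1_congr hΩ hab, map_add, inner_add_right, inner_residual_smoothToH1,
      inner_residual_smoothToH1, h1 a.1 ha, integral_surf_eq_zero hΩ ha.2.2,
      h2 b.1 (contDiff_smoothFn b) hbU, integral_gradient_eq_zero hη u hbK]
    ring
  · intro h
    constructor
    · intro φ hφ
      have h1 := h (smoothToH1 hΩ ⟨φ, hφ.1⟩)
      rw [inner_residual_smoothToH1, integral_surf_eq_zero hΩ hφ.2.2] at h1
      linarith
    · refine ⟨Kᶜ, hK.isClosed.isOpen_compl, fun x hx hxK => ?_, fun φ hφ hφK => ?_⟩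
      · exact hΩ.notMem_of_mem_frontier hx (hKΩ hxK)
      · have h1 := h (smoothToH1 hΩ ⟨φ, hφ⟩)
        rw [inner_residual_smoothToH1, integral_gradient_eq_zero hη u hφK] at h1
        linarith

end Residual

/-! ### Derivative of the Neumann-to-Dirichlet map -/

section Continuum

variable {n : ℕ} {Ω : Set (Space n)}

theorem inner_neg_energyOp (η : Linfty Ω) (u w : H1 Ω) :
    inner ℝ (-energyOp Ω η u) w = -energy η u w := by
  rw [inner_neg_left, inner_energyOp]

/-- The sensitivity problem is the equation obtained by differentiating the operator equation of the
continuum model in the direction `η`. -/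
theorem isCMSensitivity_iff (hΩ : IsBoundedLipschitzDomain Ω) (hfr : (frontier Ω).Nonempty)
    {γ η : Linfty Ω} (hη : CompactlySupported η) (u u' : H1 Ω) :
    IsCMSensitivity γ η u u' ↔ (meanOp hΩ + energyOp Ω γ) u' = -energyOp Ω η u := by
  have h1 : inner ℝ (-energyOp Ω η u) (oneH1 hΩ) = 0 := by
    rw [inner_neg_energyOp, energy_oneH1, neg_zero]
  have h0 : ∀ w : H1 Ω, ∫ x, (0 : Lp ℝ 2 (surf Ω)) x * trace w x ∂(surf Ω) = 0 := fun w => by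
    refine integral_eq_zero_of_ae ?_
    filter_upwards [Lp.coeFn_zero ℝ 2 (surf Ω)] with x hx
    rw [hx, Pi.zero_apply, zero_mul]
  rw [meanOp_add_eq_iff hΩ hfr γ h1, IsCMSensitivity,
    sensitivityEq_and_hasConormalDerivative_iff hΩ hη]
  simp_rw [h0, add_zero, inner_neg_energyOp]

theorem existsUnique_isCMSensitivity (hΩ : IsBoundedLipschitzDomain Ω)
    (hfr : (frontier Ω).Nonempty) {γ η : Linfty Ω} (hγ : γ ∈ LinftyPlus Ω)
    (hη : CompactlySupported η) (u : H1 Ω) : ∃! u' : H1 Ω, IsCMSensitivity γ η u u' := by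
  simp_rw [isCMSensitivity_iff hΩ hfr hη,
    ← inverse_apply_eq_iff (isUnit_meanOp_add hΩ hfr hγ)]
  exact ⟨_, rfl, fun _ h => h.symm⟩

theorem analyticAt_ndMap (hΩ : IsBoundedLipschitzDomain Ω) (hfr : (frontier Ω).Nonempty)
    {γ : Linfty Ω} (hγ : γ ∈ LinftyPlus Ω) : AnalyticAt ℝ (ndMap Ω) γ :=
  (analyticAt_solOp (isUnit_meanOp_add hΩ hfr hγ)).congr (ndMap_eventuallyEq hΩ hfr hγ).symm

theorem fderiv_ndMap_apply (hΩ : IsBoundedLipschitzDomain Ω) (hfr : (frontier Ω).Nonempty)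
    {γ η : Linfty Ω} (hγ : γ ∈ LinftyPlus Ω) (hη : CompactlySupported η) {f : L2Diamond Ω}
    {u u' : H1 Ω} (hu : IsCMSolution γ f u) (hu' : IsCMSensitivity γ η u u') :
    ((fderiv ℝ (ndMap Ω) γ η f : L2Diamond Ω) : Lp ℝ 2 (surf Ω)) = trace u' := by
  rw [(ndMap_eventuallyEq hΩ hfr hγ).fderiv_eq,
    fderiv_solOp_apply (isUnit_meanOp_add hΩ hfr hγ) ((isCMSolution_iff hΩ hfr γ f u).1 hu)
      ((isCMSensitivity_iff hΩ hfr hη u u').1 hu'), coe_traceDiamond hΩ hfr hu'.1]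

end Continuum

/-! ### Derivative of the complete electrode model map -/

section Electrodes

variable {n k : ℕ} {Ω : Set (Space n)} {E : Fin k → Set (Space n)} {z : Fin k → ℝ}

theorem inner_neg_liftOp {H P : Type*} [NormedAddCommGroup H] [InnerProductSpace ℝ H]
    [CompleteSpace H] [NormedAddCommGroup P] [NormedSpace ℝ P] (A : P →L[ℝ] H →L[ℝ] H) (η : P)
    (p q : ElectrodeSpace H k) :
    inner ℝ (-liftOp k A η p) q = -inner ℝ (A η p.fst) q.fst := by
  rw [inner_neg_left, inner_liftOp]

theorem integral_eq_sum_electrodes (hE : IsElectrodes Ω E) {f : Space n → ℝ}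
    (hf : Integrable f (surf Ω)) (h0 : ∀ᵐ x ∂(surf Ω), x ∉ ⋃ j, E j → f x = 0) :
    ∫ x, f x ∂(surf Ω) = ∑ j, ∫ x in E j, f x ∂(surf Ω) := by
  rw [← setIntegral_eq_integral_of_ae_compl_eq_zero h0,
    integral_iUnion_fintype hE.measurableSet (fun i j h => hE.disjoint i j h)
      fun j => hf.integrableOn]

/-- The boundary form of the electrode model, in terms of the current density `g`. -/
theorem sum_integral_contact (hΩ : IsBoundedLipschitzDomain Ω) (hE : IsElectrodes Ω E)
    (hz : ∀ j, 0 < z j) {v : H1 Ω} {V : RDiamond k} {g : Lp ℝ 2 (surf Ω)}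
    (hg0 : ∀ᵐ x ∂(surf Ω), x ∉ ⋃ j, E j → g x = 0)
    (hg : ∀ j, ∀ᵐ x ∂(surf Ω), x ∈ E j → trace v x + z j * g x = V.1 j) (w : H1 Ω)
    (W : RDiamond k) :
    ∑ j, ∫ x in E j, 1 / z j * ((trace v x - V.1 j) * (trace w x - W.1 j)) ∂(surf Ω)
      = -∫ x, g x * trace w x ∂(surf Ω) + ∑ j, W.1 j * ∫ x in E j, g x ∂(surf Ω) := by
  have := hΩ.isFiniteMeasure_surf
  have hi : Integrable g (surf Ω) := (Lp.memLp g).integrable one_le_two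
  have hiw : Integrable (fun x => g x * trace w x) (surf Ω) :=
    (Lp.memLp g).integrable_mul (Lp.memLp (trace w))
  rw [integral_eq_sum_electrodes hE hiw (by
    filter_upwards [hg0] with x hx h
    rw [hx h, zero_mul]), ← Finset.sum_neg_distrib, ← Finset.sum_add_distrib]
  refine Finset.sum_congr rfl fun j _ => ?_
  have h1 : ∫ x in E j, 1 / z j * ((trace v x - V.1 j) * (trace w x - W.1 j)) ∂(surf Ω)
      = ∫ x in E j, (-(g x * trace w x) + W.1 j * g x) ∂(surf Ω) := by
    refine integral_congr_ae ?_
    filter_upwards [ae_restrict_of_ae (hg j), ae_restrict_mem (hE.measurableSet j)] with x h2 h3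
    have h4 : trace v x - V.1 j = -(z j * g x) := by linarith [h2 h3]
    have h5 := (hz j).ne'
    rw [h4]
    field_simp
    ring
  rw [h1, integral_add (f := fun x => -(g x * trace w x)) hiw.integrableOn.neg
    (hi.integrableOn.const_mul _), integral_neg, integral_const_mul]

/-- The current density determined by the Robin condition on the electrodes. -/
theorem exists_currentDensity (hΩ : IsBoundedLipschitzDomain Ω) (hE : IsElectrodes Ω E)
    (hz : ∀ j, 0 < z j) (v : H1 Ω) (V : RDiamond k) : ∃ g : Lp ℝ 2 (surf Ω),
      (∀ᵐ x ∂(surf Ω), x ∉ ⋃ j, E j → g x = 0) ∧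
      ∀ j, ∀ᵐ x ∂(surf Ω), x ∈ E j → trace v x + z j * g x = V.1 j := by
  have := hΩ.isFiniteMeasure_surf
  set G : Space n → ℝ := fun x => ∑ j, (E j).indicator (fun y => 1 / z j * (V.1 j - trace v y)) x
  have hG : MemLp G 2 (surf Ω) := memLp_finsetSum _ fun j _ =>
    ((((memLp_const (V.1 j)).sub (Lp.memLp (trace v))).const_mul (1 / z j)).indicator
      (hE.measurableSet j))
  refine ⟨hG.toLp G, ?_, fun j => ?_⟩
  · filter_upwards [hG.coeFn_toLp] with x hx h
    rw [hx]
    exact Finset.sum_eq_zero fun j _ =>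
      Set.indicator_of_notMem (fun hj => h (Set.mem_iUnion.2 ⟨j, hj⟩)) _
  · filter_upwards [hG.coeFn_toLp] with x hx h
    have h1 : G x = 1 / z j * (V.1 j - trace v x) := by
      refine (Finset.sum_eq_single j (fun i _ hij => ?_) fun hj => ?_).trans
        (Set.indicator_of_mem h _)
      · exact Set.indicator_of_notMem
          (fun hi => Set.disjoint_left.1 (hE.disjoint i j hij) hi h) _
      · exact absurd (Finset.mem_univ j) hj
    have h2 := (hz j).ne'
    rw [hx, h1]
    field_simp
    ring

/-- The sensitivity problem is the equation obtained by differentiating the operator equation of the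
complete electrode model in the direction `η`. -/
theorem isCEMSensitivity_iff (hΩ : IsBoundedLipschitzDomain Ω) (hE : IsElectrodes Ω E)
    (hz : ∀ j, 0 < z j) {γ η : Linfty Ω} (hη : CompactlySupported η) (v : H1 Ω) (V : RDiamond k)
    (v' : H1 Ω) (V' : RDiamond k) :
    IsCEMSensitivity E z γ η v v' V' ↔ (contactOp hΩ E z + liftOp k (energyOp Ω) γ)
      (WithLp.toLp 2 (v', V')) = -liftOp k (energyOp Ω) η (WithLp.toLp 2 (v, V)) := by
  rw [contactOp_add_eq_iff]
  simp_rw [inner_neg_liftOp, inner_energyOp]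
  change _ ↔ ∀ (w : H1 Ω) (W : RDiamond k), energy γ v' w +
    ∑ j, ∫ x in E j, 1 / z j * ((trace v' x - V'.1 j) * (trace w x - W.1 j)) ∂(surf Ω)
      = -energy η v w
  constructor
  · rintro ⟨h1, g, h2, h3, h4, h5⟩ w W
    have h6 := (sensitivityEq_and_hasConormalDerivative_iff hΩ hη v v' g).1 ⟨h1, h2⟩ w
    rw [sum_integral_contact hΩ hE hz h3 h4, h6]
    simp_rw [h5, mul_zero, Finset.sum_const_zero]
    ring
  · intro h
    obtain ⟨g, h3, h4⟩ := exists_currentDensity hΩ hE hz v' V'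
    simp_rw [sum_integral_contact hΩ hE hz h3 h4] at h
    have h0 : ∀ w : H1 Ω, energy γ v' w = -energy η v w + ∫ x, g x * trace w x ∂(surf Ω) := by
      intro w
      have h5 := h w 0
      have h6 : ∑ j, (0 : RDiamond k).1 j * ∫ x in E j, g x ∂(surf Ω) = 0 :=
        Finset.sum_eq_zero fun j _ => zero_mul _
      rw [h6] at h5
      linarith
    obtain ⟨h1, h2⟩ := (sensitivityEq_and_hasConormalDerivative_iff hΩ hη v v' g).2 h0
    refine ⟨h1, g, h2, h3, h4, ?_⟩
    set a : Fin k → ℝ := fun j => ∫ x in E j, g x ∂(surf Ω) with ha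
    -- Testing with the constant one shows that the total current vanishes, so the vector of the
    -- currents is itself an admissible test vector.
    have hsum : ∑ j, a j = 0 := by
      have := hΩ.isFiniteMeasure_surf
      rw [ha, ← integral_eq_sum_electrodes hE ((Lp.memLp g).integrable one_le_two) h3,
        ← inner_trace_oneH1 hΩ, real_inner_comm, inner_traceL_eq_integral]
      have h5 := h0 (oneH1 hΩ)
      rw [energy_oneH1, energy_oneH1] at h5
      linarith
    have hsq : ∑ j, a j * a j = 0 := by
      have h5 : ∑ j, a j * ∫ x in E j, g x ∂(surf Ω) = 0 := by
        have h6 := h 0 ⟨WithLp.toLp 2 a, hsum⟩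
        rw [h0] at h6
        change _ + (_ + ∑ j, a j * ∫ x in E j, g x ∂(surf Ω)) = _ at h6
        linarith
      exact h5
    intro j
    have h5 := (Finset.sum_eq_zero_iff_of_nonneg fun i _ => mul_self_nonneg (a i)).1 hsq j
      (Finset.mem_univ j)
    exact mul_self_eq_zero.1 h5

theorem existsUnique_isCEMSensitivity (hΩ : IsBoundedLipschitzDomain Ω)
    (hfr : (frontier Ω).Nonempty) (hk : 1 ≤ k) (hE : IsElectrodes Ω E) (hz : ∀ j, 0 < z j)
    {γ η : Linfty Ω} (hγ : γ ∈ LinftyPlus Ω) (hη : CompactlySupported η) (v : H1 Ω) :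
    ∃! p : H1 Ω × RDiamond k, IsCEMSensitivity E z γ η v p.1 p.2 := by
  simp_rw [isCEMSensitivity_iff hΩ hE hz hη v 0]
  exact existsUnique_pair_of_isUnit (isUnit_contactOp_add hΩ hfr hk hE hz hγ) _

theorem analyticAt_cemMap (hΩ : IsBoundedLipschitzDomain Ω) (hfr : (frontier Ω).Nonempty)
    (hk : 1 ≤ k) (hE : IsElectrodes Ω E) (hz : ∀ j, 0 < z j) {γ : Linfty Ω}
    (hγ : γ ∈ LinftyPlus Ω) : AnalyticAt ℝ (cemMap Ω E z) γ :=
  (analyticAt_solOp (isUnit_contactOp_add hΩ hfr hk hE hz hγ)).congr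
    (cemMap_eventuallyEq hΩ hfr hk hE hz hγ).symm

theorem fderiv_cemMap_apply (hΩ : IsBoundedLipschitzDomain Ω) (hfr : (frontier Ω).Nonempty)
    (hk : 1 ≤ k) (hE : IsElectrodes Ω E) (hz : ∀ j, 0 < z j) {γ η : Linfty Ω}
    (hγ : γ ∈ LinftyPlus Ω) (hη : CompactlySupported η) {I : RDiamond k} {v v' : H1 Ω}
    {V V' : RDiamond k} (hv : IsCEMSolution E z γ I v V)
    (hv' : IsCEMSensitivity E z γ η v v' V') : fderiv ℝ (cemMap Ω E z) γ η I = V' := by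
  rw [(cemMap_eventuallyEq hΩ hfr hk hE hz hγ).fderiv_eq]
  exact fderiv_solOp_apply (isUnit_contactOp_add hΩ hfr hk hE hz hγ)
    ((isCEMSolution_iff hΩ γ I v V).1 hv) ((isCEMSensitivity_iff hΩ hE hz hη v V v' V').1 hv')

end Electrodes

end EIT

end

theorem propositionB1 {n : ℕ} (hn : n = 2 ∨ n = 3) (Ω : Set (EIT.Space n))
    (hΩ : EIT.IsBoundedLipschitzDomain Ω) :
    -- the continuum model
    ((∀ γ ∈ EIT.LinftyPlus Ω,
        (∀ f : EIT.L2Diamond Ω, ∃! u : EIT.H1 Ω, EIT.IsCMSolution γ f u) ∧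
        EIT.IsNDMap γ (EIT.ndMap Ω γ)) ∧
      AnalyticOnNhd ℝ (EIT.ndMap Ω) (EIT.LinftyPlus Ω) ∧
      (∀ γ ∈ EIT.LinftyPlus Ω, ContDiffAt ℝ (⊤ : ℕ∞) (EIT.ndMap Ω) γ) ∧
      ∀ γ ∈ EIT.LinftyPlus Ω, ∀ η : EIT.Linfty Ω, EIT.CompactlySupported η →
        ∀ (f : EIT.L2Diamond Ω) (u : EIT.H1 Ω), EIT.IsCMSolution γ f u →
          (∃! u' : EIT.H1 Ω, EIT.IsCMSensitivity γ η u u') ∧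
          ∀ u' : EIT.H1 Ω, EIT.IsCMSensitivity γ η u u' →
            ((fderiv ℝ (EIT.ndMap Ω) γ η f : EIT.L2Diamond Ω) : Lp ℝ 2 (EIT.surf Ω))
              = EIT.trace u') ∧
    -- the complete electrode model
    ∀ (k : ℕ), 1 ≤ k → ∀ (E : Fin k → Set (EIT.Space n)), EIT.IsElectrodes Ω E →
      ∀ (z : Fin k → ℝ), (∀ j, 0 < z j) →
      (∀ γ ∈ EIT.LinftyPlus Ω,
        (∀ I : EIT.RDiamond k,
          ∃! p : EIT.H1 Ω × EIT.RDiamond k, EIT.IsCEMSolution E z γ I p.1 p.2) ∧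
        EIT.IsCEMMap E z γ (EIT.cemMap Ω E z γ)) ∧
      AnalyticOnNhd ℝ (EIT.cemMap Ω E z) (EIT.LinftyPlus Ω) ∧
      (∀ γ ∈ EIT.LinftyPlus Ω, ContDiffAt ℝ (⊤ : ℕ∞) (EIT.cemMap Ω E z) γ) ∧
      ∀ γ ∈ EIT.LinftyPlus Ω, ∀ η : EIT.Linfty Ω, EIT.CompactlySupported η →
        ∀ (I : EIT.RDiamond k) (v : EIT.H1 Ω) (V : EIT.RDiamond k),
          EIT.IsCEMSolution E z γ I v V →
          (∃! p : EIT.H1 Ω × EIT.RDiamond k, EIT.IsCEMSensitivity E z γ η v p.1 p.2) ∧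
          ∀ (v' : EIT.H1 Ω) (V' : EIT.RDiamond k), EIT.IsCEMSensitivity E z γ η v v' V' →
            fderiv ℝ (EIT.cemMap Ω E z) γ η I = V' := by
  have hfr := hΩ.nonempty_frontier (by omega)
  have := EIT.completeSpace_L2Diamond hΩ
  refine ⟨⟨fun γ hγ => ⟨EIT.existsUnique_isCMSolution hΩ hfr hγ, EIT.isNDMap_ndMap hΩ hfr hγ⟩,
    fun γ hγ => EIT.analyticAt_ndMap hΩ hfr hγ,
    fun γ hγ => (EIT.analyticAt_ndMap hΩ hfr hγ).contDiffAt,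
    fun γ hγ η hη f u hu => ⟨EIT.existsUnique_isCMSensitivity hΩ hfr hγ hη u,
      fun u' hu' => EIT.fderiv_ndMap_apply hΩ hfr hγ hη hu hu'⟩⟩,
    fun k hk E hE z hz => ⟨fun γ hγ => ⟨EIT.existsUnique_isCEMSolution hΩ hfr hk hE hz hγ,
      EIT.isCEMMap_cemMap hΩ hfr hk hE hz hγ⟩,
    fun γ hγ => EIT.analyticAt_cemMap hΩ hfr hk hE hz hγ,
    fun γ hγ => (EIT.analyticAt_cemMap hΩ hfr hk hE hz hγ).contDiffAt,
    fun γ hγ η hη I v V hv => ⟨EIT.existsUnique_isCEMSensitivity hΩ hfr hk hE hz hγ hη v,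
      fun v' V' hv' => EIT.fderiv_cemMap_apply hΩ hfr hk hE hz hγ hη hv hv'⟩⟩⟩
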